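/- All vector spaces are over $\mathbb{C}$, and for a vector space $W$ write $\mathcal{E}(W)=\mathrm{Hom}(W,W((x)))$. **Definitions.** Let $H$ be a vector space with a bilinear form $\langle\cdot,\cdot\rangle$ and let $\mathcal{S}(x):H\otimes H\to H\otimes H\otimes\mathbb{C}((x))$ be a linear map. For a module $W$ over the tensor algebra $T(H\otimes\mathbb{C}[t,t^{-1}])$, let $a(m)$ be the operator on $W$ given by $a\otimes t^m$, and put $a(x)=\sum_{m\in\mathbb{Z}}a(m)x^{-m-1}$. An *$(H,\mathcal{S})$-module* is such a module $W$ such that for all $a\in H$, $w\in W$ one has $a(m)w=0$ for $m$ sufficiently large, and for all $a,b\in H$, $w\in W$ $$a(x_1)b(x_2)w-\sum_{i=1}^r f_i(x_2-x_1)\,b^{(i)}(x_2)a^{(i)}(x_1)w=x_2^{-1}\delta\!\left(\frac{x_1}{x_2}\right)\langle a,b\rangle w,$$ where $\mathcal{S}(x)(b\otimes a)=\sum_{i=1}^r b^{(i)}\otimes a^{(i)}\otimes f_i(x)$ and $f_i(x_2-x_1)$ is expanded in nonnegative powers of $x_1$. A vector $e\in W$ is *vacuum-like* if $a(m)e=0$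 for all $a\in H$, $m\ge 0$. A *vacuum $(H,\mathcal{S})$-module* is an $(H,\mathcal{S})$-module generated, as a $T(H\otimes\mathbb{C}[t,t^{-1}])$-module, by a vacuum-like vector $e$. It is *universal*, with generator $e$, if for every vacuum $(H,\mathcal{S})$-module $W'$ with vacuum-like generator $e'$ there is a unique homomorphism of $T(H\otimes\mathbb{C}[t,t^{-1}])$-modules to $W'$ sending $e$ to $e'$. A *weak quantum vertex algebra* is a vector space $V$ with a vector $\mathbf{1}$ and a linear map $Y(\cdot,x):V\to\mathcal{E}(V)$ such that $Y(\mathbf{1},x)v=v$, $Y(v,x)\mathbf{1}\in V[[x]]$ and $\lim_{x\to0}Y(v,x)\mathbf{1}=v$ for all $v\in V$, and such that for all $u,v\in V$ there is $\sum_{i=1}^r v^{(i)}\otimes u^{(i)}\otimes f_i(x)\in V\otimes V\otimes\mathbb{C}((x))$ with $$x_0^{-1}\delta\!\left(\frac{x_1-x_2}{x_0}\right)Y(u,x_1)Y(v,x_2)-x_0^{-1}\delta\!\left(\frac{x_2-x_1}{-x_0}\right)\sum_{i=1}^r f_i(-x_0)Y(v^{(i)},x_2)Y(u^{(i)},x_1)=x_2^{-1}\delta\!\left(\frac{x_1-x_0}{x_2}\right)Y(Y(u,x_0)v,x_2).$$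 A *$V$-module* structure on a vector space $W$ is a linear map $Y_W(\cdot,x):V\to\mathcal{E}(W)$ such that $Y_W(\mathbf{1},x)=1_W$ and for all $u,v\in V$, $w\in W$ there is $l\in\mathbb{N}$ with $$(x_0+x_2)^lY_W(u,x_0+x_2)Y_W(v,x_2)w=(x_0+x_2)^lY_W(Y(u,x_0)v,x_2)w.$$ (Here, as usual, powers of a binomial are expanded in nonnegative powers of its second variable.) **Proposition.** Let $H$ be a vector space equipped with a bilinear form $\langle\cdot,\cdot\rangle$ and let $\mathcal{S}(x):H\otimes H\to H\otimes H\otimes\mathbb{C}((x))$ be a linear map. Suppose that $V(H,\mathcal{S})$ is a universal vacuum $(H,\mathcal{S})$-module with vacuum-like generator $\mathbf{1}$, and that the linear map $H\to V(H,\mathcal{S})$, $a\mapsto a(-1)\mathbf{1}$, is injective. Then there exists a unique weak quantum vertex algebra structure $Y$ on $V(H,\mathcal{S})$ with $\mathbf{1}$ as the vacuum vector such that $$Y(a(-1)\mathbf{1},x)=a(x)\quad\text{for }a\in H.$$ Furthermore, on any $(H,\mathcal{S})$-module $W$ there exists a unique $V(H,\mathcal{S})$-module structure $Y_W$ such that $$Y_W(a(-1)\mathbf{1},x)=a(x)\quad\text{for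 }a\in H.$$ -/

import Mathlib

open scoped TensorProduct

universe u v w

namespace QVA

noncomputable section

/-! ### Formal series

A formal series is handled through its coefficients. A field `a(x) = ∑ₙ aₙ x^{-n-1}` is given by
its modes `aₙ`. Mathlib's `VertexOperator ℂ W` is the space `Hom(W, W((x)))`, and
`VertexOperator.ncoeff A n` is the mode `Aₙ`. A negative power of a binomial is expanded in
nonnegative powers of its second variable:
`(x + y)^k = ∑_{i ≥ 0} C(k, i) x^{k-i} y^i` for every integer `k`, where `C(k, i)` is
`Ring.choose k i`. All the `finsum`s below have finite support as soon as, for each vector `w`,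
the modes `aₙ w`, `bₙ w` vanish for `n` sufficiently large. -/

/-- The coefficient of `x₁^{-m-1} x₂^{-n-1}` in `(x₁ - x₂)^l a(x₁) b(x₂) w`. -/
def prodCoeff {W : Type*} [AddCommGroup W] [Module ℂ W]
    (l : ℤ) (a b : ℤ → W → W) (m n : ℤ) (w : W) : W :=
  ∑ᶠ i : ℕ, ((-1 : ℂ) ^ i * (Ring.choose l i : ℤ)) • a (m + l - i) (b (n + i) w)

/-- The coefficient of `x₁^{-m-1} x₂^{-n-1}` in `(x₂ - x₁)^l f(x₂ - x₁) b(x₂) a(x₁) w`, where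
`f(x) = ∑ₛ fₛ x^s` is a formal Laurent series and `f(x₂ - x₁) = ∑ₛ fₛ (x₂ - x₁)^s` is expanded in
nonnegative powers of `x₁`. -/
def swapCoeff {W : Type*} [AddCommGroup W] [Module ℂ W]
    (l : ℤ) (f : LaurentSeries ℂ) (b a : ℤ → W → W) (m n : ℤ) (w : W) : W :=
  ∑ᶠ i : ℕ, ∑ᶠ s : ℤ,
    ((-1 : ℂ) ^ i * (Ring.choose (l + s) i : ℤ) * f.coeff s) •
      b (n + l + s - i) (a (m + i) w)

/-! ### Weak quantum vertex algebras and their modules -/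

/-- The mode `vₙ`, acting on `W`, where `Y_W(v, x) = ∑ₙ vₙ x^{-n-1}`. -/
def vmode {V : Type*} [AddCommGroup V] [Module ℂ V] {W : Type*} [AddCommGroup W] [Module ℂ W]
    (YW : V →ₗ[ℂ] VertexOperator ℂ W) (v : V) (n : ℤ) : W → W :=
  fun w => VertexOperator.ncoeff (YW v) n w

/-- The `S`-Jacobi identity for `u`, `v` and the tensor `∑ⱼ v'ⱼ ⊗ u'ⱼ ⊗ fⱼ(x)`:
`x₀⁻¹ δ((x₁ - x₂)/x₀) Y(u, x₁) Y(v, x₂)`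
`  - x₀⁻¹ δ((x₂ - x₁)/(-x₀)) ∑ⱼ fⱼ(-x₀) Y(v'ⱼ, x₂) Y(u'ⱼ, x₁)`
`  = x₂⁻¹ δ((x₁ - x₀)/x₂) Y(Y(u, x₀) v, x₂)`.
The equation below compares the coefficients of `x₀^{-l-1} x₁^{-m-1} x₂^{-n-1}`, applied to `w`.
In the second term, `x₀⁻¹ δ((x₂ - x₁)/(-x₀)) f(-x₀)` has the coefficient
`(-1)^l (x₂ - x₁)^l f(x₂ - x₁)` at `x₀^{-l-1}`; on the right the coefficient is
`∑ᵢ (-1)^i C(i-m-1, i) (u_{l+i} v)_{m+n-i} w`, and `(-1)^i C(i-m-1, i) = C(m, i)`. -/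
def SJacobi {V : Type*} [AddCommGroup V] [Module ℂ V] (Y : V →ₗ[ℂ] VertexOperator ℂ V)
    (u v : V) {r : ℕ} (v' u' : Fin r → V) (f : Fin r → LaurentSeries ℂ) : Prop :=
  ∀ (l m n : ℤ) (w : V),
    prodCoeff l (vmode Y u) (vmode Y v) m n w
      - (-1 : ℂ) ^ l • ∑ j, swapCoeff l (f j) (vmode Y (v' j)) (vmode Y (u' j)) m n w
    = ∑ᶠ i : ℕ, (Ring.choose m i : ℤ) • vmode Y (vmode Y u (l + i) v) (m + n - i) w

/-- `(V, Y, 𝟏)` is a weak quantum vertex algebra. -/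
structure IsWeakQVA {V : Type*} [AddCommGroup V] [Module ℂ V]
    (one : V) (Y : V →ₗ[ℂ] VertexOperator ℂ V) : Prop where
  /-- `Y(𝟏, x) v = v`. -/
  vacuum : ∀ (n : ℤ) (v : V), vmode Y one n v = if n = -1 then v else 0
  /-- `Y(v, x) 𝟏` has no negative powers of `x`. -/
  creation_regular : ∀ (v : V) (n : ℤ), 0 ≤ n → vmode Y v n one = 0
  /-- The constant term of `Y(v, x) 𝟏` is `v`. -/
  creation : ∀ v : V, vmode Y v (-1) one = v
  /-- The `S`-Jacobi identity holds, for some element `∑ⱼ v'ⱼ ⊗ u'ⱼ ⊗ fⱼ(x)` of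
  `V ⊗ V ⊗ ℂ((x))`. -/
  jacobi : ∀ u v : V, ∃ (r : ℕ) (v' u' : Fin r → V) (f : Fin r → LaurentSeries ℂ),
    SJacobi Y u v v' u' f

/-- `(W, Y_W)` is a module for `(V, Y, 𝟏)`, viewed as a nonlocal vertex algebra. -/
structure IsVAModule {V : Type*} [AddCommGroup V] [Module ℂ V]
    (one : V) (Y : V →ₗ[ℂ] VertexOperator ℂ V)
    {W : Type*} [AddCommGroup W] [Module ℂ W] (YW : V →ₗ[ℂ] VertexOperator ℂ W) : Prop where
  /-- `Y_W(𝟏, x)` is the identity. -/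
  vacuum : ∀ (n : ℤ) (w : W), vmode YW one n w = if n = -1 then w else 0
  /-- Weak associativity: for some `l`,
  `(x₀ + x₂)^l Y_W(u, x₀ + x₂) Y_W(v, x₂) w = (x₀ + x₂)^l Y_W(Y(u, x₀) v, x₂) w`.
  The equation compares the coefficients of `x₀^{-m-1} x₂^{-n-1}`; on the left,
  `(x₀ + x₂)^l u(x₀ + x₂) = ∑ₖ uₖ (x₀ + x₂)^{l-k-1}`, expanded in nonnegative powers of `x₂`. -/
  weak_assoc : ∀ (u v : V) (w : W), ∃ l : ℕ, ∀ m n : ℤ,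
    ∑ᶠ i : ℕ, (Ring.choose (i - m - 1) i : ℤ) • vmode YW u (m + l - i) (vmode YW v (n + i) w)
    = ∑ i ∈ Finset.range (l + 1),
        (l.choose i) • vmode YW (vmode Y u (m + l - i) v) (n + i) w

/-! ### `(H, S)`-modules -/

/-- The tensor algebra `T(H ⊗ ℂ[t, t⁻¹])`. -/
abbrev ModeAlgebra (H : Type u) [AddCommGroup H] [Module ℂ H] : Type u :=
  TensorAlgebra ℂ (H ⊗[ℂ] LaurentPolynomial ℂ)

/-- The generator `a(m) = a ⊗ t^m` of `T(H ⊗ ℂ[t, t⁻¹])`. -/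
def mode {H : Type u} [AddCommGroup H] [Module ℂ H] (a : H) (m : ℤ) : ModeAlgebra H :=
  TensorAlgebra.ι ℂ (a ⊗ₜ[ℂ] (LaurentPolynomial.T m : LaurentPolynomial ℂ))

/-- The operator `a(m)` on a module for `T(H ⊗ ℂ[t, t⁻¹])`. -/
def act {H : Type u} [AddCommGroup H] [Module ℂ H] {W : Type w} [AddCommGroup W]
    [Module (ModeAlgebra H) W] (a : H) (m : ℤ) : W → W :=
  fun x => mode a m • x

/-- The `T(H ⊗ ℂ[t, t⁻¹])`-module `W` is an `(H, S)`-module, where `B` is the bilinear form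
on `H`. The relation
`a(x₁) b(x₂) w - ∑ⱼ fⱼ(x₂ - x₁) b'ⱼ(x₂) a'ⱼ(x₁) w = x₂⁻¹ δ(x₁/x₂) B(a, b) w`
is written for the coefficients of `x₁^{-m-1} x₂^{-n-1}`. Under the truncation condition it does
not depend on the way in which `S(b ⊗ a)` is written as a sum of pure tensors. -/
structure IsHSModule {H : Type u} [AddCommGroup H] [Module ℂ H] (B : LinearMap.BilinForm ℂ H)
    (S : H ⊗[ℂ] H →ₗ[ℂ] (H ⊗[ℂ] H) ⊗[ℂ] LaurentSeries ℂ)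
    (W : Type w) [AddCommGroup W] [Module ℂ W] [Module (ModeAlgebra H) W] : Prop where
  truncation : ∀ (a : H) (x : W), ∃ N : ℤ, ∀ m : ℤ, N ≤ m → act a m x = 0
  relation : ∀ (a b : H) (r : ℕ) (b' a' : Fin r → H) (f : Fin r → LaurentSeries ℂ),
    S (b ⊗ₜ[ℂ] a) = ∑ j, (b' j ⊗ₜ[ℂ] a' j) ⊗ₜ[ℂ] f j →
    ∀ (m n : ℤ) (x : W),
      act a m (act b n x) - ∑ j, swapCoeff 0 (f j) (act (b' j)) (act (a' j)) m n x
        = if m + n + 1 = 0 then B a b • x else 0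

/-- `e` is a vacuum-like vector. -/
def IsVacuumLike (H : Type u) [AddCommGroup H] [Module ℂ H]
    {W : Type w} [AddCommGroup W] [Module (ModeAlgebra H) W] (e : W) : Prop :=
  ∀ (a : H) (m : ℤ), 0 ≤ m → act a m e = 0

/-- `W` is a vacuum `(H, S)`-module, cyclic on the vacuum-like vector `e`. -/
structure IsVacuumModule {H : Type u} [AddCommGroup H] [Module ℂ H]
    (B : LinearMap.BilinForm ℂ H) (S : H ⊗[ℂ] H →ₗ[ℂ] (H ⊗[ℂ] H) ⊗[ℂ] LaurentSeries ℂ)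
    (W : Type w) [AddCommGroup W] [Module ℂ W] [Module (ModeAlgebra H) W] (e : W) : Prop where
  isHSModule : IsHSModule B S W
  vacuumLike : IsVacuumLike H e
  cyclic : Submodule.span (ModeAlgebra H) {e} = ⊤

/-- `V` is a universal vacuum `(H, S)`-module with the vacuum-like generator `one`: it maps,
uniquely, to every vacuum `(H, S)`-module, with `one` going to the given vacuum-like generator.
Since a vacuum module is a quotient of `ModeAlgebra H : Type u`, it is enough to let the test
modules range over `Type u`. -/
structure IsUniversalVacuumModule {H : Type u} [AddCommGroup H] [Module ℂ H]
    (B : LinearMap.BilinForm ℂ H) (S : H ⊗[ℂ] H →ₗ[ℂ] (H ⊗[ℂ] H) ⊗[ℂ] LaurentSeries ℂ)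
    (V : Type v) [AddCommGroup V] [Module ℂ V] [Module (ModeAlgebra H) V] (one : V) : Prop where
  isVacuumModule : IsVacuumModule B S V one
  universal : ∀ (W : Type u) [AddCommGroup W] [Module ℂ W] [Module (ModeAlgebra H) W]
    [IsScalarTower ℂ (ModeAlgebra H) W] (e : W), IsVacuumModule B S W e →
    ∃! φ : V →ₗ[ModeAlgebra H] W, φ one = e

end

end QVA

/-!
# Weak quantum vertex algebras from universal vacuum modules

Let `W` be an `(H, S)`-module. For a series `g(z)` in `W((z))`, the product `a(y + z) g(z)` may have
arbitrarily negative powers of `y`, but if `(y + z)^m a(y + z) g(z)` has not, then there is a unique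
series in `y`, truncated from below, which agrees with `a(y + z) g(z)` up to a power of `y + z`; it
is called the re-expansion (`IsReexp`). The series `g` for which this works for all `a` form a space
(`reexpSpace`) on which the coefficients of the re-expansions act. Since the `S`-relation and the
delta function are invariant under the translation `x ↦ x + z`, `y ↦ y + z`, these operators satisfy
the `S`-relation again, and the space is an `(H, S)`-module (`IsHSModes.isHSModes_reexpModes`) in
which each constant series `w` is vacuum-like. By universality there is a homomorphism from `V` to
it which sends `one` to `w`. The image of `v` is `Y_W(v, z) w`. This defines the vertex operators
(`IsUniversalVacuumModule.vertexOp`), both on `W` and on `V`, and they are characterized by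
`Y_W(one, z) = 1` and by the rule that `Y_W(Y(a, y) v, z) w` is the re-expansion of
`a(y + z) Y_W(v, z) w` (`IsFieldAction`). Weak associativity is an instance of this rule for
`u = a(-1) one`, and follows in general by induction on `u` (`IsFieldAction.weakAssoc`).
Uniqueness is clear from the rule, because `V` is generated by `one` (`IsFieldAction.ext`).

It remains to prove the `S`-Jacobi identity on `V`. All three terms satisfy the same recursion, so
that the identity follows from weak associativity for `u`, `v` and for `v'`, `u'` once
`e^{xD} Y(u, -x) v = ∑ f(x) Y(v', x) u'` for a finite sum on the right (`IsFieldAction.sJacobi`).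
Here `D v = v_{-2} one`, and `e^{xD} c(x)` is defined directly through the creation property (`theta`).
That `e^{xD} Y(u, -x) v` lies in the `ℂ((x))`-span of the series `Y(v', x) u'` is proved for
`u = a(-1) one` by induction on `v`, with the help of the `S`-relation
(`inSpan_skew_act_neg_one`). It gives the Jacobi identity, hence locality, for `a(x)` and every
`Y(v, x)`, and then the general case by induction on `u` (`inSpan_skew_act`).

Throughout, a series `∑ F q n y^{-q-1} z^{-n-1}` is encoded by the function `F` of its modes.
-/

namespace QVA

noncomputable section

set_option linter.unusedSectionVars false

/-! ### Expansions of `(x - y)^s` -/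

/-- The coefficient of `x^{s-i} y^i` in `(x - y)^s`, expanded in nonnegative powers of `y`. -/
def bc (s : ℤ) (i : ℕ) : ℂ := (-1 : ℂ) ^ i * (Ring.choose s i : ℤ)

@[simp] lemma bc_zero_right (s : ℤ) : bc s 0 = 1 := by simp [bc]

@[simp] lemma bc_zero_succ (i : ℕ) : bc 0 (i + 1) = 0 := by
  simp [bc, Ring.choose_zero_succ]

lemma bc_succ_succ (s : ℤ) (i : ℕ) : bc (s + 1) (i + 1) = bc s (i + 1) - bc s i := by
  simp only [bc, Ring.choose_succ_succ]
  push_cast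
  ring

lemma bc_natCast (k i : ℕ) : bc k i = (-1 : ℂ) ^ i * (k.choose i : ℂ) := by
  simp [bc, Ring.choose_natCast]

section Bin

variable {W : Type*} [AddCommGroup W] [Module ℂ W]

/-- If `G p q` is the coefficient of `x^{-p-1} y^{-q-1}` in `G(x, y)`, then `bin s G p q` is the
coefficient of `x^{-p-1} y^{-q-1}` in `(x - y)^s G(x, y)`. -/
def bin (s : ℤ) (G : ℤ → ℤ → W) (p q : ℤ) : W :=
  ∑ᶠ i : ℕ, bc s i • G (p + s - i) (q + i)

/-- The powers of the second variable are bounded below, uniformly in the first variable. -/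
def STrunc (G : ℤ → ℤ → W) : Prop := ∃ K : ℤ, ∀ p q, K ≤ q → G p q = 0

/-- `G(x, y)` lies in `W((x))((y))`. -/
def Lau (G : ℤ → ℤ → W) : Prop :=
  STrunc G ∧ ∀ q₀ : ℤ, ∃ P : ℤ, ∀ p q, P ≤ p → q₀ ≤ q → G p q = 0

lemma finsum_nat_eq_range {f : ℕ → W} (N : ℕ) (h : ∀ i, N ≤ i → f i = 0) :
    ∑ᶠ i, f i = ∑ i ∈ Finset.range N, f i := by
  apply finsum_eq_sum_of_support_subset
  intro i hi
  by_contra hc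
  simp only [Finset.coe_range, Set.mem_Iio, not_lt] at hc
  exact hi (h i hc)

lemma finsum_int_eq_Ico {f : ℤ → W} (a b : ℤ) (ha : ∀ s, s < a → f s = 0)
    (hb : ∀ s, b ≤ s → f s = 0) : ∑ᶠ s, f s = ∑ s ∈ Finset.Ico a b, f s := by
  apply finsum_eq_sum_of_support_subset
  intro i hi
  by_contra hc
  simp only [Finset.coe_Ico, Set.mem_Ico, not_and_or, not_le, not_lt] at hc
  exact hi (hc.elim (ha i) (hb i))

lemma bin_eq_sum {G : ℤ → ℤ → W} {s p q : ℤ} (N : ℕ)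
    (h : ∀ i : ℕ, N ≤ i → G (p + s - i) (q + i) = 0) :
    bin s G p q = ∑ i ∈ Finset.range N, bc s i • G (p + s - i) (q + i) :=
  finsum_nat_eq_range N fun i hi => by rw [h i hi, smul_zero]

lemma bin_eq_sum_of_le {G : ℤ → ℤ → W} {K : ℤ} (hK : ∀ p q, K ≤ q → G p q = 0) {s p q : ℤ}
    {N : ℕ} (hN : K ≤ q + N) :
    bin s G p q = ∑ i ∈ Finset.range N, bc s i • G (p + s - i) (q + i) :=
  bin_eq_sum N fun i hi => hK _ _ (by omega)

lemma STrunc.exists_nat {G : ℤ → ℤ → W} (h : STrunc G) (q : ℤ) :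
    ∃ N : ℕ, ∀ s p, bin s G p q = ∑ i ∈ Finset.range N, bc s i • G (p + s - i) (q + i) := by
  obtain ⟨K, hK⟩ := h
  exact ⟨(K - q).toNat, fun s p => bin_eq_sum_of_le hK (by omega)⟩

lemma bin_eq_zero {G : ℤ → ℤ → W} {s p q : ℤ} (h : ∀ p' q', q ≤ q' → G p' q' = 0) :
    bin s G p q = 0 := by
  rw [bin_eq_sum_of_le (K := q) h (N := 0) (by simp)]; simp

@[simp] lemma bin_zero (G : ℤ → ℤ → W) (p q : ℤ) : bin 0 G p q = G p q := by
  rw [bin, finsum_nat_eq_range 1]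
  · simp
  · intro i hi
    obtain ⟨j, rfl⟩ : ∃ j, i = j + 1 := ⟨i - 1, by omega⟩
    simp

lemma bin_succ {G : ℤ → ℤ → W} (h : STrunc G) (s p q : ℤ) :
    bin (s + 1) G p q = bin s G (p + 1) q - bin s G p (q + 1) := by
  obtain ⟨K, hK⟩ := h
  obtain ⟨N, hN⟩ : ∃ N : ℕ, K ≤ q + N := ⟨(K - q).toNat, by omega⟩
  rw [bin_eq_sum_of_le hK (N := N + 1) (by push_cast; omega),
    bin_eq_sum_of_le hK (N := N + 1) (q := q) (p := p + 1) (by push_cast; omega),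
    bin_eq_sum_of_le hK (N := N) (q := q + 1) (by omega), Finset.sum_range_succ',
    Finset.sum_range_succ']
  have key : ∀ A B C D : W, A = B - D → A + C = B + C - D := fun A B C D h => by rw [h]; abel
  have e : G (p + (s + 1) - ((0 : ℕ) : ℤ)) (q + ((0 : ℕ) : ℤ))
      = G (p + 1 + s - ((0 : ℕ) : ℤ)) (q + ((0 : ℕ) : ℤ)) := by congr 1; ring
  simp only [bc_zero_right, e]
  apply key
  rw [← Finset.sum_sub_distrib]
  refine Finset.sum_congr rfl fun i _ => ?_
  have e1 : p + (s + 1) - ((i + 1 : ℕ) : ℤ) = p + s - i := by push_cast; ring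
  have e2 : p + 1 + s - ((i + 1 : ℕ) : ℤ) = p + s - i := by push_cast; ring
  have e3 : q + ((i + 1 : ℕ) : ℤ) = q + 1 + i := by push_cast; ring
  rw [e1, e2, e3, bc_succ_succ, sub_smul]

lemma bin_shift (G : ℤ → ℤ → W) (s p q a b : ℤ) :
    bin s (fun p q => G (p + a) (q + b)) p q = bin s G (p + a) (q + b) := by
  unfold bin
  refine finsum_congr fun i => ?_
  congr 2
  ring_nf

lemma STrunc.add {G G' : ℤ → ℤ → W} (h : STrunc G) (h' : STrunc G') :
    STrunc (fun p q => G p q + G' p q) := by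
  obtain ⟨K, hK⟩ := h
  obtain ⟨K', hK'⟩ := h'
  exact ⟨max K K', fun p q hq => by
    simp only [hK p q (by omega), hK' p q (by omega), add_zero]⟩

lemma Lau.add {G G' : ℤ → ℤ → W} (h : Lau G) (h' : Lau G') :
    Lau (fun p q => G p q + G' p q) := by
  refine ⟨h.1.add h'.1, fun q₀ => ?_⟩
  obtain ⟨K, hK⟩ := h.2 q₀
  obtain ⟨K', hK'⟩ := h'.2 q₀
  exact ⟨max K K', fun p q hp hq => by
    simp only [hK p q (by omega) hq, hK' p q (by omega) hq, add_zero]⟩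

lemma STrunc.shift {G : ℤ → ℤ → W} (h : STrunc G) (a b : ℤ) :
    STrunc (fun p q => G (p + a) (q + b)) := by
  obtain ⟨K, hK⟩ := h
  exact ⟨K - b, fun p q hq => hK _ _ (by omega)⟩

lemma Lau.shift {G : ℤ → ℤ → W} (h : Lau G) (a b : ℤ) :
    Lau (fun p q => G (p + a) (q + b)) := by
  refine ⟨h.1.shift a b, fun q₀ => ?_⟩
  obtain ⟨K, hK⟩ := h.2 (q₀ + b)
  exact ⟨K - a, fun p q hp hq => hK _ _ (by omega) (by omega)⟩

lemma STrunc.map {W' : Type*} [AddCommGroup W'] [Module ℂ W'] (φ : W →ₗ[ℂ] W')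
    {G : ℤ → ℤ → W} (h : STrunc G) : STrunc (fun p q => φ (G p q)) := by
  obtain ⟨K, hK⟩ := h
  exact ⟨K, fun p q hq => by simp only [hK p q hq, map_zero]⟩

lemma bin_add {G G' : ℤ → ℤ → W} (h : STrunc G) (h' : STrunc G') (s p q : ℤ) :
    bin s (fun p q => G p q + G' p q) p q = bin s G p q + bin s G' p q := by
  obtain ⟨K, hK⟩ := h
  obtain ⟨K', hK'⟩ := h'
  obtain ⟨N, hN, hN'⟩ : ∃ N : ℕ, K ≤ q + N ∧ K' ≤ q + N :=
    ⟨(max K K' - q).toNat, by omega, by omega⟩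
  rw [bin_eq_sum_of_le hK hN, bin_eq_sum_of_le hK' hN', bin_eq_sum_of_le (K := max K K')
    (fun p q hq => by rw [hK _ _ (by omega), hK' _ _ (by omega), add_zero]) (N := N) (by omega),
    ← Finset.sum_add_distrib]
  simp only [smul_add]

lemma map_bin {W' : Type*} [AddCommGroup W'] [Module ℂ W'] (φ : W →ₗ[ℂ] W')
    {G : ℤ → ℤ → W} (h : STrunc G) (s p q : ℤ) :
    φ (bin s G p q) = bin s (fun p q => φ (G p q)) p q := by
  obtain ⟨K, hK⟩ := h
  obtain ⟨N, hN⟩ : ∃ N : ℕ, K ≤ q + N := ⟨(K - q).toNat, by omega⟩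
  rw [bin_eq_sum_of_le hK hN, bin_eq_sum_of_le (K := K)
    (fun p q hq => by rw [hK _ _ hq, map_zero]) hN, map_sum]
  simp only [map_smul]

lemma bin_smul {G : ℤ → ℤ → W} (h : STrunc G) (c : ℂ) (s p q : ℤ) :
    bin s (fun p q => c • G p q) p q = c • bin s G p q :=
  (map_bin (c • LinearMap.id) h s p q).symm

lemma bin_sub {G G' : ℤ → ℤ → W} (h : STrunc G) (h' : STrunc G') (s p q : ℤ) :
    bin s (fun p q => G p q - G' p q) p q = bin s G p q - bin s G' p q := by
  have := bin_add h (h'.map (-LinearMap.id)) s p q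
  rw [← map_bin (-LinearMap.id) h'] at this
  simpa [sub_eq_add_neg] using this

lemma STrunc.bin {G : ℤ → ℤ → W} (h : STrunc G) (s : ℤ) : STrunc (bin s G) := by
  obtain ⟨K, hK⟩ := h
  exact ⟨K, fun p q hq => bin_eq_zero fun p' q' h' => hK _ _ (by omega)⟩

/-- The bound in `Lau` for the first variable, for all powers `(x - y)^s` at once. -/
lemma Lau.exists_bound {G : ℤ → ℤ → W} (h : Lau G) (q₀ : ℤ) :
    ∃ P : ℤ, ∀ s p q, P ≤ p + s → q₀ ≤ q → QVA.bin s G p q = 0 := by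
  obtain ⟨⟨K, hK⟩, h2⟩ := h
  obtain ⟨P, hP⟩ := h2 q₀
  refine ⟨P + (K - q₀).toNat, fun s p q hp hq => ?_⟩
  rw [bin_eq_sum_of_le hK (N := (K - q₀).toNat) (by omega)]
  refine Finset.sum_eq_zero fun i hi => ?_
  rw [Finset.mem_range] at hi
  rw [hP _ _ (by omega) (by omega), smul_zero]

lemma Lau.bin {G : ℤ → ℤ → W} (h : Lau G) (s : ℤ) : Lau (bin s G) := by
  refine ⟨h.1.bin s, fun q₀ => ?_⟩
  obtain ⟨P, hP⟩ := h.exists_bound q₀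
  exact ⟨P - s, fun p q hp hq => hP _ _ _ (by omega) hq⟩

/-! ### Multiplication by a Laurent series in `x - y` -/

/-- The coefficient of `x^{-p-1} y^{-q-1}` in `(x - y)^l f(x - y) G(x, y)`, where `f(x - y)` is
expanded in nonnegative powers of `y`. -/
def tw (l : ℤ) (f : LaurentSeries ℂ) (G : ℤ → ℤ → W) (p q : ℤ) : W :=
  ∑ᶠ s : ℤ, f.coeff s • bin (l + s) G p q

lemma exists_coeff_bound (f : LaurentSeries ℂ) : ∃ s₀ : ℤ, ∀ s, s < s₀ → f.coeff s = 0 :=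
  ⟨f.order, fun _ hs => HahnSeries.coeff_eq_zero_of_lt_order hs⟩

lemma tw_eq_sum {f : LaurentSeries ℂ} {G : ℤ → ℤ → W} {l p q s₀ S : ℤ}
    (h₀ : ∀ s, s < s₀ → f.coeff s = 0) (hS : ∀ s, S ≤ s → bin (l + s) G p q = 0) :
    tw l f G p q = ∑ s ∈ Finset.Ico s₀ S, f.coeff s • bin (l + s) G p q :=
  finsum_int_eq_Ico _ _ (fun s hs => by rw [h₀ s hs, zero_smul])
    fun s hs => by rw [hS s hs, smul_zero]

/-- A common finite range of summation for `tw` at finitely many places. -/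
lemma Lau.tw_eq_sum {G : ℤ → ℤ → W} (h : Lau G) (q₀ : ℤ) : ∃ P : ℤ,
    ∀ (f : LaurentSeries ℂ) (s₀ l p q S : ℤ), (∀ s, s < s₀ → f.coeff s = 0) → q₀ ≤ q →
      P ≤ p + l + S → tw l f G p q = ∑ s ∈ Finset.Ico s₀ S, f.coeff s • QVA.bin (l + s) G p q := by
  obtain ⟨P, hP⟩ := h.exists_bound q₀
  exact ⟨P, fun f s₀ l p q S h₀ hq hS =>
    QVA.tw_eq_sum h₀ fun s hs => hP _ _ _ (by omega) hq⟩

lemma tw_succ {G : ℤ → ℤ → W} (h : Lau G) (f : LaurentSeries ℂ) (l p q : ℤ) :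
    tw (l + 1) f G p q = tw l f G (p + 1) q - tw l f G p (q + 1) := by
  obtain ⟨P, hP⟩ := h.tw_eq_sum q
  obtain ⟨s₀, h₀⟩ := exists_coeff_bound f
  rw [hP f s₀ (l + 1) p q (P - p - l) h₀ le_rfl (by omega),
    hP f s₀ l (p + 1) q (P - p - l) h₀ le_rfl (by omega),
    hP f s₀ l p (q + 1) (P - p - l) h₀ (by omega) (by omega), ← Finset.sum_sub_distrib]
  refine Finset.sum_congr rfl fun s _ => ?_
  rw [← smul_sub, ← bin_succ h.1]
  congr 2; ring

lemma tw_add {G G' : ℤ → ℤ → W} (h : Lau G) (h' : Lau G') (f : LaurentSeries ℂ) (l p q : ℤ) :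
    tw l f (fun p q => G p q + G' p q) p q = tw l f G p q + tw l f G' p q := by
  obtain ⟨P, hP⟩ := h.tw_eq_sum q
  obtain ⟨P', hP'⟩ := h'.tw_eq_sum q
  obtain ⟨P'', hP''⟩ := (h.add h').tw_eq_sum q
  obtain ⟨s₀, h₀⟩ := exists_coeff_bound f
  have key : ∃ S, P ≤ p + l + S ∧ P' ≤ p + l + S ∧ P'' ≤ p + l + S :=
    ⟨max P (max P' P'') - p - l, by omega, by omega, by omega⟩
  obtain ⟨S, h1, h2, h3⟩ := key
  rw [hP f s₀ l p q S h₀ le_rfl h1, hP' f s₀ l p q S h₀ le_rfl h2,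
    hP'' f s₀ l p q S h₀ le_rfl h3, ← Finset.sum_add_distrib]
  refine Finset.sum_congr rfl fun s _ => ?_
  rw [← smul_add, ← bin_add h.1 h'.1]

lemma tw_shift (G : ℤ → ℤ → W) (f : LaurentSeries ℂ) (l p q a b : ℤ) :
    tw l f (fun p q => G (p + a) (q + b)) p q = tw l f G (p + a) (q + b) := by
  unfold tw
  simp only [bin_shift]

lemma tw_eq_zero {G : ℤ → ℤ → W} {f : LaurentSeries ℂ} {l p q : ℤ}
    (h : ∀ p' q', q ≤ q' → G p' q' = 0) : tw l f G p q = 0 := by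
  unfold tw
  simp only [bin_eq_zero h, smul_zero, finsum_zero]

lemma STrunc.tw {G : ℤ → ℤ → W} (h : STrunc G) (l : ℤ) (f : LaurentSeries ℂ) :
    STrunc (tw l f G) := by
  obtain ⟨K, hK⟩ := h
  exact ⟨K, fun p q hq => tw_eq_zero fun p' q' h' => hK _ _ (by omega)⟩

lemma Lau.tw {G : ℤ → ℤ → W} (h : Lau G) (l : ℤ) (f : LaurentSeries ℂ) : Lau (tw l f G) := by
  refine ⟨h.1.tw l f, fun q₀ => ?_⟩
  obtain ⟨P, hP⟩ := h.tw_eq_sum q₀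
  obtain ⟨s₀, h₀⟩ := exists_coeff_bound f
  refine ⟨P - l - s₀, fun p q hp hq => ?_⟩
  rw [hP f s₀ l p q s₀ h₀ hq (by omega)]; simp

/-- Expanding `f(x - y)` by powers of `y` first. -/
lemma tw_eq_sum_sum {G : ℤ → ℤ → W} (h : Lau G) {q : ℤ} {N : ℕ}
    (hN : ∀ p q', q + N ≤ q' → G p q' = 0) (f : LaurentSeries ℂ) (l p : ℤ) :
    tw l f G p q = ∑ i ∈ Finset.range N, ∑ᶠ s : ℤ,
      (bc (l + s) i * f.coeff s) • G (p + l + s - i) (q + i) := by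
  obtain ⟨P, hP⟩ := h.tw_eq_sum q
  obtain ⟨P', hP'⟩ := h.2 q
  obtain ⟨s₀, h₀⟩ := exists_coeff_bound f
  obtain ⟨S, h1, h2⟩ : ∃ S, P ≤ p + l + S ∧ P' ≤ p + l + S - N :=
    ⟨max P (P' + N) - p - l, by omega, by omega⟩
  rw [hP f s₀ l p q S h₀ le_rfl h1]
  have : ∀ i ∈ Finset.range N, (∑ᶠ s : ℤ, (bc (l + s) i * f.coeff s) • G (p + l + s - i) (q + i))
      = ∑ s ∈ Finset.Ico s₀ S, (bc (l + s) i * f.coeff s) • G (p + l + s - i) (q + i) := by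
    intro i hi
    rw [Finset.mem_range] at hi
    refine finsum_int_eq_Ico _ _ (fun s hs => by rw [h₀ s hs, mul_zero, zero_smul]) fun s hs => ?_
    rw [hP' _ _ (by omega) (by omega), smul_zero]
  rw [Finset.sum_congr rfl this, Finset.sum_comm]
  refine Finset.sum_congr rfl fun s _ => ?_
  rw [bin_eq_sum_of_le hN (N := N) (by omega), Finset.smul_sum]
  refine Finset.sum_congr rfl fun i _ => ?_
  rw [smul_smul, mul_comm, add_assoc p l s]

end Bin

lemma prodCoeff_eq_bin {W : Type*} [AddCommGroup W] [Module ℂ W] (l : ℤ) (a b : ℤ → W → W)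
    (m n : ℤ) (w : W) : prodCoeff l a b m n w = bin l (fun p q => a p (b q w)) m n := rfl

lemma swapCoeff_eq_tw {W : Type*} [AddCommGroup W] [Module ℂ W] (l : ℤ) (f : LaurentSeries ℂ)
    (b a : ℤ → W → W) (m n : ℤ) (w : W) (h : Lau fun p q => b p (a q w)) :
    swapCoeff l f b a m n w = tw l f (fun p q => b p (a q w)) n m := by
  obtain ⟨K, hK⟩ := h.1
  obtain ⟨N, hN⟩ : ∃ N : ℕ, K ≤ m + N := ⟨(K - m).toNat, by omega⟩
  rw [tw_eq_sum_sum h (N := N) (fun p q hq => hK _ _ (by omega))]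
  refine finsum_nat_eq_range N fun i hi => ?_
  simp only [hK _ (m + i) (by omega), smul_zero, finsum_zero]

/-! ### Re-expansion of series with poles along `y + z = 0` -/

section Reexpansion

variable {W : Type*} [AddCommGroup W] [Module ℂ W]

/-- Multiplication by `y + z` on series `F(y, z) = ∑ F q n y^{-q-1} z^{-n-1}`. -/
def dg : Module.End ℂ (ℤ → ℤ → W) where
  toFun F q n := F (q + 1) n + F q (n + 1)
  map_add' F G := by ext; simp only [Pi.add_apply]; abel
  map_smul' c F := by ext; simp only [Pi.smul_apply, smul_add, RingHom.id_apply]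

lemma dg_apply (F : ℤ → ℤ → W) (q n : ℤ) : dg F q n = F (q + 1) n + F q (n + 1) := rfl

/-- The powers of the first variable are bounded below. -/
def FTrunc {X : Type*} [Zero X] (F : ℤ → X) : Prop := ∃ k : ℤ, ∀ q, k ≤ q → F q = 0

lemma FTrunc.add {X : Type*} [AddCommGroup X] {F G : ℤ → X} (hF : FTrunc F) (hG : FTrunc G) :
    FTrunc (F + G) := by
  obtain ⟨k, hk⟩ := hF
  obtain ⟨k', hk'⟩ := hG
  exact ⟨max k k', fun q hq => by
    rw [Pi.add_apply, hk q (by omega), hk' q (by omega), add_zero]⟩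

lemma FTrunc.smul {X : Type*} [AddCommGroup X] [Module ℂ X] {F : ℤ → X} (hF : FTrunc F) (c : ℂ) :
    FTrunc (c • F) := by
  obtain ⟨k, hk⟩ := hF
  exact ⟨k, fun q hq => by rw [Pi.smul_apply, hk q (by omega), smul_zero]⟩

lemma FTrunc.neg {X : Type*} [AddCommGroup X] {F : ℤ → X} (hF : FTrunc F) :
    FTrunc (-F) := by
  obtain ⟨k, hk⟩ := hF
  exact ⟨k, fun q hq => by rw [Pi.neg_apply, hk q (by omega), neg_zero]⟩

lemma FTrunc.sub {X : Type*} [AddCommGroup X] {F G : ℤ → X} (hF : FTrunc F) (hG : FTrunc G) :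
    FTrunc (F - G) := by
  rw [sub_eq_add_neg]; exact hF.add hG.neg

lemma FTrunc.zero {X : Type*} [Zero X] : FTrunc (fun _ => (0 : X)) := ⟨0, fun _ _ => rfl⟩

lemma FTrunc.shift {X : Type*} [Zero X] {F : ℤ → X} (hF : FTrunc F) (a : ℤ) :
    FTrunc (fun q => F (q + a)) := by
  obtain ⟨k, hk⟩ := hF
  exact ⟨k - a, fun q hq => hk _ (by omega)⟩

lemma dg_pow_eq_zero (m : ℕ) {F : ℤ → ℤ → W} {k : ℤ} (h : ∀ q, k ≤ q → F q = 0) :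
    ∀ q, k ≤ q → (dg ^ m) F q = 0 := by
  induction m generalizing F with
  | zero => simpa using h
  | succ m ih =>
    intro q hq
    rw [pow_succ, Module.End.mul_apply]
    refine ih (fun q hq => ?_) q hq
    ext n
    simp [dg_apply, h q hq, h (q + 1) (by omega)]

lemma FTrunc.dg_pow {F : ℤ → ℤ → W} (h : FTrunc F) (m : ℕ) : FTrunc ((dg ^ m) F) := by
  obtain ⟨k, hk⟩ := h
  exact ⟨k, dg_pow_eq_zero m hk⟩

/-- On series which are truncated in `y`, dividing by `(y + z)^m` does not lower the powers
of `y`. -/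
lemma eq_zero_of_dg_pow (m : ℕ) {F : ℤ → ℤ → W} (hF : FTrunc F) {k : ℤ}
    (h : ∀ q, k ≤ q → (dg ^ m) F q = 0) : ∀ q, k ≤ q → F q = 0 := by
  induction m generalizing F with
  | zero => simpa using h
  | succ m ih =>
    obtain ⟨K, hK⟩ := hF
    have h1 : ∀ q, k ≤ q → dg F q = 0 := by
      refine ih ?_ fun q hq => ?_
      · exact FTrunc.dg_pow ⟨K, hK⟩ 1
      · rw [← Module.End.mul_apply, ← pow_succ]; exact h q hq
    have h2 : ∀ j : ℕ, ∀ q, k ≤ q → K - j ≤ q → F q = 0 := by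
      intro j
      induction j with
      | zero => intro q _ hq; exact hK q (by simpa using hq)
      | succ j ihj =>
        intro q hq hj
        ext n
        have := congrFun (h1 q hq) (n - 1)
        rw [dg_apply, ihj (q + 1) (by omega) (by push_cast at hj; omega)] at this
        simpa using this
    intro q hq
    exact h2 (K - q).toNat q hq (by omega)

lemma eq_of_dg_pow_eq {m : ℕ} {F G : ℤ → ℤ → W} (hF : FTrunc F) (hG : FTrunc G)
    (h : (dg ^ m) F = (dg ^ m) G) : F = G := by
  rw [← sub_eq_zero]
  obtain ⟨k, hk⟩ := hF.sub hG
  ext1 q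
  refine eq_zero_of_dg_pow m (hF.sub hG) (k := q) (fun q _ => ?_) q le_rfl
  rw [map_sub, h, sub_self]; rfl

/-- Division by `(y + z)^m` of series which are truncated in `y`. -/
lemma exists_dg_pow_eq (m : ℕ) {E : ℤ → ℤ → W} (hE : FTrunc E) :
    ∃ F, FTrunc F ∧ (dg ^ m) F = E := by
  induction m generalizing E with
  | zero => exact ⟨E, hE, by simp⟩
  | succ m ih =>
    obtain ⟨F', ⟨k, hk⟩, rfl⟩ := ih hE
    let F : ℤ → ℤ → W := fun q n =>
      ∑ i ∈ Finset.range (k - q).toNat, (-1 : ℂ) ^ i • F' (q + i) (n - 1 - i)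
    have hF0 : ∀ q, k ≤ q → F q = 0 := by
      intro q hq
      ext n
      simp [F, show (k - q).toNat = 0 by omega]
    refine ⟨F, ⟨k, hF0⟩, ?_⟩
    rw [pow_succ, Module.End.mul_apply]
    congr 1
    ext q n
    rw [dg_apply]
    by_cases hq : k ≤ q
    · rw [hF0 q hq, hF0 (q + 1) (by omega), hk q hq]; simp
    · obtain ⟨j, hj, hj'⟩ : ∃ j : ℕ, (k - q).toNat = j + 1 ∧ (k - (q + 1)).toNat = j :=
        ⟨(k - (q + 1)).toNat, by omega, rfl⟩
      simp only [F, hj, hj', Finset.sum_range_succ']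
      rw [← add_assoc, ← Finset.sum_add_distrib, Finset.sum_eq_zero]
      · simp
      · intro i _
        have e1 : q + ((i + 1 : ℕ) : ℤ) = q + 1 + i := by push_cast; ring
        have e2 : n + 1 - 1 - ((i + 1 : ℕ) : ℤ) = n - 1 - i := by push_cast; ring
        rw [e1, e2, pow_succ, mul_neg_one, neg_smul, add_neg_cancel]

lemma dg_pow_apply (m : ℕ) (F : ℤ → ℤ → W) (q n : ℤ) :
    (dg ^ m) F q n = ∑ i ∈ Finset.range (m + 1), m.choose i • F (q + m - i) (n + i) := by
  induction m generalizing q n with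
  | zero => simp
  | succ m ih =>
    rw [pow_succ', Module.End.mul_apply, dg_apply, ih, ih, Finset.sum_range_succ' _ (m + 1)]
    have : ∀ i ∈ Finset.range (m + 1), (m + 1).choose (i + 1) •
        F (q + ((m + 1 : ℕ) : ℤ) - ((i + 1 : ℕ) : ℤ)) (n + ((i + 1 : ℕ) : ℤ))
        = m.choose i • F (q + m - i) (n + 1 + i)
          + m.choose (i + 1) • F (q + 1 + m - ((i + 1 : ℕ) : ℤ)) (n + ((i + 1 : ℕ) : ℤ)) := by
      intro i _
      have e1 : q + ((m + 1 : ℕ) : ℤ) - ((i + 1 : ℕ) : ℤ) = q + m - i := by push_cast; ring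
      have e2 : n + ((i + 1 : ℕ) : ℤ) = n + 1 + i := by push_cast; ring
      have e3 : q + 1 + m - ((i + 1 : ℕ) : ℤ) = q + m - i := by push_cast; ring
      rw [e1, e2, e3, Nat.choose_succ_succ, add_smul]
    have e : q + ((m + 1 : ℕ) : ℤ) - ((0 : ℕ) : ℤ) = q + 1 + m - ((0 : ℕ) : ℤ) := by
      push_cast; ring
    have h1 : ∑ i ∈ Finset.range (m + 1), m.choose i • F (q + 1 + m - i) (n + i)
        = ∑ i ∈ Finset.range (m + 1), m.choose (i + 1) •
            F (q + 1 + m - ((i + 1 : ℕ) : ℤ)) (n + ((i + 1 : ℕ) : ℤ))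
          + F (q + 1 + m - ((0 : ℕ) : ℤ)) (n + ((0 : ℕ) : ℤ)) := by
      rw [Finset.sum_range_succ', Finset.sum_range_succ _ m]
      simp only [Nat.choose_succ_self, zero_smul, add_zero, Nat.choose_zero_right, one_smul]
    rw [Finset.sum_congr rfl this, Finset.sum_add_distrib, h1, e, Nat.choose_zero_right, one_smul]
    abel

/-- Division by `(y + z)^m` preserves truncation in `z`. -/
lemma FTrunc.of_dg_pow (m : ℕ) {F : ℤ → ℤ → W} (hF : FTrunc F)
    (h : ∀ q, FTrunc ((dg ^ m) F q)) : ∀ q, FTrunc (F q) := by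
  induction m generalizing F with
  | zero => simpa using h
  | succ m ih =>
    obtain ⟨K, hK⟩ := hF
    have h1 : ∀ q, FTrunc (dg F q) := by
      refine ih ?_ fun q => ?_
      · exact FTrunc.dg_pow ⟨K, hK⟩ 1
      · rw [← Module.End.mul_apply, ← pow_succ]; exact h q
    have h2 : ∀ j : ℕ, ∀ q, K - j ≤ q → FTrunc (F q) := by
      intro j
      induction j with
      | zero => intro q hq; rw [hK q (by simpa using hq)]; exact FTrunc.zero
      | succ j ihj =>
        intro q hj
        have := ((h1 q).sub (ihj (q + 1) (by push_cast at hj; omega))).shift (-1)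
        convert this using 2 with n
        simp [dg_apply]
    intro q
    exact h2 (K - q).toNat q (by omega)

/-- `F` is truncated in `y`, and equal to `S` up to a power of `y + z`. -/
def IsReexp (S F : ℤ → ℤ → W) : Prop := FTrunc F ∧ ∃ m : ℕ, (dg ^ m) F = (dg ^ m) S

lemma dg_pow_eq_of_le {m m' : ℕ} (h : m ≤ m') {F S : ℤ → ℤ → W}
    (e : (dg ^ m) F = (dg ^ m) S) : (dg ^ m') F = (dg ^ m') S := by
  obtain ⟨j, rfl⟩ := Nat.exists_eq_add_of_le' h
  rw [pow_add, Module.End.mul_apply, e, Module.End.mul_apply]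

lemma IsReexp.unique {S F F' : ℤ → ℤ → W} (h : IsReexp S F) (h' : IsReexp S F') : F = F' := by
  obtain ⟨hF, m, hm⟩ := h
  obtain ⟨hF', m', hm'⟩ := h'
  exact eq_of_dg_pow_eq (m := max m m') hF hF'
    ((dg_pow_eq_of_le (le_max_left _ _) hm).trans (dg_pow_eq_of_le (le_max_right _ _) hm').symm)

lemma IsReexp.add {S F S' F' : ℤ → ℤ → W} (h : IsReexp S F) (h' : IsReexp S' F') :
    IsReexp (S + S') (F + F') := by
  obtain ⟨hF, m, hm⟩ := h
  obtain ⟨hF', m', hm'⟩ := h'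
  refine ⟨hF.add hF', max m m', ?_⟩
  rw [map_add, map_add, dg_pow_eq_of_le (le_max_left _ _) hm,
    dg_pow_eq_of_le (le_max_right _ _) hm']

lemma IsReexp.smul {S F : ℤ → ℤ → W} (h : IsReexp S F) (c : ℂ) : IsReexp (c • S) (c • F) := by
  obtain ⟨hF, m, hm⟩ := h
  exact ⟨hF.smul c, m, by rw [map_smul, map_smul, hm]⟩

/-- `(y + z)^m S` is truncated in `y`. -/
def Good (m : ℕ) (S : ℤ → ℤ → W) : Prop := FTrunc ((dg ^ m) S)

lemma Good.mono {m m' : ℕ} (h : m ≤ m') {S : ℤ → ℤ → W} (hS : Good m S) : Good m' S := by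
  obtain ⟨j, rfl⟩ := Nat.exists_eq_add_of_le' h
  rw [Good, pow_add, Module.End.mul_apply]
  exact FTrunc.dg_pow hS j

lemma Good.add {m : ℕ} {S S' : ℤ → ℤ → W} (hS : Good m S) (hS' : Good m S') :
    Good m (S + S') := by
  rw [Good, map_add]; exact FTrunc.add hS hS'

lemma Good.smul {m : ℕ} {S : ℤ → ℤ → W} (hS : Good m S) (c : ℂ) : Good m (c • S) := by
  rw [Good, map_smul]; exact FTrunc.smul hS c

lemma Good.exists_isReexp {m : ℕ} {S : ℤ → ℤ → W} (hS : Good m S) : ∃ F, IsReexp S F := by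
  obtain ⟨F, hF, h⟩ := exists_dg_pow_eq m hS
  exact ⟨F, hF, m, h⟩

lemma IsReexp.good {S F : ℤ → ℤ → W} (h : IsReexp S F) : ∃ m, Good m S := by
  obtain ⟨hF, m, hm⟩ := h
  exact ⟨m, by rw [Good, ← hm]; exact hF.dg_pow m⟩

/-- If `(y + z)^m S` is truncated in `y`, then the exponent `m` also works for the re-expansion. -/
lemma IsReexp.dg_pow_eq {S F : ℤ → ℤ → W} (h : IsReexp S F) {m : ℕ} (hS : Good m S) :
    (dg ^ m) F = (dg ^ m) S := by
  obtain ⟨hF, m', hm'⟩ := h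
  refine eq_of_dg_pow_eq (m := m') (hF.dg_pow m) hS ?_
  rw [← Module.End.mul_apply, ← Module.End.mul_apply, ← pow_add, add_comm, pow_add,
    Module.End.mul_apply, hm', ← Module.End.mul_apply, ← pow_add, add_comm, pow_add]

end Reexpansion

/-! ### The operators `a(y + z)` -/

section ShiftMode

variable {W : Type*} [AddCommGroup W] [Module ℂ W]

/-- The coefficient of `y^{-q-1} z^{-n-1}` in `a(y + z) g(z)`. -/
def shiftMode (a : ℤ → Module.End ℂ W) (q : ℤ) (g : ℤ → W) (n : ℤ) : W :=
  bin q (fun p j => a p (g j)) 0 n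

lemma FTrunc.sTrunc_mode {g : ℤ → W} (hg : FTrunc g) (a : ℤ → Module.End ℂ W) :
    STrunc (fun p j => a p (g j)) := by
  obtain ⟨k, hk⟩ := hg
  exact ⟨k, fun p q hq => by simp only [hk q hq, map_zero]⟩

/-- Multiplication of `a(y + z) g(z)` by `(y + z)^m` shifts the modes of `a`. -/
lemma dg_pow_shiftMode (a : ℤ → Module.End ℂ W) {g : ℤ → W} (hg : FTrunc g) (m : ℕ) (q n : ℤ) :
    (dg ^ m) (fun q => shiftMode a q g) q n = bin q (fun p j => a p (g j)) m n := by
  induction m generalizing q n with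
  | zero => simp [shiftMode]
  | succ m ih =>
    rw [pow_succ', Module.End.mul_apply, dg_apply, ih, ih, bin_succ (hg.sTrunc_mode a)]
    push_cast; abel

lemma shiftMode_add (a : ℤ → Module.End ℂ W) (q : ℤ) {g g' : ℤ → W} (hg : FTrunc g)
    (hg' : FTrunc g') : shiftMode a q (g + g') = shiftMode a q g + shiftMode a q g' := by
  ext n
  simp only [shiftMode, Pi.add_apply, map_add]
  exact bin_add (hg.sTrunc_mode a) (hg'.sTrunc_mode a) _ _ _

lemma shiftMode_smul (a : ℤ → Module.End ℂ W) (q : ℤ) (c : ℂ) {g : ℤ → W} (hg : FTrunc g) :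
    shiftMode a q (c • g) = c • shiftMode a q g := by
  ext n
  simp only [shiftMode, Pi.smul_apply, map_smul]
  exact bin_smul (hg.sTrunc_mode a) _ _ _ _

lemma shiftMode_shift (a : ℤ → Module.End ℂ W) (q : ℤ) (g : ℤ → W) (n t : ℤ) :
    shiftMode a q (fun n => g (n + t)) n = shiftMode a q g (n + t) := by
  have := bin_shift (fun p j => a p (g j)) q 0 n 0 t
  simpa [shiftMode] using this

lemma FTrunc.shiftMode {g : ℤ → W} (hg : FTrunc g) (a : ℤ → Module.End ℂ W) (q : ℤ) :
    FTrunc (shiftMode a q g) := by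
  obtain ⟨k, hk⟩ := hg
  exact ⟨k, fun n hn => bin_eq_zero fun p' q' h => by rw [hk q' (by omega), map_zero]⟩

lemma IsReexp.fTrunc_apply {a : ℤ → Module.End ℂ W} {g : ℤ → W} (hg : FTrunc g) {F : ℤ → ℤ → W}
    (h : IsReexp (fun q => QVA.shiftMode a q g) F) : ∀ q, FTrunc (F q) := by
  obtain ⟨hF, m, hm⟩ := h
  refine FTrunc.of_dg_pow m hF fun q => ?_
  obtain ⟨k, hk⟩ := hg
  refine ⟨k, fun n hn => ?_⟩
  rw [hm, dg_pow_shiftMode a ⟨k, hk⟩]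
  exact bin_eq_zero fun p' q' h => by rw [hk q' (by omega), map_zero]

end ShiftMode

/-! ### Series in three variables -/

section ThreeVariables

variable {W : Type*} [AddCommGroup W] [Module ℂ W]

/-- Multiplication by the first variable. -/
def s₁ : Module.End ℂ (ℤ → ℤ → ℤ → W) where
  toFun G l p n := G (l + 1) p n
  map_add' _ _ := rfl
  map_smul' _ _ := rfl

/-- Multiplication by the second variable. -/
def s₂ : Module.End ℂ (ℤ → ℤ → ℤ → W) where
  toFun G l p n := G l (p + 1) n
  map_add' _ _ := rfl
  map_smul' _ _ := rfl

/-- Multiplication by the third variable. -/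
def s₃ : Module.End ℂ (ℤ → ℤ → ℤ → W) where
  toFun G l p n := G l p (n + 1)
  map_add' _ _ := rfl
  map_smul' _ _ := rfl

lemma commute_s₁_s₂ : Commute (s₁ (W := W)) s₂ := rfl
lemma commute_s₁_s₃ : Commute (s₁ (W := W)) s₃ := rfl
lemma commute_s₂_s₃ : Commute (s₂ (W := W)) s₃ := rfl

lemma s₁_apply (G : ℤ → ℤ → ℤ → W) (l p n : ℤ) : s₁ G l p n = G (l + 1) p n := rfl
lemma s₂_apply (G : ℤ → ℤ → ℤ → W) (l p n : ℤ) : s₂ G l p n = G l (p + 1) n := rfl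
lemma s₃_apply (G : ℤ → ℤ → ℤ → W) (l p n : ℤ) : s₃ G l p n = G l p (n + 1) := rfl

/-- Multiplication by the sum of the first and the third variable. -/
def d₁₃ : Module.End ℂ (ℤ → ℤ → ℤ → W) := s₁ + s₃

/-- Multiplication by the sum of the second and the third variable. -/
def d₂₃ : Module.End ℂ (ℤ → ℤ → ℤ → W) := s₂ + s₃

/-- Multiplication by the sum of the first and the second variable. -/
def d₁₂ : Module.End ℂ (ℤ → ℤ → ℤ → W) := s₁ + s₂

/-- Multiplication by the second minus the first variable. -/
def e₂₁ : Module.End ℂ (ℤ → ℤ → ℤ → W) := s₂ - s₁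

lemma slice₁₃ (m : ℕ) (G : ℤ → ℤ → ℤ → W) (l p n : ℤ) :
    (d₁₃ ^ m) G l p n = (dg ^ m) (fun l n => G l p n) l n := by
  induction m generalizing G with
  | zero => rfl
  | succ m ih =>
    rw [pow_succ, Module.End.mul_apply, ih, pow_succ, Module.End.mul_apply]; rfl

lemma slice₂₃ (m : ℕ) (G : ℤ → ℤ → ℤ → W) (l p n : ℤ) :
    (d₂₃ ^ m) G l p n = (dg ^ m) (G l) p n := by
  induction m generalizing G with
  | zero => rfl
  | succ m ih =>
    rw [pow_succ, Module.End.mul_apply, ih, pow_succ, Module.End.mul_apply]; rfl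

lemma slice₁₂ (m : ℕ) (G : ℤ → ℤ → ℤ → W) (l p n : ℤ) :
    (d₁₂ ^ m) G l p n = (dg ^ m) (fun l p => G l p n) l p := by
  induction m generalizing G with
  | zero => rfl
  | succ m ih =>
    rw [pow_succ, Module.End.mul_apply, ih, pow_succ, Module.End.mul_apply]; rfl

lemma commute_e₂₁_d₁₃ : Commute (e₂₁ (W := W)) d₁₃ := by
  refine Commute.sub_left (.add_right ?_ ?_) (.add_right ?_ ?_)
  exacts [commute_s₁_s₂.symm, commute_s₂_s₃, Commute.refl _, commute_s₁_s₃]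

lemma commute_e₂₁_d₂₃ : Commute (e₂₁ (W := W)) d₂₃ := by
  refine Commute.sub_left (.add_right ?_ ?_) (.add_right ?_ ?_)
  exacts [Commute.refl _, commute_s₂_s₃, commute_s₁_s₂, commute_s₁_s₃]

lemma commute_d₁₃_d₂₃ : Commute (d₁₃ (W := W)) d₂₃ := by
  refine Commute.add_left (.add_right ?_ ?_) (.add_right ?_ ?_)
  exacts [commute_s₁_s₂, commute_s₁_s₃, commute_s₂_s₃.symm, Commute.refl _]

/-- Multiplication by `f(y - x)`, expanded in nonnegative powers of `x`, for series in
`x, y, z`. -/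
def tw₃ (l : ℤ) (f : LaurentSeries ℂ) (G : ℤ → ℤ → ℤ → W) (x p n : ℤ) : W :=
  tw l f (fun p x => G x p n) p x

/-- For each power of `z`, the coefficient lies in `W((y))((x))`. -/
def Lau₃ (G : ℤ → ℤ → ℤ → W) : Prop := ∀ n, Lau fun p x => G x p n

lemma Lau₃.add {G G' : ℤ → ℤ → ℤ → W} (h : Lau₃ G) (h' : Lau₃ G') : Lau₃ (G + G') :=
  fun n => (h n).add (h' n)

lemma Lau₃.shift {G : ℤ → ℤ → ℤ → W} (h : Lau₃ G) (a b c : ℤ) :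
    Lau₃ (fun x p n => G (x + a) (p + b) (n + c)) := fun n => (h (n + c)).shift b a

lemma tw₃_add {G G' : ℤ → ℤ → ℤ → W} (h : Lau₃ G) (h' : Lau₃ G') (l : ℤ) (f : LaurentSeries ℂ) :
    tw₃ l f (G + G') = tw₃ l f G + tw₃ l f G' := by
  ext x p n
  exact tw_add (h n) (h' n) f l p x

lemma tw₃_shift (G : ℤ → ℤ → ℤ → W) (l : ℤ) (f : LaurentSeries ℂ) (a b c x p n : ℤ) :
    tw₃ l f (fun x p n => G (x + a) (p + b) (n + c)) x p n = tw₃ l f G (x + a) (p + b) (n + c) :=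
  tw_shift (fun p x => G x p (n + c)) f l p x b a

lemma tw₃_succ {G : ℤ → ℤ → ℤ → W} (h : Lau₃ G) (l : ℤ) (f : LaurentSeries ℂ) :
    e₂₁ (tw₃ l f G) = tw₃ (l + 1) f G := by
  ext x p n
  exact (tw_succ (h n) f l p x).symm

lemma Lau₃.add₁₃ {G : ℤ → ℤ → ℤ → W} (h : Lau₃ G) : Lau₃ (d₁₃ G) := by
  have h1 := h.shift 1 0 0
  have h3 := h.shift 0 0 1
  simp only [add_zero] at h1 h3
  exact h1.add h3

lemma Lau₃.add₂₃ {G : ℤ → ℤ → ℤ → W} (h : Lau₃ G) : Lau₃ (d₂₃ G) := by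
  have h1 := h.shift 0 1 0
  have h3 := h.shift 0 0 1
  simp only [add_zero] at h1 h3
  exact h1.add h3

lemma tw₃_add₁₃ {G : ℤ → ℤ → ℤ → W} (h : Lau₃ G) (l : ℤ) (f : LaurentSeries ℂ) :
    tw₃ l f (d₁₃ G) = d₁₃ (tw₃ l f G) := by
  have h1 := h.shift 1 0 0
  have h3 := h.shift 0 0 1
  have e1 := tw₃_shift G l f 1 0 0
  have e3 := tw₃_shift G l f 0 0 1
  simp only [add_zero] at h1 h3 e1 e3
  refine (tw₃_add h1 h3 l f).trans ?_
  ext x p n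
  exact congrArg₂ (· + ·) (e1 x p n) (e3 x p n)

lemma tw₃_add₂₃ {G : ℤ → ℤ → ℤ → W} (h : Lau₃ G) (l : ℤ) (f : LaurentSeries ℂ) :
    tw₃ l f (d₂₃ G) = d₂₃ (tw₃ l f G) := by
  have h1 := h.shift 0 1 0
  have h3 := h.shift 0 0 1
  have e1 := tw₃_shift G l f 0 1 0
  have e3 := tw₃_shift G l f 0 0 1
  simp only [add_zero] at h1 h3 e1 e3
  refine (tw₃_add h1 h3 l f).trans ?_
  ext x p n
  exact congrArg₂ (· + ·) (e1 x p n) (e3 x p n)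

lemma tw₃_pow₁₃ (m : ℕ) {G : ℤ → ℤ → ℤ → W} (h : Lau₃ G) (l : ℤ) (f : LaurentSeries ℂ) :
    Lau₃ ((d₁₃ ^ m) G) ∧ tw₃ l f ((d₁₃ ^ m) G) = (d₁₃ ^ m) (tw₃ l f G) := by
  induction m generalizing G with
  | zero => exact ⟨h, rfl⟩
  | succ m ih =>
    rw [pow_succ, Module.End.mul_apply, Module.End.mul_apply, ← tw₃_add₁₃ h]
    exact ih h.add₁₃

lemma tw₃_pow₂₃ (m : ℕ) {G : ℤ → ℤ → ℤ → W} (h : Lau₃ G) (l : ℤ) (f : LaurentSeries ℂ) :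
    Lau₃ ((d₂₃ ^ m) G) ∧ tw₃ l f ((d₂₃ ^ m) G) = (d₂₃ ^ m) (tw₃ l f G) := by
  induction m generalizing G with
  | zero => exact ⟨h, rfl⟩
  | succ m ih =>
    rw [pow_succ, Module.End.mul_apply, Module.End.mul_apply, ← tw₃_add₂₃ h]
    exact ih h.add₂₃

end ThreeVariables

/-! ### The substitution `x ↦ x + z`, `y ↦ y + z` -/

section Substitution

variable {W : Type*} [AddCommGroup W] [Module ℂ W]

lemma exists_forall_Ico_bound {P : ℤ → ℤ → Prop} (h : ∀ n, ∃ X, ∀ k, X ≤ k → P n k) (a b : ℤ) :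
    ∃ X, ∀ n, a ≤ n → n < b → ∀ k, X ≤ k → P n k := by
  choose X hX using h
  obtain ⟨M, hM⟩ := ((Finset.Ico a b).image X).exists_le
  exact ⟨M, fun n h1 h2 k hk => hX n k
    ((hM _ (Finset.mem_image_of_mem X (Finset.mem_Ico.mpr ⟨h1, h2⟩))).trans hk)⟩

/-- The powers of the third variable are bounded below. -/
def TTrunc (G : ℤ → ℤ → ℤ → W) : Prop := ∃ K : ℤ, ∀ l p n, K ≤ n → G l p n = 0

lemma TTrunc.s₁₃ {G : ℤ → ℤ → ℤ → W} (h : TTrunc G) (p : ℤ) : STrunc (fun l n => G l p n) := by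
  obtain ⟨K, hK⟩ := h
  exact ⟨K, fun l n hn => hK l p n hn⟩

lemma TTrunc.s₂₃ {G : ℤ → ℤ → ℤ → W} (h : TTrunc G) (l : ℤ) : STrunc (fun p n => G l p n) := by
  obtain ⟨K, hK⟩ := h
  exact ⟨K, fun p n hn => hK l p n hn⟩

lemma TTrunc.add {G G' : ℤ → ℤ → ℤ → W} (h : TTrunc G) (h' : TTrunc G') : TTrunc (G + G') := by
  obtain ⟨K, hK⟩ := h
  obtain ⟨K', hK'⟩ := h'
  exact ⟨max K K', fun l p n hn => by
    simp only [Pi.add_apply, hK l p n (by omega), hK' l p n (by omega), add_zero]⟩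

lemma TTrunc.neg {G : ℤ → ℤ → ℤ → W} (h : TTrunc G) : TTrunc (-G) := by
  obtain ⟨K, hK⟩ := h
  exact ⟨K, fun l p n hn => by simp only [Pi.neg_apply, hK l p n hn, neg_zero]⟩

lemma TTrunc.sub {G G' : ℤ → ℤ → ℤ → W} (h : TTrunc G) (h' : TTrunc G') : TTrunc (G - G') := by
  rw [sub_eq_add_neg]; exact h.add h'.neg

lemma TTrunc.smul {G : ℤ → ℤ → ℤ → W} (h : TTrunc G) (c : ℂ) : TTrunc (c • G) := by
  obtain ⟨K, hK⟩ := h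
  exact ⟨K, fun l p n hn => by simp only [Pi.smul_apply, hK l p n hn, smul_zero]⟩

lemma TTrunc.shift {G : ℤ → ℤ → ℤ → W} (h : TTrunc G) (a b c : ℤ) :
    TTrunc (fun l p n => G (l + a) (p + b) (n + c)) := by
  obtain ⟨K, hK⟩ := h
  exact ⟨K - c, fun l p n hn => hK _ _ _ (by omega)⟩

lemma TTrunc.s₁ {G : ℤ → ℤ → ℤ → W} (h : TTrunc G) : TTrunc (s₁ G) := by
  have := h.shift 1 0 0
  simp only [add_zero] at this
  exact this

lemma TTrunc.s₂ {G : ℤ → ℤ → ℤ → W} (h : TTrunc G) : TTrunc (s₂ G) := by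
  have := h.shift 0 1 0
  simp only [add_zero] at this
  exact this

lemma TTrunc.s₃ {G : ℤ → ℤ → ℤ → W} (h : TTrunc G) : TTrunc (s₃ G) := by
  have := h.shift 0 0 1
  simp only [add_zero] at this
  exact this

/-- The substitution `x ↦ x + z` in series in `x, y, z`. -/
def sub₁₃ (G : ℤ → ℤ → ℤ → W) (l p n : ℤ) : W := bin l (fun l n => G l p n) 0 n

/-- The substitution `y ↦ y + z` in series in `x, y, z`. -/
def sub₂₃ (G : ℤ → ℤ → ℤ → W) (l p n : ℤ) : W := bin p (fun p n => G l p n) 0 n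

lemma sub₁₃_eq_sum {G : ℤ → ℤ → ℤ → W} {K : ℤ} (hK : ∀ l p n, K ≤ n → G l p n = 0) {n : ℤ} {N : ℕ}
    (hN : K ≤ n + N) (l p : ℤ) :
    sub₁₃ G l p n = ∑ i ∈ Finset.range N, bc l i • G (l - i) p (n + i) := by
  rw [sub₁₃, bin_eq_sum_of_le (K := K) (fun l n hn => hK l p n hn) hN]
  simp only [zero_add]

lemma sub₂₃_eq_sum {G : ℤ → ℤ → ℤ → W} {K : ℤ} (hK : ∀ l p n, K ≤ n → G l p n = 0) {n : ℤ} {N : ℕ}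
    (hN : K ≤ n + N) (l p : ℤ) :
    sub₂₃ G l p n = ∑ i ∈ Finset.range N, bc p i • G l (p - i) (n + i) := by
  rw [sub₂₃, bin_eq_sum_of_le (K := K) (fun p n hn => hK l p n hn) hN]
  simp only [zero_add]

lemma sub₁₃_eq_zero {G : ℤ → ℤ → ℤ → W} {K : ℤ} (hK : ∀ l p n, K ≤ n → G l p n = 0) :
    ∀ l p n, K ≤ n → sub₁₃ G l p n = 0 := fun l p n hn => by
  rw [sub₁₃_eq_sum hK (N := 0) (by simpa using hn)]; simp

lemma sub₂₃_eq_zero {G : ℤ → ℤ → ℤ → W} {K : ℤ} (hK : ∀ l p n, K ≤ n → G l p n = 0) :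
    ∀ l p n, K ≤ n → sub₂₃ G l p n = 0 := fun l p n hn => by
  rw [sub₂₃_eq_sum hK (N := 0) (by simpa using hn)]; simp

lemma TTrunc.sub₁₃ {G : ℤ → ℤ → ℤ → W} (h : TTrunc G) : TTrunc (sub₁₃ G) := by
  obtain ⟨K, hK⟩ := h
  exact ⟨K, sub₁₃_eq_zero hK⟩

lemma TTrunc.sub₂₃ {G : ℤ → ℤ → ℤ → W} (h : TTrunc G) : TTrunc (sub₂₃ G) := by
  obtain ⟨K, hK⟩ := h
  exact ⟨K, sub₂₃_eq_zero hK⟩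

lemma sub₁₃_add {G G' : ℤ → ℤ → ℤ → W} (h : TTrunc G) (h' : TTrunc G') :
    sub₁₃ (G + G') = sub₁₃ G + sub₁₃ G' := by
  ext l p n
  exact bin_add (h.s₁₃ p) (h'.s₁₃ p) l 0 n

lemma sub₂₃_add {G G' : ℤ → ℤ → ℤ → W} (h : TTrunc G) (h' : TTrunc G') :
    sub₂₃ (G + G') = sub₂₃ G + sub₂₃ G' := by
  ext l p n
  exact bin_add (h.s₂₃ l) (h'.s₂₃ l) p 0 n

lemma sub₁₃_sub {G G' : ℤ → ℤ → ℤ → W} (h : TTrunc G) (h' : TTrunc G') :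
    sub₁₃ (G - G') = sub₁₃ G - sub₁₃ G' := by
  ext l p n
  exact bin_sub (h.s₁₃ p) (h'.s₁₃ p) l 0 n

lemma sub₂₃_sub {G G' : ℤ → ℤ → ℤ → W} (h : TTrunc G) (h' : TTrunc G') :
    sub₂₃ (G - G') = sub₂₃ G - sub₂₃ G' := by
  ext l p n
  exact bin_sub (h.s₂₃ l) (h'.s₂₃ l) p 0 n

lemma sub₁₃_smul {G : ℤ → ℤ → ℤ → W} (h : TTrunc G) (c : ℂ) : sub₁₃ (c • G) = c • sub₁₃ G := by
  ext l p n
  exact bin_smul (h.s₁₃ p) c l 0 n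

lemma sub₂₃_smul {G : ℤ → ℤ → ℤ → W} (h : TTrunc G) (c : ℂ) : sub₂₃ (c • G) = c • sub₂₃ G := by
  ext l p n
  exact bin_smul (h.s₂₃ l) c p 0 n

lemma sub₁₃_s₁ {G : ℤ → ℤ → ℤ → W} (h : TTrunc G) : sub₁₃ (s₁ G) = d₁₃ (sub₁₃ G) := by
  ext l p n
  have h1 := bin_shift (fun l n => G l p n) l 0 n 1 0
  have h2 := bin_succ (h.s₁₃ p) l 0 n
  simp only [add_zero, zero_add] at h1 h2
  exact h1.trans (by rw [eq_sub_iff_add_eq] at h2; exact h2.symm)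

lemma sub₂₃_s₂ {G : ℤ → ℤ → ℤ → W} (h : TTrunc G) : sub₂₃ (s₂ G) = d₂₃ (sub₂₃ G) := by
  ext l p n
  have h1 := bin_shift (fun p n => G l p n) p 0 n 1 0
  have h2 := bin_succ (h.s₂₃ l) p 0 n
  simp only [add_zero, zero_add] at h1 h2
  exact h1.trans (by rw [eq_sub_iff_add_eq] at h2; exact h2.symm)

lemma sub₁₃_s₂ (G : ℤ → ℤ → ℤ → W) : sub₁₃ (s₂ G) = s₂ (sub₁₃ G) := rfl

lemma sub₂₃_s₁ (G : ℤ → ℤ → ℤ → W) : sub₂₃ (s₁ G) = s₁ (sub₂₃ G) := rfl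

lemma sub₁₃_s₃ (G : ℤ → ℤ → ℤ → W) : sub₁₃ (s₃ G) = s₃ (sub₁₃ G) := by
  ext l p n
  have h1 := bin_shift (fun l n => G l p n) l 0 n 0 1
  simp only [add_zero] at h1
  exact h1

lemma sub₂₃_s₃ (G : ℤ → ℤ → ℤ → W) : sub₂₃ (s₃ G) = s₃ (sub₂₃ G) := by
  ext l p n
  have h1 := bin_shift (fun p n => G l p n) p 0 n 0 1
  simp only [add_zero] at h1
  exact h1

lemma sub₁₃_sub₂₃_comm {G : ℤ → ℤ → ℤ → W} (h : TTrunc G) :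
    sub₁₃ (sub₂₃ G) = sub₂₃ (sub₁₃ G) := by
  obtain ⟨K, hK⟩ := h
  ext l p n
  obtain ⟨N, hN⟩ : ∃ N : ℕ, K ≤ n + N := ⟨(K - n).toNat, by omega⟩
  rw [sub₁₃_eq_sum (sub₂₃_eq_zero hK) hN, sub₂₃_eq_sum (sub₁₃_eq_zero hK) hN]
  have h1 : ∀ i ∈ Finset.range N, bc l i • sub₂₃ G (l - i) p (n + i) = ∑ j ∈ Finset.range N,
      bc l i • bc p j • G (l - i) (p - j) (n + i + j) := fun i _ => by
    rw [sub₂₃_eq_sum hK (N := N) (by omega), Finset.smul_sum]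
  have h2 : ∀ j ∈ Finset.range N, bc p j • sub₁₃ G l (p - j) (n + j) = ∑ i ∈ Finset.range N,
      bc l i • bc p j • G (l - i) (p - j) (n + i + j) := fun j _ => by
    rw [sub₁₃_eq_sum hK (N := N) (by omega), Finset.smul_sum]
    refine Finset.sum_congr rfl fun i _ => ?_
    rw [smul_comm, add_right_comm]
  rw [Finset.sum_congr rfl h1, Finset.sum_congr rfl h2, Finset.sum_comm]

/-- The substitution `x ↦ x + z`, `y ↦ y + z`. -/
def dsub (G : ℤ → ℤ → ℤ → W) : ℤ → ℤ → ℤ → W := sub₁₃ (sub₂₃ G)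

lemma dsub_e₂₁ {G : ℤ → ℤ → ℤ → W} (h : TTrunc G) : dsub (e₂₁ G) = e₂₁ (dsub G) := by
  simp only [dsub, e₂₁, LinearMap.sub_apply]
  rw [sub₂₃_sub h.s₂ h.s₁, sub₂₃_s₂ h, sub₂₃_s₁]
  simp only [d₂₃, LinearMap.add_apply]
  rw [sub₁₃_sub (h.sub₂₃.s₂.add h.sub₂₃.s₃) h.sub₂₃.s₁, sub₁₃_add h.sub₂₃.s₂ h.sub₂₃.s₃,
    sub₁₃_s₂, sub₁₃_s₃, sub₁₃_s₁ h.sub₂₃, d₁₃, LinearMap.add_apply]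
  abel

lemma TTrunc.dsub {G : ℤ → ℤ → ℤ → W} (h : TTrunc G) : TTrunc (dsub G) := h.sub₂₃.sub₁₃

/-- The value of `dsub` at a point only depends on the values in a region. -/
lemma dsub_eq_zero {G : ℤ → ℤ → ℤ → W} {K : ℤ} (hK : ∀ l p n, K ≤ n → G l p n = 0) {l p n : ℤ}
    (h : ∀ l' p' n', n ≤ n' → l - (K - n) ≤ l' → p - (K - n) ≤ p' → G l' p' n' = 0) :
    dsub G l p n = 0 := by
  by_cases hn : K ≤ n
  · exact sub₁₃_eq_zero (sub₂₃_eq_zero hK) _ _ _ hn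
  rw [dsub, sub₁₃_eq_sum (sub₂₃_eq_zero hK) (N := (K - n).toNat) (by omega)]
  refine Finset.sum_eq_zero fun i hi => ?_
  rw [Finset.mem_range] at hi
  rw [sub₂₃_eq_sum hK (N := (K - n).toNat) (by omega), Finset.sum_eq_zero, smul_zero]
  intro j hj
  rw [Finset.mem_range] at hj
  rw [h _ _ _ (by omega) (by omega) (by omega), smul_zero]

lemma Lau₃.exists_left {G : ℤ → ℤ → ℤ → W} (h : Lau₃ G) (hT : TTrunc G) (n₀ : ℤ) :
    ∃ X, ∀ l p n, n₀ ≤ n → X ≤ l → G l p n = 0 := by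
  obtain ⟨K, hK⟩ := hT
  obtain ⟨X, hX⟩ := exists_forall_Ico_bound (P := fun n l => ∀ p, G l p n = 0)
    (fun n => (h n).1.imp fun k hk q hq p => hk p q hq) n₀ K
  refine ⟨X, fun l p n hn hl => ?_⟩
  by_cases hn' : K ≤ n
  · exact hK _ _ _ hn'
  · exact hX n hn (by omega) l hl p

lemma Lau₃.exists_right {G : ℤ → ℤ → ℤ → W} (h : Lau₃ G) (hT : TTrunc G) (n₀ l₀ : ℤ) :
    ∃ P, ∀ s l p n, n₀ ≤ n → l₀ ≤ l → P ≤ p + s → bin s (fun p x => G x p n) p l = 0 := by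
  obtain ⟨K, hK⟩ := hT
  obtain ⟨X, hX⟩ := exists_forall_Ico_bound
    (P := fun n t => ∀ s l p, l₀ ≤ l → p + s = t → bin s (fun p x => G x p n) p l = 0)
    (fun n => ((h n).exists_bound l₀).imp fun k hk t ht s l p hl hp => hk s p l (by omega) hl) n₀ K
  refine ⟨X, fun s l p n hn hl hp => ?_⟩
  by_cases hn' : K ≤ n
  · exact bin_eq_zero fun p' q' _ => hK _ _ _ hn'
  · exact hX n hn (by omega) _ hp s l p hl rfl

lemma Lau₃.dsub {G : ℤ → ℤ → ℤ → W} (h : Lau₃ G) (hT : TTrunc G) : Lau₃ (dsub G) := by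
  intro n
  have h' := hT
  obtain ⟨K, hK⟩ := hT
  constructor
  · obtain ⟨X, hX⟩ := h.exists_left h' n
    exact ⟨X + (K - n), fun p x hx => dsub_eq_zero hK fun l' p' n' h1 h2 h3 =>
      hX _ _ _ h1 (by omega)⟩
  · intro q₀
    obtain ⟨P, hP⟩ := h.exists_right h' n (q₀ - (K - n))
    refine ⟨P + (K - n), fun p x hp hx => dsub_eq_zero hK fun l' p' n' h1 h2 h3 => ?_⟩
    have := hP 0 l' p' n' h1 (by omega) (by omega)
    simpa using this

/-- Multiplication by `(y - x)^s`, expanded in nonnegative powers of `x`. -/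
def bin₃ (s : ℤ) (G : ℤ → ℤ → ℤ → W) (x p n : ℤ) : W := bin s (fun p x => G x p n) p x

lemma e₂₁_bin₃ {G : ℤ → ℤ → ℤ → W} (h : Lau₃ G) (s : ℤ) : e₂₁ (bin₃ s G) = bin₃ (s + 1) G := by
  ext x p n
  exact (bin_succ (h n).1 s p x).symm

lemma TTrunc.bin₃ {G : ℤ → ℤ → ℤ → W} (h : TTrunc G) (s : ℤ) : TTrunc (bin₃ s G) := by
  obtain ⟨K, hK⟩ := h
  exact ⟨K, fun l p n hn => bin_eq_zero fun p' q' _ => hK _ _ _ hn⟩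

lemma Lau₃.bin₃ {G : ℤ → ℤ → ℤ → W} (h : Lau₃ G) (s : ℤ) : Lau₃ (bin₃ s G) := fun n => (h n).bin s

/-- Multiplication by `y - x` is injective on series which are truncated in `x`. -/
lemma eq_zero_of_e₂₁ {D : ℤ → ℤ → ℤ → W} (h : ∀ n, ∃ X, ∀ l p, X ≤ l → D l p n = 0)
    (hD : e₂₁ D = 0) : D = 0 := by
  have step : ∀ l p n, D l (p + 1) n = D (l + 1) p n := fun l p n =>
    sub_eq_zero.mp (congrFun (congrFun (congrFun hD l) p) n)
  have iter : ∀ (j : ℕ) l p n, D l p n = D (l + j) (p - j) n := by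
    intro j
    induction j with
    | zero => simp
    | succ j ih =>
      intro l p n
      rw [ih, show p - (j : ℤ) = (p - ((j + 1 : ℕ) : ℤ)) + 1 by push_cast; ring, step]
      congr 1; push_cast; ring
  ext l p n
  obtain ⟨X, hX⟩ := h n
  rw [iter (X - l).toNat, hX _ _ (by omega)]; rfl

/-- The powers of `y - x` are translation invariant; for negative powers this holds because `y - x`
acts injectively. -/
lemma dsub_bin₃ {G : ℤ → ℤ → ℤ → W} (h : Lau₃ G) (hT : TTrunc G) (s : ℤ) :
    dsub (bin₃ s G) = bin₃ s (dsub G) := by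
  have hd : Lau₃ (dsub G) := h.dsub hT
  have h1 : ∀ s, e₂₁ (dsub (bin₃ s G) - bin₃ s (dsub G))
      = dsub (bin₃ (s + 1) G) - bin₃ (s + 1) (dsub G) := fun s => by
    rw [map_sub, ← dsub_e₂₁ (hT.bin₃ s), e₂₁_bin₃ h, e₂₁_bin₃ hd]
  rw [← sub_eq_zero]
  induction s using Int.induction_on with
  | zero =>
    have e0 : ∀ G : ℤ → ℤ → ℤ → W, bin₃ 0 G = G := fun G => by ext; exact bin_zero _ _ _
    rw [e0, e0, sub_self]
  | succ s ih => rw [← h1, ih, map_zero]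
  | pred s ih =>
    refine eq_zero_of_e₂₁ (fun n => ?_) ?_
    · obtain ⟨X, hX⟩ := ((h.bin₃ (-s - 1)).dsub (hT.bin₃ _) n).1
      obtain ⟨X', hX'⟩ := (hd.bin₃ (-s - 1) n).1
      exact ⟨max X X', fun l p hl => by
        have e := hX p l (by omega)
        have e' := hX' p l (by omega)
        dsimp only at e e'
        simp only [Pi.sub_apply, e, e', sub_zero]⟩
    · rw [h1, ← ih]; simp

lemma tw₃_eq_sum_bin₃ {G : ℤ → ℤ → ℤ → W} (h : Lau₃ G) (hT : TTrunc G) (f : LaurentSeries ℂ)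
    {s₀ : ℤ} (h₀ : ∀ s, s < s₀ → f.coeff s = 0) (n₀ l₀ p₀ : ℤ) :
    ∃ S₀, ∀ S l p n, S₀ ≤ S → n₀ ≤ n → l₀ ≤ l → p₀ ≤ p →
      tw₃ 0 f G l p n = (∑ s ∈ Finset.Ico s₀ S, f.coeff s • bin₃ s G) l p n := by
  obtain ⟨P, hP⟩ := h.exists_right hT n₀ l₀
  refine ⟨P - p₀, fun S l p n hS hn hl hp => ?_⟩
  rw [tw₃, tw_eq_sum (S := S) h₀ fun s hs => hP _ _ _ _ hn hl (by omega)]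
  simp only [Finset.sum_apply, Pi.smul_apply, bin₃, zero_add]

lemma dsub_sum_bin₃ {G : ℤ → ℤ → ℤ → W} (h : Lau₃ G) (hT : TTrunc G) (f : LaurentSeries ℂ)
    (T : Finset ℤ) : TTrunc (∑ s ∈ T, f.coeff s • bin₃ s G) ∧
      dsub (∑ s ∈ T, f.coeff s • bin₃ s G) = ∑ s ∈ T, f.coeff s • bin₃ s (dsub G) := by
  classical
  induction T using Finset.induction_on with
  | empty =>
    refine ⟨⟨0, fun _ _ _ _ => rfl⟩, ?_⟩
    ext l p n
    exact dsub_eq_zero (K := n) (fun _ _ _ _ => rfl) fun _ _ _ _ _ _ => rfl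
  | insert s T hs ih =>
    have h1 : TTrunc (f.coeff s • bin₃ s G) := (hT.bin₃ s).smul _
    rw [Finset.sum_insert hs, Finset.sum_insert hs]
    refine ⟨h1.add ih.1, ?_⟩
    rw [dsub, sub₂₃_add h1 ih.1, sub₁₃_add h1.sub₂₃ ih.1.sub₂₃, ← dsub, ← dsub, ih.2,
      ← dsub_bin₃ h hT, dsub, sub₂₃_smul (hT.bin₃ s), sub₁₃_smul (hT.bin₃ s).sub₂₃, ← dsub]

lemma TTrunc.tw₃ {G : ℤ → ℤ → ℤ → W} (h : TTrunc G) (l : ℤ) (f : LaurentSeries ℂ) :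
    TTrunc (tw₃ l f G) := by
  obtain ⟨K, hK⟩ := h
  exact ⟨K, fun l p n hn => tw_eq_zero fun p' q' _ => hK _ _ _ hn⟩

/-- The expansion of `f(y - x)` is invariant under the simultaneous translation of both
variables. -/
lemma dsub_tw₃ {G : ℤ → ℤ → ℤ → W} (h : Lau₃ G) (hT : TTrunc G) (f : LaurentSeries ℂ) :
    dsub (tw₃ 0 f G) = tw₃ 0 f (dsub G) := by
  have hT' := hT
  obtain ⟨K, hK⟩ := hT
  obtain ⟨s₀, h₀⟩ := exists_coeff_bound f
  ext l p n
  obtain ⟨S₁, hS₁⟩ := tw₃_eq_sum_bin₃ h hT' f h₀ n (l - (K - n)) (p - (K - n))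
  obtain ⟨S₂, hS₂⟩ := tw₃_eq_sum_bin₃ (h.dsub hT') hT'.dsub f h₀ n l p
  rw [hS₂ (max S₁ S₂) l p n (le_max_right _ _) le_rfl le_rfl le_rfl, ← (dsub_sum_bin₃ h hT' f _).2,
    ← sub_eq_zero, ← Pi.sub_apply, ← Pi.sub_apply, ← Pi.sub_apply]
  have hs := (dsub_sum_bin₃ h hT' f (Finset.Ico s₀ (max S₁ S₂))).1
  have ht : TTrunc (tw₃ 0 f G) := hT'.tw₃ 0 f
  rw [dsub, dsub, ← sub₁₃_sub ht.sub₂₃ hs.sub₂₃, ← sub₂₃_sub ht hs, ← dsub]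
  have key : ∀ l p n, K ≤ n → (tw₃ 0 f G - ∑ s ∈ Finset.Ico s₀ (max S₁ S₂), f.coeff s • bin₃ s G)
      l p n = 0 := by
    intro l p n hn
    simp only [Pi.sub_apply, Finset.sum_apply, Pi.smul_apply]
    rw [tw₃, tw_eq_zero fun p' q' _ => hK _ _ _ hn, zero_sub, neg_eq_zero]
    refine Finset.sum_eq_zero fun s _ => ?_
    rw [bin₃, bin_eq_zero fun p' q' _ => hK _ _ _ hn, smul_zero]
  refine dsub_eq_zero key fun l' p' n' h1 h2 h3 => ?_
  rw [Pi.sub_apply, Pi.sub_apply, Pi.sub_apply,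
    hS₁ (max S₁ S₂) l' p' n' (le_max_left _ _) h1 h2 h3, sub_self]

/-- The delta function `y⁻¹ δ(x/y)` is invariant under the simultaneous translation of both
variables. -/
lemma dsub_delta {g : ℤ → W} (hg : FTrunc g) :
    dsub (fun l p n => if l + p + 1 = 0 then g n else 0)
      = fun l p n => if l + p + 1 = 0 then g n else 0 := by
  set D : ℤ → ℤ → ℤ → W := fun l p n => if l + p + 1 = 0 then g n else 0 with hD
  have hT : TTrunc D := by
    obtain ⟨k, hk⟩ := hg
    exact ⟨k, fun l p n hn => by simp [hD, hk n hn]⟩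
  have he : e₂₁ D = 0 := by
    ext l p n
    have : l + (p + 1) + 1 = l + 1 + p + 1 := by ring
    simp [e₂₁, s₁_apply, s₂_apply, hD, this]
  have he' : e₂₁ (dsub D - D) = 0 := by
    rw [map_sub, ← dsub_e₂₁ hT, he, sub_zero]
    ext l p n
    exact dsub_eq_zero (K := n) (fun _ _ _ _ => rfl) fun _ _ _ _ _ _ => rfl
  have step : ∀ l p n, (dsub D - D) l (p + 1) n = (dsub D - D) (l + 1) p n := fun l p n =>
    sub_eq_zero.mp (congrFun (congrFun (congrFun he' l) p) n)
  have base : ∀ p n, (dsub D - D) 0 p n = 0 := by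
    intro p n
    simp only [Pi.sub_apply]
    rw [dsub, sub₁₃, bin_zero, sub₂₃, bin, sub_eq_zero]
    simp only [hD, zero_add]
    rcases lt_trichotomy p (-1) with hp | hp | hp
    · rw [if_neg (by omega)]
      refine (finsum_congr fun i => ?_).trans finsum_zero
      rw [if_neg (by omega), smul_zero]
    · subst hp
      rw [finsum_nat_eq_range 1]
      · simp
      · intro i hi
        rw [if_neg (by omega), smul_zero]
    · rw [if_neg (by omega)]
      refine (finsum_congr fun i => ?_).trans finsum_zero
      by_cases hi : p - (i : ℤ) + 1 = 0
      · obtain ⟨j, rfl⟩ : ∃ j : ℕ, p = j := ⟨p.toNat, by omega⟩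
        rw [bc_natCast, Nat.choose_eq_zero_of_lt (by omega)]; simp
      · rw [if_neg hi, smul_zero]
  have all : ∀ l p n, (dsub D - D) l p n = 0 := by
    intro l
    induction l using Int.induction_on with
    | zero => exact base
    | succ l ih => intro p n; rw [← step]; exact ih _ _
    | pred l ih =>
      intro p n
      have := step (-l - 1) (p - 1) n
      rw [sub_add_cancel, sub_add_cancel] at this
      rw [this]; exact ih _ _
  rw [← sub_eq_zero]
  ext l p n
  exact all l p n

end Substitution

/-! ### The `S`-relation for re-expanded operators -/

section HSModes

lemma Lau.map {W W' : Type*} [AddCommGroup W] [Module ℂ W] [AddCommGroup W'] [Module ℂ W']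
    (φ : W →ₗ[ℂ] W') {G : ℤ → ℤ → W} (h : Lau G) : Lau (fun p q => φ (G p q)) := by
  refine ⟨h.1.map φ, fun q₀ => ?_⟩
  obtain ⟨P, hP⟩ := h.2 q₀
  exact ⟨P, fun p q hp hq => by simp only [hP p q hp hq, map_zero]⟩

lemma map_tw {W W' : Type*} [AddCommGroup W] [Module ℂ W] [AddCommGroup W'] [Module ℂ W']
    (φ : W →ₗ[ℂ] W') {G : ℤ → ℤ → W} (h : Lau G) (f : LaurentSeries ℂ) (l p q : ℤ) :
    φ (tw l f G p q) = tw l f (fun p q => φ (G p q)) p q := by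
  obtain ⟨P, hP⟩ := h.tw_eq_sum q
  obtain ⟨P', hP'⟩ := (h.map φ).tw_eq_sum q
  obtain ⟨s₀, h₀⟩ := exists_coeff_bound f
  obtain ⟨S, h1, h2⟩ : ∃ S, P ≤ p + l + S ∧ P' ≤ p + l + S :=
    ⟨max P P' - p - l, by omega, by omega⟩
  rw [hP f s₀ l p q S h₀ le_rfl h1, hP' f s₀ l p q S h₀ le_rfl h2, map_sum]
  simp only [map_smul, map_bin φ h.1]

variable {H : Type*} [AddCommGroup H] [Module ℂ H]
  {W : Type*} [AddCommGroup W] [Module ℂ W]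

/-- The operators `A a m` satisfy the axioms for the action of `a(m)` on an `(H, S)`-module. -/
structure IsHSModes (B : LinearMap.BilinForm ℂ H)
    (S : H ⊗[ℂ] H →ₗ[ℂ] (H ⊗[ℂ] H) ⊗[ℂ] LaurentSeries ℂ)
    (A : H →ₗ[ℂ] ℤ → Module.End ℂ W) : Prop where
  fTrunc : ∀ (a : H) (x : W), FTrunc (fun m => A a m x)
  relation : ∀ (a b : H) (r : ℕ) (b' a' : Fin r → H) (f : Fin r → LaurentSeries ℂ),
    S (b ⊗ₜ[ℂ] a) = ∑ j, (b' j ⊗ₜ[ℂ] a' j) ⊗ₜ[ℂ] f j →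
    ∀ (m n : ℤ) (x : W),
      A a m (A b n x) - ∑ j, tw 0 (f j) (fun p q => A (b' j) p (A (a' j) q x)) n m
        = if m + n + 1 = 0 then B a b • x else 0

lemma lau_of_fTrunc {X : Type*} [AddCommGroup X] {G : ℤ → ℤ → X}
    (h1 : ∃ K, ∀ q, K ≤ q → ∀ p, G p q = 0) (h2 : ∀ q, FTrunc fun p => G p q) : Lau G := by
  obtain ⟨K, hK⟩ := h1
  refine ⟨⟨K, fun p q hq => hK q hq p⟩, fun q₀ => ?_⟩
  obtain ⟨P, hP⟩ := exists_forall_Ico_bound (P := fun q p => G p q = 0) h2 q₀ K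
  refine ⟨P, fun p q hp hq => ?_⟩
  by_cases hq' : K ≤ q
  · exact hK q hq' p
  · exact hP q hq (by omega) p hp

variable {B : LinearMap.BilinForm ℂ H}
    {S : H ⊗[ℂ] H →ₗ[ℂ] (H ⊗[ℂ] H) ⊗[ℂ] LaurentSeries ℂ}
    {A : H →ₗ[ℂ] ℤ → Module.End ℂ W}

lemma IsHSModes.lau (hA : IsHSModes B S A) (b a : H) (x : W) :
    Lau (fun p q => A b p (A a q x)) := by
  refine lau_of_fTrunc ?_ fun q => hA.fTrunc b _
  obtain ⟨K, hK⟩ := hA.fTrunc a x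
  exact ⟨K, fun q hq p => by dsimp only at hK; rw [hK q hq, map_zero]⟩

lemma shiftMode_shiftMode_eq_dsub (a b : ℤ → Module.End ℂ W) {g : ℤ → W} (hg : FTrunc g) :
    (fun l p n => shiftMode a l (shiftMode b p g) n) = dsub fun l p n => a l (b p (g n)) := by
  ext l p n
  simp only [dsub, sub₁₃, sub₂₃, shiftMode]
  congr 1
  ext l' n'
  exact map_bin (a l') (hg.sTrunc_mode b) p 0 n'

lemma tTrunc_modes (a b : ℤ → Module.End ℂ W) {g : ℤ → W} (hg : FTrunc g) :
    TTrunc fun l p n => a l (b p (g n)) := by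
  obtain ⟨k, hk⟩ := hg
  exact ⟨k, fun l p n hn => by simp only [hk n hn, map_zero]⟩

lemma shiftMode_shiftMode_swap_eq_dsub (a b : ℤ → Module.End ℂ W) {g : ℤ → W} (hg : FTrunc g) :
    (fun l p n => shiftMode b p (shiftMode a l g) n) = dsub fun l p n => b p (a l (g n)) := by
  have hT : TTrunc fun l p n => b p (a l (g n)) := by
    obtain ⟨k, hk⟩ := hg
    exact ⟨k, fun l p n hn => by simp only [hk n hn, map_zero]⟩
  rw [dsub, sub₁₃_sub₂₃_comm hT]
  ext l p n
  simp only [sub₁₃, sub₂₃, shiftMode]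
  congr 1
  ext p' n'
  exact map_bin (b p') (hg.sTrunc_mode a) l 0 n'

lemma IsHSModes.lau₃ (hA : IsHSModes B S A) (b a : H) (g : ℤ → W) :
    Lau₃ fun l p n => A b p (A a l (g n)) := fun n => hA.lau b a (g n)

lemma IsHSModes.lau₃_shiftMode (hA : IsHSModes B S A) (b a : H) {g : ℤ → W} (hg : FTrunc g) :
    Lau₃ fun l p n => shiftMode (A b) p (shiftMode (A a) l g) n := by
  rw [shiftMode_shiftMode_swap_eq_dsub _ _ hg]
  refine (hA.lau₃ b a g).dsub ?_
  obtain ⟨k, hk⟩ := hg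
  exact ⟨k, fun l p n hn => by simp only [hk n hn, map_zero]⟩

/-- The operators `a(y + z)` satisfy the `S`-relation, because it is translation invariant. -/
lemma IsHSModes.shift_relation (hA : IsHSModes B S A) {a b : H} {r : ℕ} {b' a' : Fin r → H}
    {f : Fin r → LaurentSeries ℂ} (hS : S (b ⊗ₜ[ℂ] a) = ∑ j, (b' j ⊗ₜ[ℂ] a' j) ⊗ₜ[ℂ] f j)
    {g : ℤ → W} (hg : FTrunc g) :
    (fun l p n => shiftMode (A a) l (shiftMode (A b) p g) n)
      = ∑ j, tw₃ 0 (f j) (fun l p n => shiftMode (A (b' j)) p (shiftMode (A (a' j)) l g) n)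
        + fun l p n => if l + p + 1 = 0 then B a b • g n else 0 := by
  have hg' : FTrunc (B a b • g) := hg.smul _
  have h1 : (fun l p n => A a l (A b p (g n)))
      = ∑ j, tw₃ 0 (f j) (fun l p n => A (b' j) p (A (a' j) l (g n)))
        + fun l p n => if l + p + 1 = 0 then (B a b • g) n else 0 := by
    ext l p n
    have := hA.relation a b r b' a' f hS l p (g n)
    rw [sub_eq_iff_eq_add'] at this
    simp only [Pi.add_apply, Finset.sum_apply]
    exact this
  have hT : ∀ j, TTrunc (fun l p n => A (b' j) p (A (a' j) l (g n))) := fun j => by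
    obtain ⟨k, hk⟩ := hg
    exact ⟨k, fun l p n hn => by simp only [hk n hn, map_zero]⟩
  have hsum : ∀ T : Finset (Fin r),
      TTrunc (∑ j ∈ T, tw₃ 0 (f j) (fun l p n => A (b' j) p (A (a' j) l (g n)))) ∧
      dsub (∑ j ∈ T, tw₃ 0 (f j) (fun l p n => A (b' j) p (A (a' j) l (g n))))
        = ∑ j ∈ T, tw₃ 0 (f j)
          (fun l p n => shiftMode (A (b' j)) p (shiftMode (A (a' j)) l g) n) := by
    intro T
    induction T using Finset.induction_on with
    | empty =>
      refine ⟨⟨0, fun _ _ _ _ => rfl⟩, ?_⟩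
      ext l p n
      exact dsub_eq_zero (K := n) (fun _ _ _ _ => rfl) fun _ _ _ _ _ _ => rfl
    | insert j T hj ih =>
      rw [Finset.sum_insert hj, Finset.sum_insert hj]
      have h2 := (hT j).tw₃ 0 (f j)
      refine ⟨h2.add ih.1, ?_⟩
      rw [dsub, sub₂₃_add h2 ih.1, sub₁₃_add h2.sub₂₃ ih.1.sub₂₃, ← dsub, ← dsub, ih.2,
        dsub_tw₃ (hA.lau₃ _ _ g) (hT j), ← shiftMode_shiftMode_swap_eq_dsub _ _ hg]
  have hD : TTrunc (fun l p n => if l + p + 1 = 0 then (B a b • g) n else 0) := by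
    obtain ⟨k, hk⟩ := hg'
    exact ⟨k, fun l p n hn => by simp [hk n hn]⟩
  rw [shiftMode_shiftMode_eq_dsub _ _ hg, h1, dsub, sub₂₃_add (hsum _).1 hD,
    sub₁₃_add (hsum _).1.sub₂₃ hD.sub₂₃, ← dsub, ← dsub, (hsum _).2, dsub_delta hg']
  rfl

lemma d₂₃_pow_shiftMode (a : ℤ → Module.End ℂ W) (m : ℕ) {F : ℤ → ℤ → W}
    (hF : ∀ p, FTrunc (F p)) : (d₂₃ ^ m) (fun l p n => shiftMode a l (F p) n)
      = fun l p n => shiftMode a l ((dg ^ m) F p) n := by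
  induction m generalizing F with
  | zero => rfl
  | succ m ih =>
    rw [pow_succ, pow_succ, Module.End.mul_apply, Module.End.mul_apply, ← ih]
    · congr 1
      ext l p n
      have := congrFun (shiftMode_add a l (hF (p + 1)) ((hF p).shift 1)) n
      simp only [Pi.add_apply, shiftMode_shift] at this
      exact this.symm
    · intro p
      exact (hF (p + 1)).add ((hF p).shift 1)

lemma d₁₃_pow_shiftMode (a : ℤ → Module.End ℂ W) (m : ℕ) {F : ℤ → ℤ → W}
    (hF : ∀ l, FTrunc (F l)) : (d₁₃ ^ m) (fun l p n => shiftMode a p (F l) n)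
      = fun l p n => shiftMode a p ((dg ^ m) F l) n := by
  induction m generalizing F with
  | zero => rfl
  | succ m ih =>
    rw [pow_succ, pow_succ, Module.End.mul_apply, Module.End.mul_apply, ← ih]
    · congr 1
      ext l p n
      have := congrFun (shiftMode_add a p (hF (l + 1)) ((hF l).shift 1)) n
      simp only [Pi.add_apply, shiftMode_shift] at this
      exact this.symm
    · intro l
      exact (hF (l + 1)).add ((hF l).shift 1)

lemma shiftMode_zero (a : ℤ → Module.End ℂ W) (q : ℤ) : shiftMode a q 0 = 0 := by
  ext n
  exact bin_eq_zero fun p' q' _ => by simp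

/-- The exponent of `x + z` needed to make `a(x + z) c(y) g(z)` truncated in `x` is governed by the
factors `a'` which occur when `a` is moved past `c`; it does not depend on the mode of `c`. -/
theorem IsHSModes.good_of_isReexp (hA : IsHSModes B S A) {a c : H} {r : ℕ} {c' a' : Fin r → H}
    {f : Fin r → LaurentSeries ℂ} (hS : S (c ⊗ₜ[ℂ] a) = ∑ j, (c' j ⊗ₜ[ℂ] a' j) ⊗ₜ[ℂ] f j)
    {g : ℤ → W} (hg : FTrunc g) {m : ℕ}
    (hgood : ∀ j, Good m fun q => shiftMode (A (a' j)) q g) {F : ℤ → ℤ → W}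
    (hF : IsReexp (fun q => shiftMode (A c) q g) F) (p : ℤ) :
    Good m fun q => shiftMode (A a) q (F p) := by
  have hFn := hF.fTrunc_apply hg
  obtain ⟨⟨p₀, hp₀⟩, m', hm'⟩ := hF
  set X₁ : ℤ → ℤ → ℤ → W := fun l p n => shiftMode (A a) l (shiftMode (A c) p g) n with hX₁
  set X₂ : ℤ → ℤ → ℤ → W := fun l p n => shiftMode (A a) l (F p) n with hX₂
  set X₃ : Fin r → ℤ → ℤ → ℤ → W :=
    fun j l p n => shiftMode (A (c' j)) p (shiftMode (A (a' j)) l g) n with hX₃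
  -- the delta function is killed by `y - x`
  have h1 : e₂₁ ((d₁₃ ^ m) X₁) = ∑ j, tw₃ 1 (f j) ((d₁₃ ^ m) (X₃ j)) := by
    have hc := (commute_e₂₁_d₁₃ (W := W)).pow_right m
    have : e₂₁ ((d₁₃ ^ m) X₁) = (d₁₃ ^ m) (e₂₁ X₁) := LinearMap.congr_fun hc X₁
    rw [this, hX₁, hA.shift_relation hS hg, map_add, map_sum]
    have h0 : e₂₁ (fun l p n => if l + p + 1 = 0 then B a c • g n else 0) = 0 := by
      ext l p n
      have : l + (p + 1) + 1 = l + 1 + p + 1 := by ring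
      simp [e₂₁, s₁_apply, s₂_apply, this]
    rw [h0, add_zero, map_sum]
    refine Finset.sum_congr rfl fun j _ => ?_
    have hL := hA.lau₃_shiftMode (c' j) (a' j) hg
    rw [tw₃_succ hL, ← (tw₃_pow₁₃ m hL _ _).2]
    rfl
  have h2 : ∃ k, ∀ l, k ≤ l → e₂₁ ((d₁₃ ^ m) X₁) l = 0 := by
    choose k hk using hgood
    obtain ⟨K, hK⟩ := (Finset.univ.image k).exists_le
    refine ⟨K, fun l hl => ?_⟩
    ext p n
    rw [h1]
    simp only [Finset.sum_apply]
    refine Finset.sum_eq_zero fun j _ => tw_eq_zero fun p' l' hl' => ?_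
    simp only [hX₃]
    have hkj : k j ≤ K := hK _ (Finset.mem_image_of_mem k (Finset.mem_univ j))
    rw [d₁₃_pow_shiftMode _ _ fun l => hg.shiftMode _ _]
    dsimp only
    rw [hk j l' (by omega), shiftMode_zero]
    rfl
  obtain ⟨k, hk⟩ := h2
  have h3 : (d₂₃ ^ m') X₂ = (d₂₃ ^ m') X₁ := by
    rw [hX₂, hX₁, d₂₃_pow_shiftMode _ _ hFn, d₂₃_pow_shiftMode _ _ fun p => hg.shiftMode _ _, hm']
  set E := e₂₁ ((d₁₃ ^ m) X₂) with hE
  have hc : (d₂₃ ^ m') E = (d₂₃ ^ m') (e₂₁ ((d₁₃ ^ m) X₁)) := by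
    have c1 : ∀ X, (d₂₃ ^ m') (e₂₁ ((d₁₃ ^ m) X)) = e₂₁ ((d₁₃ ^ m) ((d₂₃ (W := W) ^ m') X)) := by
      intro X
      have e1 := LinearMap.congr_fun ((commute_e₂₁_d₂₃ (W := W)).pow_right m') ((d₁₃ ^ m) X)
      have e2 := LinearMap.congr_fun ((commute_d₁₃_d₂₃ (W := W)).pow_pow m m') X
      simp only [Module.End.mul_apply] at e1 e2
      rw [← e1, ← e2]
    rw [hE, c1, c1, h3]
  have hX₂0 : ∀ l p, p₀ ≤ p → X₂ l p = 0 := fun l p hp => by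
    ext n; simp only [hX₂, hp₀ p hp, shiftMode_zero]
  have hd0 : ∀ l p, p₀ ≤ p → (d₁₃ ^ m) X₂ l p = 0 := fun l p hp => by
    ext n
    rw [slice₁₃]
    have : (fun l n => X₂ l p n) = 0 := by ext l n; rw [hX₂0 l p hp]; rfl
    rw [this, map_zero]; rfl
  have hE0 : ∀ l, k ≤ l → E l = 0 := by
    intro l hl
    have hEt : FTrunc (E l) := by
      refine ⟨p₀, fun p hp => ?_⟩
      ext n
      have e1 := hd0 l (p + 1) (by omega)
      have e2 := hd0 (l + 1) p hp
      simp [hE, e₂₁, s₁_apply, s₂_apply, e1, e2]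
    ext1 p
    refine eq_zero_of_dg_pow m' hEt (k := p) (fun q _ => ?_) p le_rfl
    ext n
    rw [← slice₂₃, hc, slice₂₃, hk l hl, map_zero]
    rfl
  -- now `y - x` is inverted in the expansion by nonnegative powers of `y`
  have hfin : ∀ j : ℕ, ∀ p, p₀ - j ≤ p → ∃ k, ∀ l, k ≤ l → (d₁₃ ^ m) X₂ l p = 0 := by
    intro j
    induction j with
    | zero => intro p hp; exact ⟨0, fun l _ => hd0 l p (by simpa using hp)⟩
    | succ j ih =>
      intro p hp
      obtain ⟨k', hk'⟩ := ih (p + 1) (by push_cast at hp; omega)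
      refine ⟨max k k' + 1, fun l hl => ?_⟩
      have e1 := congrFun (hE0 (l - 1) (by omega)) p
      have e2 := hk' (l - 1) (by omega)
      have e3 : E (l - 1) p = (d₁₃ ^ m) X₂ (l - 1) (p + 1) - (d₁₃ ^ m) X₂ (l - 1 + 1) p := rfl
      rw [e3, e2, zero_sub, sub_add_cancel] at e1
      exact neg_eq_zero.mp e1
  obtain ⟨k', hk'⟩ := hfin (p₀ - p).toNat p (by omega)
  refine ⟨k', fun l hl => ?_⟩
  ext n
  have := congrFun (hk' l hl) n
  rw [slice₁₃] at this
  exact this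

lemma isReexp_zero : IsReexp (W := W) 0 0 := ⟨⟨0, fun _ _ => rfl⟩, 0, rfl⟩

lemma IsReexp.eq_zero {a : ℤ → Module.End ℂ W} {F : ℤ → ℤ → W}
    (h : IsReexp (fun q => shiftMode a q 0) F) : F = 0 := by
  refine h.unique ?_
  have : (fun q => shiftMode a q 0) = (0 : ℤ → ℤ → W) := funext fun q => shiftMode_zero a q
  rw [this]; exact isReexp_zero

/-- The re-expanded operators satisfy the `S`-relation: it holds for the operators `a(y + z)`, hence
for the re-expansions up to powers of `x + z` and `y + z`, and these powers act injectively on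
series which are truncated in the respective variable. -/
theorem IsHSModes.reexp_relation (hA : IsHSModes B S A) {a c : H} {r : ℕ} {c' a' : Fin r → H}
    {f : Fin r → LaurentSeries ℂ} (hS : S (c ⊗ₜ[ℂ] a) = ∑ j, (c' j ⊗ₜ[ℂ] a' j) ⊗ₜ[ℂ] f j)
    {g : ℤ → W} (hg : FTrunc g) {Fc : ℤ → ℤ → W} (hFc : IsReexp (fun q => shiftMode (A c) q g) Fc)
    {Ga : ℤ → ℤ → ℤ → W} (hGa : ∀ p, IsReexp (fun q => shiftMode (A a) q (Fc p)) (Ga p))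
    {Fa : Fin r → ℤ → ℤ → W} (hFa : ∀ j, IsReexp (fun q => shiftMode (A (a' j)) q g) (Fa j))
    {Gc : Fin r → ℤ → ℤ → ℤ → W}
    (hGc : ∀ j l, IsReexp (fun q => shiftMode (A (c' j)) q (Fa j l)) (Gc j l))
    {m₁ m₂ : ℕ} (hm₁ : ∀ p, Good m₁ fun q => shiftMode (A a) q (Fc p))
    (hm₂ : ∀ j l, Good m₂ fun q => shiftMode (A (c' j)) q (Fa j l)) (l p : ℤ) :
    Ga p l - ∑ j, tw 0 (f j) (fun p l => Gc j l p) p l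
      = if l + p + 1 = 0 then B a c • g else 0 := by
  have hL : ∀ j, Lau (fun p l => Gc j l p) := fun j => by
    refine lau_of_fTrunc ?_ fun l => (hGc j l).1
    obtain ⟨k, hk⟩ := (hFa j).1
    refine ⟨k, fun l hl p => ?_⟩
    have := hGc j l
    rw [hk l hl] at this
    rw [this.eq_zero]; rfl
  have hL₃ : ∀ j, Lau₃ (Gc j) := fun j n => (hL j).map (LinearMap.proj n)
  have hFcn := hFc.fTrunc_apply hg
  have hFan := fun j => (hFa j).fTrunc_apply hg
  -- a common exponent
  obtain ⟨M, hM₁, hM₂, hMc, hMa⟩ : ∃ M : ℕ, m₁ ≤ M ∧ m₂ ≤ M ∧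
      (dg ^ M) Fc = (dg ^ M) (fun q => shiftMode (A c) q g) ∧
      ∀ j, (dg ^ M) (Fa j) = (dg ^ M) (fun q => shiftMode (A (a' j)) q g) := by
    obtain ⟨m₃, hm₃⟩ := hFc.2
    have := fun j => (hFa j).2
    choose m₄ hm₄ using this
    obtain ⟨M, hM⟩ := (insert m₁ (insert m₂ (insert m₃ (Finset.univ.image m₄)))).exists_le
    refine ⟨M, hM _ (by simp), hM _ (by simp), dg_pow_eq_of_le (hM _ (by simp)) hm₃,
      fun j => dg_pow_eq_of_le (hM _ (by simp)) (hm₄ j)⟩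
  set G : ℤ → ℤ → ℤ → W := fun l p n => Ga p l n with hG
  set X₁ : ℤ → ℤ → ℤ → W := fun l p n => shiftMode (A a) l (shiftMode (A c) p g) n with hX₁
  set X₂ : ℤ → ℤ → ℤ → W := fun l p n => shiftMode (A a) l (Fc p) n with hX₂
  set X₃ : Fin r → ℤ → ℤ → ℤ → W :=
    fun j l p n => shiftMode (A (c' j)) p (shiftMode (A (a' j)) l g) n with hX₃
  set Y : Fin r → ℤ → ℤ → ℤ → W := fun j l p n => shiftMode (A (c' j)) p (Fa j l) n with hY
  set D : ℤ → ℤ → ℤ → W := fun l p n => if l + p + 1 = 0 then B a c • g n else 0 with hD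
  have i1 : (d₁₃ ^ M) G = (d₁₃ ^ M) X₂ := by
    ext l p n
    rw [slice₁₃, slice₁₃]
    exact congrFun (congrFun ((hGa p).dg_pow_eq ((hm₁ p).mono hM₁)) l) n
  have i2 : (d₂₃ ^ M) X₂ = (d₂₃ ^ M) X₁ := by
    rw [hX₂, hX₁, d₂₃_pow_shiftMode _ _ hFcn, d₂₃_pow_shiftMode _ _ fun p => hg.shiftMode _ _, hMc]
  have i3 : ∀ j, (d₂₃ ^ M) (Gc j) = (d₂₃ ^ M) (Y j) := fun j => by
    ext l p n
    rw [slice₂₃, slice₂₃]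
    exact congrFun (congrFun ((hGc j l).dg_pow_eq ((hm₂ j l).mono hM₂)) p) n
  have i4 : ∀ j, (d₁₃ ^ M) (Y j) = (d₁₃ ^ M) (X₃ j) := fun j => by
    simp only [hY, hX₃]
    rw [d₁₃_pow_shiftMode _ _ (hFan j), d₁₃_pow_shiftMode _ _ fun p => hg.shiftMode _ _, hMa j]
  have comm : ∀ X : ℤ → ℤ → ℤ → W, (d₁₃ ^ M) ((d₂₃ ^ M) X) = (d₂₃ ^ M) ((d₁₃ ^ M) X) := fun X =>
    LinearMap.congr_fun ((commute_d₁₃_d₂₃ (W := W)).pow_pow M M) X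
  -- the defect in the `S`-relation for the re-expansions
  set Γ : ℤ → ℤ → ℤ → W := G - ∑ j, tw₃ 0 (f j) (Gc j) - D with hΓ
  have hΓ0 : (d₁₃ ^ M) ((d₂₃ ^ M) Γ) = 0 := by
    rw [hΓ, map_sub, map_sub, map_sub, map_sub, map_sum, map_sum, comm G, i1, ← comm, i2]
    have : ∀ j ∈ Finset.univ, (d₁₃ ^ M) ((d₂₃ ^ M) (tw₃ 0 (f j) (Gc j)))
        = (d₁₃ ^ M) ((d₂₃ ^ M) (tw₃ 0 (f j) (X₃ j))) := fun j _ => by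
      have hX := hA.lau₃_shiftMode (c' j) (a' j) hg
      obtain ⟨l1, t1⟩ := tw₃_pow₂₃ M (hL₃ j) 0 (f j)
      obtain ⟨l2, t2⟩ := tw₃_pow₂₃ M hX 0 (f j)
      rw [← t1, ← t2, ← (tw₃_pow₁₃ M l1 0 (f j)).2, ← (tw₃_pow₁₃ M l2 0 (f j)).2, i3, comm, i4,
        ← comm]
    rw [Finset.sum_congr rfl this, ← map_sum, ← map_sum, ← map_sub, ← map_sub, ← map_sub,
      ← map_sub, hX₁, hA.shift_relation hS hg]
    simp [hX₃, hD]
  -- truncation of `Γ` in each of the two variables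
  have htw : ∀ j l p n, tw₃ 0 (f j) (Gc j) l p n = tw 0 (f j) (fun p l => Gc j l p) p l n :=
    fun j l p n => (map_tw (LinearMap.proj n : (ℤ → W) →ₗ[ℂ] W) (hL j) (f j) 0 p l).symm
  have hΓp : ∀ p, FTrunc fun l n => Γ l p n := by
    intro p
    have e1 : FTrunc fun l n => G l p n := (hGa p).1
    have e2 : ∀ T : Finset (Fin r), FTrunc fun l n => (∑ j ∈ T, tw₃ 0 (f j) (Gc j)) l p n := by
      intro T
      induction T using Finset.induction_on with
      | empty => exact ⟨0, fun _ _ => rfl⟩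
      | insert j T hj ih =>
        rw [Finset.sum_insert hj]
        refine FTrunc.add ?_ ih
        obtain ⟨k, hk⟩ := ((hL j).tw 0 (f j)).1
        refine ⟨k, fun l hl => ?_⟩
        ext n
        change tw₃ 0 (f j) (Gc j) l p n = 0
        rw [htw, hk p l hl]
        rfl
    have e3 : FTrunc fun l n => D l p n := ⟨-p, fun l hl => by
      ext n; simp only [hD]; rw [if_neg (by omega)]; rfl⟩
    exact (e1.sub (e2 _)).sub e3
  have hΓl : ∀ l, FTrunc (Γ l) := by
    intro l
    have e1 : FTrunc (G l) := by
      obtain ⟨k, hk⟩ := hFc.1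
      refine ⟨k, fun p hp => ?_⟩
      have := hGa p
      rw [hk p hp] at this
      simp only [hG]
      rw [this.eq_zero]; rfl
    have e2 : ∀ T : Finset (Fin r), FTrunc ((∑ j ∈ T, tw₃ 0 (f j) (Gc j)) l) := by
      intro T
      induction T using Finset.induction_on with
      | empty => exact ⟨0, fun _ _ => rfl⟩
      | insert j T hj ih =>
        rw [Finset.sum_insert hj]
        refine FTrunc.add ?_ ih
        obtain ⟨k, hk⟩ := ((hL j).tw 0 (f j)).2 l
        refine ⟨k, fun p hp => ?_⟩
        ext n
        change tw₃ 0 (f j) (Gc j) l p n = 0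
        rw [htw, hk p l hp le_rfl]
        rfl
    have e3 : FTrunc (D l) := ⟨-l, fun p hp => by
      ext n; simp only [hD]; rw [if_neg (by omega)]; rfl⟩
    exact (e1.sub (e2 _)).sub e3
  have hΓ'p : ∀ p, FTrunc fun l n => (d₂₃ ^ M) Γ l p n := by
    have : ∀ (m : ℕ) (X : ℤ → ℤ → ℤ → W), (∀ p, FTrunc fun l n => X l p n) →
        ∀ p, FTrunc fun l n => (d₂₃ ^ m) X l p n := by
      intro m
      induction m with
      | zero => intro X hX; exact hX
      | succ m ih =>
        intro X hX
        rw [pow_succ]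
        refine ih _ fun p => ?_
        obtain ⟨k, hk⟩ := hX p
        obtain ⟨k', hk'⟩ := hX (p + 1)
        refine ⟨max k k', fun l hl => ?_⟩
        ext n
        have e1 := congrFun (hk' l (by omega)) n
        have e2 := congrFun (hk l (by omega)) (n + 1)
        dsimp only at e1 e2
        simp [d₂₃, s₂_apply, s₃_apply, e1, e2]
    exact this M Γ hΓp
  have hΓ1 : (d₂₃ ^ M) Γ = 0 := by
    ext l p n
    refine congrFun (eq_zero_of_dg_pow M (hΓ'p p) (k := l) (fun l' _ => ?_) l le_rfl) n
    ext n
    rw [← slice₁₃, hΓ0]; rfl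
  have hΓ2 : Γ l p = 0 := by
    refine eq_zero_of_dg_pow M (hΓl l) (k := p) (fun p' _ => ?_) p le_rfl
    ext n
    rw [← slice₂₃, hΓ1]; rfl
  ext n
  have := congrFun hΓ2 n
  simp only [hΓ, Pi.sub_apply, Finset.sum_apply, htw] at this
  have h := sub_eq_zero.mp this
  simp only [Pi.sub_apply, Finset.sum_apply]
  rw [show Ga p l n = G l p n from rfl]
  refine h.trans ?_
  simp only [hD]
  split_ifs <;> rfl

end HSModes

/-! ### Re-expansion as an `(H, S)`-module -/

section ReexpSpace

variable {H : Type*} [AddCommGroup H] [Module ℂ H]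
  {W : Type*} [AddCommGroup W] [Module ℂ W]

lemma exists_tensor_rep (x : (H ⊗[ℂ] H) ⊗[ℂ] LaurentSeries ℂ) :
    ∃ (r : ℕ) (b a : Fin r → H) (f : Fin r → LaurentSeries ℂ),
      x = ∑ j, (b j ⊗ₜ[ℂ] a j) ⊗ₜ[ℂ] f j := by
  have hadd : ∀ x y : (H ⊗[ℂ] H) ⊗[ℂ] LaurentSeries ℂ,
      (∃ (r : ℕ) (b a : Fin r → H) (f : Fin r → LaurentSeries ℂ),
        x = ∑ j, (b j ⊗ₜ[ℂ] a j) ⊗ₜ[ℂ] f j) →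
      (∃ (r : ℕ) (b a : Fin r → H) (f : Fin r → LaurentSeries ℂ),
        y = ∑ j, (b j ⊗ₜ[ℂ] a j) ⊗ₜ[ℂ] f j) →
      ∃ (r : ℕ) (b a : Fin r → H) (f : Fin r → LaurentSeries ℂ),
        x + y = ∑ j, (b j ⊗ₜ[ℂ] a j) ⊗ₜ[ℂ] f j := by
    rintro x y ⟨r, b, a, f, rfl⟩ ⟨r', b', a', f', rfl⟩
    refine ⟨r + r', Fin.append b b', Fin.append a a', Fin.append f f', ?_⟩
    simp [Fin.sum_univ_add]
  have hzero : ∃ (r : ℕ) (b a : Fin r → H) (f : Fin r → LaurentSeries ℂ),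
      (0 : (H ⊗[ℂ] H) ⊗[ℂ] LaurentSeries ℂ) = ∑ j, (b j ⊗ₜ[ℂ] a j) ⊗ₜ[ℂ] f j :=
    ⟨0, 0, 0, 0, by simp⟩
  induction x using TensorProduct.induction_on with
  | zero => exact hzero
  | add x y hx hy => exact hadd x y hx hy
  | tmul x f =>
    induction x using TensorProduct.induction_on with
    | zero => rw [TensorProduct.zero_tmul]; exact hzero
    | add x y hx hy => rw [TensorProduct.add_tmul]; exact hadd _ _ hx hy
    | tmul b a => exact ⟨1, fun _ => b, fun _ => a, fun _ => f, by simp⟩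

lemma shiftMode_add_left (a b : ℤ → Module.End ℂ W) (q : ℤ) {g : ℤ → W} (hg : FTrunc g) :
    shiftMode (a + b) q g = shiftMode a q g + shiftMode b q g := by
  ext n
  exact bin_add (hg.sTrunc_mode a) (hg.sTrunc_mode b) _ _ _

lemma shiftMode_smul_left (a : ℤ → Module.End ℂ W) (q : ℤ) (c : ℂ) {g : ℤ → W} (hg : FTrunc g) :
    shiftMode (c • a) q g = c • shiftMode a q g := by
  ext n
  exact bin_smul (hg.sTrunc_mode a) _ _ _ _

/-- The series `g(z)` in `W((z))` such that, for each `a`, some product `(y + z)^m a(y + z) g(z)` is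
truncated in `y`. -/
def reexpSpace (A : H →ₗ[ℂ] ℤ → Module.End ℂ W) : Submodule ℂ (ℤ → W) where
  carrier := {g | FTrunc g ∧ ∀ a, ∃ m, Good m fun q => shiftMode (A a) q g}
  zero_mem' := by
    refine ⟨.zero, fun a => ⟨0, 0, fun q _ => ?_⟩⟩
    ext n
    exact congrFun (shiftMode_zero (A a) q) n
  add_mem' := by
    rintro g g' ⟨hg, h⟩ ⟨hg', h'⟩
    refine ⟨hg.add hg', fun a => ?_⟩
    obtain ⟨m, hm⟩ := h a
    obtain ⟨m', hm'⟩ := h' a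
    refine ⟨max m m', ?_⟩
    have := (hm.mono (le_max_left m m')).add (hm'.mono (le_max_right m m'))
    simp only [shiftMode_add _ _ hg hg']
    exact this
  smul_mem' := by
    rintro c g ⟨hg, h⟩
    refine ⟨hg.smul c, fun a => ?_⟩
    obtain ⟨m, hm⟩ := h a
    refine ⟨m, ?_⟩
    have := hm.smul c
    simp only [shiftMode_smul _ _ _ hg]
    exact this

variable {A : H →ₗ[ℂ] ℤ → Module.End ℂ W}

lemma exists_good (g : reexpSpace A) {r : ℕ} (a : Fin r → H) :
    ∃ m, ∀ j, Good m fun q => shiftMode (A (a j)) q g := by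
  choose m hm using fun j => g.2.2 (a j)
  obtain ⟨M, hM⟩ := (Finset.univ.image m).exists_le
  exact ⟨M, fun j => (hm j).mono (hM _ (by simp))⟩

/-- The re-expansion of `a(y + z) g(z)` as a series in `y` with coefficients in `W((z))`. -/
def reexp (a : H) (g : reexpSpace A) : ℤ → ℤ → W :=
  Classical.choose (g.2.2 a).choose_spec.exists_isReexp

lemma isReexp_reexp (a : H) (g : reexpSpace A) :
    IsReexp (fun q => shiftMode (A a) q g) (reexp a g) :=
  Classical.choose_spec (g.2.2 a).choose_spec.exists_isReexp

variable {B : LinearMap.BilinForm ℂ H}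
    {S : H ⊗[ℂ] H →ₗ[ℂ] (H ⊗[ℂ] H) ⊗[ℂ] LaurentSeries ℂ}

/-- The uniform exponent for all modes of the re-expansion. -/
lemma IsHSModes.exists_good_reexp (hA : IsHSModes B S A) (a c : H) (g : reexpSpace A) :
    ∃ m, ∀ p, Good m fun q => shiftMode (A a) q (reexp c g p) := by
  obtain ⟨r, c', a', f, hS⟩ := exists_tensor_rep (S (c ⊗ₜ[ℂ] a))
  obtain ⟨m, hm⟩ := exists_good g a'
  exact ⟨m, fun p => hA.good_of_isReexp hS g.2.1 hm (isReexp_reexp c g) p⟩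

lemma IsHSModes.reexp_mem (hA : IsHSModes B S A) (c : H) (g : reexpSpace A) (p : ℤ) :
    reexp c g p ∈ reexpSpace A :=
  ⟨(isReexp_reexp c g).fTrunc_apply g.2.1 p,
    fun a => (hA.exists_good_reexp a c g).imp fun _ h => h p⟩

/-- The modes, in the variable `y`, of the re-expansions of `a(y + z)`, as operators
on `reexpSpace A`. -/
def IsHSModes.reexpModes (hA : IsHSModes B S A) : H →ₗ[ℂ] ℤ → Module.End ℂ (reexpSpace A) where
  toFun a p :=
    { toFun := fun g => ⟨reexp a g p, hA.reexp_mem a g p⟩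
      map_add' := fun g g' => by
        refine Subtype.ext (?_ : reexp a (g + g') p = (reexp a g + reexp a g') p)
        refine congrFun ((isReexp_reexp a (g + g')).unique ?_) p
        have := (isReexp_reexp a g).add (isReexp_reexp a g')
        simp only [Submodule.coe_add, shiftMode_add _ _ g.2.1 g'.2.1]
        exact this
      map_smul' := fun c g => by
        refine Subtype.ext (?_ : reexp a (c • g) p = (c • reexp a g) p)
        refine congrFun ((isReexp_reexp a (c • g)).unique ?_) p
        have := (isReexp_reexp a g).smul c
        simp only [Submodule.coe_smul, shiftMode_smul _ _ _ g.2.1]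
        exact this }
  map_add' a b := by
    refine funext fun p => LinearMap.ext fun g => Subtype.ext
      (?_ : reexp (a + b) g p = (reexp a g + reexp b g) p)
    refine congrFun ((isReexp_reexp (a + b) g).unique ?_) p
    have := (isReexp_reexp a g).add (isReexp_reexp b g)
    simp only [map_add, shiftMode_add_left _ _ _ g.2.1]
    exact this
  map_smul' c a := by
    refine funext fun p => LinearMap.ext fun g => Subtype.ext
      (?_ : reexp (c • a) g p = (c • reexp a g) p)
    refine congrFun ((isReexp_reexp (c • a) g).unique ?_) p
    have := (isReexp_reexp a g).smul c
    simp only [map_smul, shiftMode_smul_left _ _ _ g.2.1]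
    exact this

lemma IsHSModes.coe_reexpModes (hA : IsHSModes B S A) (a : H) (p : ℤ) (g : reexpSpace A) :
    (hA.reexpModes a p g : ℤ → W) = reexp a g p := rfl

/-- The space of re-expandable series is again an `(H, S)`-module. -/
theorem IsHSModes.isHSModes_reexpModes (hA : IsHSModes B S A) : IsHSModes B S hA.reexpModes := by
  have hT : ∀ a (g : reexpSpace A), FTrunc fun m => hA.reexpModes a m g := fun a g => by
    obtain ⟨k, hk⟩ := (isReexp_reexp a g).1
    exact ⟨k, fun q hq => Subtype.ext (hk q hq)⟩
  refine ⟨hT, fun a b r b' a' f hS m n g => ?_⟩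
  have hL : ∀ j, Lau fun p q => hA.reexpModes (b' j) p (hA.reexpModes (a' j) q g) := fun j => by
    refine lau_of_fTrunc ?_ fun q => hT _ _
    obtain ⟨K, hK⟩ := hT (a' j) g
    exact ⟨K, fun q hq p => by dsimp only at hK; rw [hK q hq, map_zero]⟩
  obtain ⟨m₁, hm₁⟩ := hA.exists_good_reexp a b g
  obtain ⟨m₂, hm₂⟩ : ∃ m₂, ∀ j l, Good m₂ fun q => shiftMode (A (b' j)) q (reexp (a' j) g l) := by
    choose k hk using fun j => hA.exists_good_reexp (b' j) (a' j) g
    obtain ⟨M, hM⟩ := (Finset.univ.image k).exists_le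
    exact ⟨M, fun j l => (hk j l).mono (hM _ (by simp))⟩
  have key := hA.reexp_relation hS g.2.1 (isReexp_reexp b g)
    (Ga := fun p => reexp a (hA.reexpModes b p g)) (fun p => isReexp_reexp a _)
    (fun j => isReexp_reexp (a' j) g) (Gc := fun j l => reexp (b' j) (hA.reexpModes (a' j) l g))
    (fun j l => isReexp_reexp (b' j) _) hm₁ hm₂ m n
  refine Subtype.ext ?_
  have h1 : ((hA.reexpModes a m (hA.reexpModes b n g)
      - ∑ j, tw 0 (f j) (fun p q => hA.reexpModes (b' j) p (hA.reexpModes (a' j) q g)) n m :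
        reexpSpace A) : ℤ → W)
      = reexp a (hA.reexpModes b n g) m
        - ∑ j, tw 0 (f j) (fun p l => reexp (b' j) (hA.reexpModes (a' j) l g) p) n m := by
    rw [Submodule.coe_sub, Submodule.coe_sum, hA.coe_reexpModes]
    congr 1
    exact Finset.sum_congr rfl fun j _ => map_tw (reexpSpace A).subtype (hL j) (f j) 0 n m
  rw [h1, key]
  split_ifs <;> rfl

end ReexpSpace

/-! ### Modules over the tensor algebra -/

section ModeAlgebra

variable {H : Type u} [AddCommGroup H] [Module ℂ H]

section Rep

variable {N : Type*} [AddCommGroup N] [Module ℂ N]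

lemma coeff_T (n : ℤ) :
    (LaurentPolynomial.T n : LaurentPolynomial ℂ).coeff = Finsupp.single n 1 := rfl

/-- The representation of the tensor algebra given by a family of modes. -/
def modeRep (A : H →ₗ[ℂ] ℤ → Module.End ℂ N) : ModeAlgebra H →ₐ[ℂ] Module.End ℂ N :=
  TensorAlgebra.lift ℂ <| TensorProduct.lift
    { toFun := fun a => (Finsupp.linearCombination ℂ (A a)).comp
        (AddMonoidAlgebra.coeffLinearEquiv (S := ℂ) (M := ℤ) ℂ).toLinearMap
      map_add' := fun a b => by
        ext
        simp [coeff_T]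
      map_smul' := fun c a => by
        ext
        simp [coeff_T] }

lemma modeRep_mode (A : H →ₗ[ℂ] ℤ → Module.End ℂ N) (a : H) (m : ℤ) :
    modeRep A (mode a m) = A a m := by
  rw [modeRep, mode, TensorAlgebra.lift_ι_apply, TensorProduct.lift.tmul]
  simp [coeff_T]

end Rep

/-- A subspace which is stable under all `a(m)` is stable under the tensor algebra. -/
lemma smul_mem_of_act_mem {N : Type*} [AddCommGroup N] [Module ℂ N] [Module (ModeAlgebra H) N]
    [IsScalarTower ℂ (ModeAlgebra H) N] (P : Submodule ℂ N)
    (hP : ∀ (a : H) (m : ℤ), ∀ x ∈ P, act a m x ∈ P) (t : ModeAlgebra H) : ∀ x ∈ P, t • x ∈ P := by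
  induction t using TensorAlgebra.induction with
  | algebraMap r => intro x hx; rw [algebraMap_smul]; exact P.smul_mem r hx
  | add s t hs ht => intro x hx; rw [add_smul]; exact P.add_mem (hs x hx) (ht x hx)
  | mul s t hs ht => intro x hx; rw [mul_smul]; exact hs _ (ht x hx)
  | ι y =>
    induction y using TensorProduct.induction_on with
    | zero => intro x hx; rw [map_zero, zero_smul]; exact P.zero_mem
    | add y z hy hz => intro x hx; rw [map_add, add_smul]; exact P.add_mem (hy x hx) (hz x hx)
    | tmul a f =>
      induction f using LaurentPolynomial.induction_on' with
      | add f g hf hg =>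
        intro x hx
        rw [TensorProduct.tmul_add, map_add, add_smul]
        exact P.add_mem (hf x hx) (hg x hx)
      | C_mul_T n c =>
        intro x hx
        rw [← LaurentPolynomial.smul_eq_C_mul, TensorProduct.tmul_smul, map_smul, smul_assoc]
        exact P.smul_mem c (hP a n x hx)

section ActLin

variable (H) (W : Type*) [AddCommGroup W] [Module ℂ W] [Module (ModeAlgebra H) W]
  [IsScalarTower ℂ (ModeAlgebra H) W]

/-- The operators `a(m)` on a module over the tensor algebra, as linear maps. -/
def actLin : H →ₗ[ℂ] ℤ → Module.End ℂ W where
  toFun a m :=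
    { toFun := act a m
      map_add' := fun x y => smul_add _ _ _
      map_smul' := fun c x => smul_algebra_smul_comm _ _ _ }
  map_add' a b := by
    ext m x
    change mode (a + b) m • x = mode a m • x + mode b m • x
    rw [mode, TensorProduct.add_tmul, map_add, add_smul]
    rfl
  map_smul' c a := by
    ext m x
    change mode (c • a) m • x = c • mode a m • x
    rw [mode, ← TensorProduct.smul_tmul', map_smul, smul_assoc]
    rfl

end ActLin

@[simp] lemma actLin_apply {W : Type*} [AddCommGroup W] [Module ℂ W] [Module (ModeAlgebra H) W]
    [IsScalarTower ℂ (ModeAlgebra H) W] (a : H) (m : ℤ) (x : W) :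
    actLin H W a m x = act a m x := rfl

variable {B : LinearMap.BilinForm ℂ H}
    {S : H ⊗[ℂ] H →ₗ[ℂ] (H ⊗[ℂ] H) ⊗[ℂ] LaurentSeries ℂ}

lemma IsHSModule.isHSModes {W : Type*} [AddCommGroup W] [Module ℂ W] [Module (ModeAlgebra H) W]
    [IsScalarTower ℂ (ModeAlgebra H) W] (h : IsHSModule B S W) :
    IsHSModes B S (actLin H W) := by
  have hT : ∀ (a : H) (x : W), FTrunc fun m => actLin H W a m x := h.truncation
  refine ⟨hT, fun a b r b' a' f hS m n x => ?_⟩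
  have hL : ∀ j, Lau fun p q => act (b' j) p (act (a' j) q x) := fun j => by
    refine lau_of_fTrunc ?_ fun q => h.truncation _ _
    obtain ⟨K, hK⟩ := h.truncation (a' j) x
    exact ⟨K, fun q hq p => by rw [hK q hq]; exact smul_zero _⟩
  rw [← h.relation a b r b' a' f hS m n x]
  congr 1
  exact Finset.sum_congr rfl fun j _ => (swapCoeff_eq_tw _ _ _ _ _ _ _ (hL j)).symm

variable {V : Type v} [AddCommGroup V] [Module ℂ V] [Module (ModeAlgebra H) V]
  [IsScalarTower ℂ (ModeAlgebra H) V] {one : V}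

lemma IsVacuumModule.induction (hV : IsVacuumModule B S V one) {P : V → Prop}
    (h0 : P 0) (hadd : ∀ x y, P x → P y → P (x + y)) (hsmul : ∀ (c : ℂ) x, P x → P (c • x))
    (hone : P one) (hact : ∀ (a : H) (m : ℤ) x, P x → P (act a m x)) (v : V) : P v := by
  let Q : Submodule ℂ V :=
    { carrier := {x | P x}, zero_mem' := h0, add_mem' := fun {x y} hx hy => hadd x y hx hy,
      smul_mem' := fun c x hx => hsmul c x hx }
  have hv : v ∈ Submodule.span (ModeAlgebra H) {one} := by rw [hV.cyclic]; trivial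
  obtain ⟨t, rfl⟩ := Submodule.mem_span_singleton.mp hv
  exact smul_mem_of_act_mem Q hact t one hone

/-- A linear map which commutes with the modes is determined by the image of the generator. -/
lemma IsVacuumModule.hom_ext (hV : IsVacuumModule B S V one) {N : Type*} [AddCommGroup N]
    [Module ℂ N] {A : H → ℤ → N → N} {φ ψ : V →ₗ[ℂ] N} (h1 : φ one = ψ one)
    (hφ : ∀ a m v, φ (act (H := H) a m v) = A a m (φ v))
    (hψ : ∀ a m v, ψ (act (H := H) a m v) = A a m (ψ v)) : φ = ψ := by
  ext v
  induction v using hV.induction with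
  | h0 => simp
  | hadd x y hx hy => rw [map_add, map_add, hx, hy]
  | hsmul c x hx => rw [map_smul, map_smul, hx]
  | hone => exact h1
  | hact a m x hx => rw [hφ, hψ, hx]

/-- The universal property, for modes on a vector space of any size: the submodule generated
by `e` is a quotient of the tensor algebra. -/
theorem IsUniversalVacuumModule.exists_hom (hV : IsUniversalVacuumModule B S V one)
    {N : Type*} [AddCommGroup N] [Module ℂ N] {A : H →ₗ[ℂ] ℤ → Module.End ℂ N}
    (hA : IsHSModes B S A) {e : N} (he : ∀ a m, 0 ≤ m → A a m e = 0) :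
    ∃ φ : V →ₗ[ℂ] N, φ one = e ∧ ∀ a m v, φ (act a m v) = A a m (φ v) := by
  let _ : Module (ModeAlgebra H) N := Module.compHom N (modeRep A).toRingHom
  have hsmul : ∀ (t : ModeAlgebra H) (x : N), t • x = modeRep A t x := fun _ _ => rfl
  have : IsScalarTower ℂ (ModeAlgebra H) N := ⟨fun c t x => by
    rw [hsmul, hsmul, map_smul]; rfl⟩
  have hact : ∀ (a : H) m (x : N), act a m x = A a m x := fun a m x => by
    rw [act, hsmul, modeRep_mode]
  let ψ₀ := LinearMap.toSpanSingleton (ModeAlgebra H) N e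
  let ψ : (ModeAlgebra H ⧸ LinearMap.ker ψ₀) →ₗ[ModeAlgebra H] N :=
    (LinearMap.ker ψ₀).liftQ ψ₀ le_rfl
  have hinj : Function.Injective ψ := by
    rw [← LinearMap.ker_eq_bot]
    exact Submodule.ker_liftQ_eq_bot _ _ _ le_rfl
  let e' : ModeAlgebra H ⧸ LinearMap.ker ψ₀ := Submodule.Quotient.mk 1
  have he' : ψ e' = e := by
    simp [ψ, e', ψ₀]
  have hψ : ∀ (a : H) m x, ψ (act a m x) = A a m (ψ x) := fun a m x => by
    rw [← hact]; exact map_smul ψ _ _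
  have hT : ∀ (a : H) x, ∃ K : ℤ, ∀ m, K ≤ m →
      act a m (x : ModeAlgebra H ⧸ LinearMap.ker ψ₀) = 0 := fun a x => by
    obtain ⟨K, hK⟩ := hA.fTrunc a (ψ x)
    exact ⟨K, fun m hm => hinj (by rw [hψ, map_zero]; exact hK m hm)⟩
  let ψL : (ModeAlgebra H ⧸ LinearMap.ker ψ₀) →ₗ[ℂ] N := ψ.restrictScalars ℂ
  have hvac : IsVacuumModule B S (ModeAlgebra H ⧸ LinearMap.ker ψ₀) e' := by
    refine ⟨⟨hT, fun a b r b' a' f hS m n x => ?_⟩, fun a m hm => ?_, ?_⟩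
    · have hL : ∀ j, Lau fun p q => act (b' j) p (act (a' j) q x) := fun j => by
        refine lau_of_fTrunc ?_ fun q => hT _ _
        obtain ⟨K, hK⟩ := hT (a' j) x
        exact ⟨K, fun q hq p => by rw [hK q hq]; exact smul_zero _⟩
      have hsw : ∀ j, ψL (swapCoeff 0 (f j) (act (b' j)) (act (a' j)) m n x)
          = tw 0 (f j) (fun p q => A (b' j) p (A (a' j) q (ψ x))) n m := fun j => by
        rw [swapCoeff_eq_tw _ _ _ _ _ _ _ (hL j), map_tw ψL (hL j)]
        simp only [ψL, LinearMap.restrictScalars_apply, hψ]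
      have h := hA.relation a b r b' a' f hS m n (ψ x)
      refine hinj (?_ : ψL _ = ψL _)
      rw [map_sub, map_sum, Finset.sum_congr rfl fun j _ => hsw j]
      have h2 : ψL (act a m (act b n x)) = A a m (A b n (ψ x)) := by
        simp only [ψL, LinearMap.restrictScalars_apply, hψ]
      rw [h2, h]
      split_ifs
      · rw [map_smul]; rfl
      · rw [map_zero]
    · exact hinj (by rw [hψ, he', map_zero, he a m hm])
    · rw [eq_top_iff]
      rintro x -
      obtain ⟨t, rfl⟩ := Submodule.Quotient.mk_surjective _ x
      refine Submodule.mem_span_singleton.mpr ⟨t, ?_⟩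
      simp only [e', ← Submodule.Quotient.mk_smul, smul_eq_mul, mul_one]
  obtain ⟨φ, hφ, -⟩ := hV.universal _ e' hvac
  refine ⟨(ψ.comp φ).restrictScalars ℂ, ?_, fun a m v => ?_⟩
  · simp [hφ, he']
  · simp only [LinearMap.restrictScalars_apply, LinearMap.comp_apply, ← hψ]
    congr 1
    exact map_smul φ _ _

end ModeAlgebra

/-! ### The vertex operators -/

section VertexOperators

variable {H : Type u} [AddCommGroup H] [Module ℂ H]
  {B : LinearMap.BilinForm ℂ H} {S : H ⊗[ℂ] H →ₗ[ℂ] (H ⊗[ℂ] H) ⊗[ℂ] LaurentSeries ℂ}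
  {V : Type v} [AddCommGroup V] [Module ℂ V] [Module (ModeAlgebra H) V]
  [IsScalarTower ℂ (ModeAlgebra H) V] {one : V}
  {W : Type w} [AddCommGroup W] [Module ℂ W] {A : H →ₗ[ℂ] ℤ → Module.End ℂ W}

/-- The constant series `w`. -/
def constSeries (w : W) (n : ℤ) : W := if n = -1 then w else 0

lemma shiftMode_constSeries (a : ℤ → Module.End ℂ W) (q n : ℤ) (w : W) :
    shiftMode a q (constSeries w) n
      = if n ≤ -1 then bc q (-1 - n).toNat • a (q + n + 1) w else 0 := by
  unfold shiftMode
  split_ifs with h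
  · obtain ⟨k, hk⟩ : ∃ k : ℕ, n + k = -1 := ⟨(-1 - n).toNat, by omega⟩
    rw [bin, finsum_eq_single _ k]
    · rw [show (-1 - n).toNat = k by omega]
      simp only [constSeries, hk, if_true, zero_add]
      congr 2
      congr 1
      omega
    · intro i hi
      simp only [constSeries]
      rw [if_neg (by omega), map_zero, smul_zero]
  · refine bin_eq_zero fun p' q' hq => ?_
    simp only [constSeries]
    rw [if_neg (by omega), map_zero]

lemma fTrunc_constSeries (w : W) : FTrunc (constSeries w) :=
  ⟨0, fun q hq => by rw [constSeries, if_neg (by omega)]⟩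

lemma bc_eq_zero_of_lt {q : ℤ} (hq : 0 ≤ q) {k : ℕ} (hk : q < k) : bc q k = 0 := by
  obtain ⟨q, rfl⟩ := Int.eq_ofNat_of_zero_le hq
  rw [bc_natCast, Nat.choose_eq_zero_of_lt (by omega)]
  simp

/-- The product `(y + z)^m a(y + z) w` has no negative powers of `y` as soon as
`x^m a(x) w` has none. -/
lemma dg_pow_constSeries (a : ℤ → Module.End ℂ W) {w : W} {m : ℕ}
    (hm : ∀ n : ℤ, (m : ℤ) ≤ n → a n w = 0) {q : ℤ} (hq : 0 ≤ q) :
    (dg ^ m) (fun q => shiftMode a q (constSeries w)) q = 0 := by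
  ext n
  rw [dg_pow_shiftMode a (fTrunc_constSeries w), bin]
  refine finsum_eq_zero_of_forall_eq_zero fun i => ?_
  by_cases h : n + i = -1
  · by_cases hi : q < i
    · rw [bc_eq_zero_of_lt hq hi, zero_smul]
    · simp only [constSeries, if_pos h]
      rw [hm _ (by omega), smul_zero]
  · simp only [constSeries, if_neg h, map_zero, smul_zero]

lemma constSeries_mem (hA : IsHSModes B S A) (w : W) : constSeries w ∈ reexpSpace A := by
  refine ⟨fTrunc_constSeries w, fun a => ?_⟩
  obtain ⟨k, hk⟩ := hA.fTrunc a w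
  exact ⟨k.toNat, 0, fun q hq => dg_pow_constSeries _ (fun n hn => hk n (by omega)) hq⟩

lemma IsReexp.constSeries_eq_zero {a : ℤ → Module.End ℂ W} {w : W} (hw : FTrunc fun n => a n w)
    {F : ℤ → ℤ → W} (hF : IsReexp (fun q => shiftMode a q (constSeries w)) F) {q : ℤ}
    (hq : 0 ≤ q) : F q = 0 := by
  obtain ⟨k, hk⟩ := hw
  have hz : ∀ q, 0 ≤ q → (dg ^ k.toNat) (fun q => shiftMode a q (constSeries w)) q = 0 :=
    fun q hq => dg_pow_constSeries a (fun n hn => hk n (by omega)) hq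
  have hg : Good k.toNat (fun q => shiftMode a q (constSeries w)) := ⟨0, hz⟩
  refine eq_zero_of_dg_pow k.toNat hF.1 (k := 0) (fun q hq => ?_) q hq
  rw [hF.dg_pow_eq hg, hz q hq]

lemma bc_neg_one (i : ℕ) : bc (-1) i = 1 := by
  induction i with
  | zero => simp
  | succ i ih =>
    have := bc_succ_succ (-1) i
    rw [neg_add_cancel, bc_zero_succ, ih] at this
    exact sub_eq_zero.mp this.symm

/-- The constant term, in `y`, of the re-expansion of `a(y + z) w` is `a(z) w`. -/
lemma IsReexp.constSeries_neg_one {a : ℤ → Module.End ℂ W} {w : W} (hw : FTrunc fun n => a n w)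
    {F : ℤ → ℤ → W} (hF : IsReexp (fun q => shiftMode a q (constSeries w)) F) (n : ℤ) :
    F (-1) n = a n w := by
  have hz : ∀ q, 0 ≤ q → F q = 0 := fun q hq => hF.constSeries_eq_zero hw hq
  obtain ⟨k, hk⟩ := hw
  have hg : Good k.toNat (fun q => shiftMode a q (constSeries w)) :=
    ⟨0, fun q hq => dg_pow_constSeries a (fun n hn => hk n (by omega)) hq⟩
  have h := congrFun (congrFun (hF.dg_pow_eq hg) (-1)) (n - k.toNat)
  rw [dg_pow_apply, dg_pow_shiftMode a (fTrunc_constSeries w)] at h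
  rw [Finset.sum_eq_single_of_mem k.toNat (by simp)] at h
  · simp only [Nat.choose_self, one_smul, add_sub_cancel_right, sub_add_cancel] at h
    rw [h, bin]
    by_cases hn : n - k.toNat ≤ -1
    · rw [finsum_eq_single _ (-1 - (n - k.toNat)).toNat]
      · have e : n - k.toNat + ((-1 - (n - k.toNat)).toNat : ℤ) = -1 := by omega
        simp only [bc_neg_one, one_smul, constSeries, e, if_true]
        congr 2
        omega
      · intro i hi
        simp only [constSeries]
        rw [if_neg (by omega), map_zero, smul_zero]
    · have e : a n w = 0 := hk n (by omega)
      rw [e]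
      refine finsum_eq_zero_of_forall_eq_zero fun i => ?_
      simp only [constSeries]
      rw [if_neg (by omega), map_zero, smul_zero]
  · intro i hi hik
    have : i < k.toNat + 1 := Finset.mem_range.mp hi
    rw [hz _ (by omega), Pi.zero_apply, smul_zero]

/-- The homomorphism from `V` to the space of series which sends `one` to the constant
series `w`. -/
theorem IsUniversalVacuumModule.exists_fieldHom (hV : IsUniversalVacuumModule B S V one)
    (hA : IsHSModes B S A) (w : W) : ∃ φ : V →ₗ[ℂ] reexpSpace A,
      φ one = ⟨constSeries w, constSeries_mem hA w⟩ ∧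
      ∀ a m v, φ (act a m v) = hA.reexpModes a m (φ v) := by
  refine hV.exists_hom hA.isHSModes_reexpModes fun a m hm => Subtype.ext ?_
  rw [hA.coe_reexpModes]
  exact (isReexp_reexp a _).constSeries_eq_zero (hA.fTrunc a w) hm

/-- The linear map sending `v` to the field `Y_W(v, z)`, where `Y_W(v, z) w` is the image of `v`
under the homomorphism which sends `one` to the constant series `w`. -/
def IsUniversalVacuumModule.fieldHom (hV : IsUniversalVacuumModule B S V one)
    (hA : IsHSModes B S A) (w : W) : V →ₗ[ℂ] reexpSpace A :=
  Classical.choose (hV.exists_fieldHom hA w)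

namespace IsUniversalVacuumModule

variable (hV : IsUniversalVacuumModule B S V one) (hA : IsHSModes B S A)

lemma fieldHom_one (w : W) : hV.fieldHom hA w one = ⟨constSeries w, constSeries_mem hA w⟩ :=
  (Classical.choose_spec (hV.exists_fieldHom hA w)).1

lemma fieldHom_act (w : W) (a : H) (m : ℤ) (v : V) :
    hV.fieldHom hA w (act a m v) = hA.reexpModes a m (hV.fieldHom hA w v) :=
  (Classical.choose_spec (hV.exists_fieldHom hA w)).2 a m v

lemma fieldHom_add (w w' : W) :
    hV.fieldHom hA (w + w') = hV.fieldHom hA w + hV.fieldHom hA w' := by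
  refine hV.isVacuumModule.hom_ext (A := fun a m => hA.reexpModes a m) ?_
    (hV.fieldHom_act hA _) fun a m v => ?_
  · rw [LinearMap.add_apply, fieldHom_one, fieldHom_one, fieldHom_one]
    refine Subtype.ext (funext fun n => ?_)
    simp only [Submodule.coe_add, Pi.add_apply, constSeries]
    split_ifs <;> simp
  · simp only [LinearMap.add_apply, fieldHom_act, map_add]

lemma fieldHom_smul (c : ℂ) (w : W) : hV.fieldHom hA (c • w) = c • hV.fieldHom hA w := by
  refine hV.isVacuumModule.hom_ext (A := fun a m => hA.reexpModes a m) ?_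
    (hV.fieldHom_act hA _) fun a m v => ?_
  · rw [LinearMap.smul_apply, fieldHom_one, fieldHom_one]
    refine Subtype.ext (funext fun n => ?_)
    simp only [Submodule.coe_smul, Pi.smul_apply, constSeries]
    split_ifs <;> simp
  · simp only [LinearMap.smul_apply, fieldHom_act, map_smul]

/-- The mode `vₙ`, as a linear operator on `W`. -/
def fieldMode (v : V) (n : ℤ) : Module.End ℂ W where
  toFun w := (hV.fieldHom hA w v : ℤ → W) n
  map_add' w w' := by simp [fieldHom_add]
  map_smul' c w := by simp [fieldHom_smul]

/-- The vertex operators `Y_W(v, x)` on an `(H, S)`-module. -/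
def vertexOp : V →ₗ[ℂ] VertexOperator ℂ W where
  toFun v := VertexOperator.of_coeff (fun n => fieldMode hV hA v (-n - 1)) fun w => by
    obtain ⟨k, hk⟩ := (hV.fieldHom hA w v).2.1
    refine ⟨-k, fun n hn => ?_⟩
    by_contra hc
    exact hn (hk _ (by omega))
  map_add' v v' := by
    ext w n
    simp [fieldMode]
  map_smul' c v := by
    ext w n
    simp [fieldMode]
    rfl

lemma vmode_vertexOp (v : V) (n : ℤ) (w : W) :
    vmode (hV.vertexOp hA) v n w = (hV.fieldHom hA w v : ℤ → W) n := by
  simp only [vmode, vertexOp, LinearMap.coe_mk, AddHom.coe_mk, VertexOperator.ncoeff_of_coeff]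
  simp [fieldMode]

end IsUniversalVacuumModule

end VertexOperators

/-! ### Composition of substitutions -/

section Substitution

variable {W : Type*} [AddCommGroup W] [Module ℂ W]

lemma bc_mul_bc (y : ℤ) (i k : ℕ) : bc y i * bc (y - i) k = bc y (i + k) * ((i + k).choose k) := by
  have h := Ring.choose_smul_choose y (Nat.le_add_right i k)
  rw [Nat.add_sub_cancel_left, nsmul_eq_mul] at h
  have h' : (((i + k).choose i : ℤ) : ℂ) * (Ring.choose y (i + k) : ℤ)
      = (Ring.choose y i : ℤ) * (Ring.choose (y - i) k : ℤ) := by exact_mod_cast h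
  rw [Nat.choose_symm_add] at h'
  simp only [bc, pow_add]
  push_cast at h'
  linear_combination (-1 : ℂ) ^ i * (-1) ^ k * (-h')

/-- For each power of `z`, the powers of `x` are bounded below, uniformly in `y`. -/
def RTrunc (G : ℤ → ℤ → ℤ → W) : Prop := ∀ n, STrunc fun y x => G y x n

/-- The substitution `y ↦ y + x` in series in `y, x, z`. -/
def sub₁₂ (G : ℤ → ℤ → ℤ → W) (y x n : ℤ) : W := bin y (fun y x => G y x n) 0 x

lemma RTrunc.add {G G' : ℤ → ℤ → ℤ → W} (h : RTrunc G) (h' : RTrunc G') : RTrunc (G + G') :=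
  fun n => (h n).add (h' n)

lemma RTrunc.s₁ {G : ℤ → ℤ → ℤ → W} (h : RTrunc G) : RTrunc (s₁ G) := fun n => by
  have := (h n).shift 1 0
  simp only [add_zero] at this
  exact this

lemma RTrunc.s₂ {G : ℤ → ℤ → ℤ → W} (h : RTrunc G) : RTrunc (s₂ G) := fun n => by
  have := (h n).shift 0 1
  simp only [add_zero] at this
  exact this

lemma RTrunc.s₃ {G : ℤ → ℤ → ℤ → W} (h : RTrunc G) : RTrunc (s₃ G) := fun n => h (n + 1)

lemma sub₁₂_add {G G' : ℤ → ℤ → ℤ → W} (h : RTrunc G) (h' : RTrunc G') :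
    sub₁₂ (G + G') = sub₁₂ G + sub₁₂ G' := by
  ext y x n
  exact bin_add (h n) (h' n) y 0 x

lemma sub₁₂_s₁ {G : ℤ → ℤ → ℤ → W} (h : RTrunc G) : sub₁₂ (s₁ G) = d₁₂ (sub₁₂ G) := by
  ext y x n
  have h1 := bin_shift (fun y x => G y x n) y 0 x 1 0
  have h2 := bin_succ (h n) y 0 x
  simp only [add_zero, zero_add] at h1 h2
  simp only [sub₁₂, d₁₂, LinearMap.add_apply, Pi.add_apply, s₁_apply, s₂_apply]
  rw [h1, h2]
  abel

lemma sub₁₂_s₂ (G : ℤ → ℤ → ℤ → W) : sub₁₂ (s₂ G) = s₂ (sub₁₂ G) := by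
  ext y x n
  have h1 := bin_shift (fun y x => G y x n) y 0 x 0 1
  simp only [add_zero] at h1
  exact h1

lemma sub₁₂_s₃ (G : ℤ → ℤ → ℤ → W) : sub₁₂ (s₃ G) = s₃ (sub₁₂ G) := rfl

/-- Multiplication by the sum of the three variables. -/
def d₁₂₃ : Module.End ℂ (ℤ → ℤ → ℤ → W) := s₁ + s₂ + s₃

lemma RTrunc.d₂₃ {G : ℤ → ℤ → ℤ → W} (h : RTrunc G) : RTrunc (d₂₃ G) := h.s₂.add h.s₃

lemma RTrunc.d₁₃ {G : ℤ → ℤ → ℤ → W} (h : RTrunc G) : RTrunc (d₁₃ G) := h.s₁.add h.s₃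

lemma sub₁₂_d₂₃_pow {G : ℤ → ℤ → ℤ → W} (h : RTrunc G) (k : ℕ) :
    sub₁₂ ((d₂₃ ^ k) G) = (d₂₃ ^ k) (sub₁₂ G) := by
  induction k generalizing G with
  | zero => rfl
  | succ k ih =>
    rw [pow_succ, Module.End.mul_apply, ih h.d₂₃, Module.End.mul_apply]
    congr 1
    rw [d₂₃, LinearMap.add_apply, sub₁₂_add h.s₂ h.s₃, sub₁₂_s₂, sub₁₂_s₃]
    rfl

lemma sub₁₂_d₁₃_pow {G : ℤ → ℤ → ℤ → W} (h : RTrunc G) (k : ℕ) :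
    sub₁₂ ((d₁₃ ^ k) G) = (d₁₂₃ ^ k) (sub₁₂ G) := by
  induction k generalizing G with
  | zero => rfl
  | succ k ih =>
    rw [pow_succ, Module.End.mul_apply, ih h.d₁₃, pow_succ, Module.End.mul_apply]
    congr 1
    rw [d₁₃, LinearMap.add_apply, sub₁₂_add h.s₁ h.s₃, sub₁₂_s₁ h, sub₁₂_s₃]
    rfl

lemma RTrunc.d₁₃_pow {G : ℤ → ℤ → ℤ → W} (h : RTrunc G) (k : ℕ) : RTrunc ((QVA.d₁₃ ^ k) G) := by
  induction k with
  | zero => exact h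
  | succ k ih => rw [pow_succ']; exact ih.d₁₃

/-- A bound on the powers of `x` for all powers of `z` beyond a given one. -/
lemma RTrunc.exists_bound {G : ℤ → ℤ → ℤ → W} (h : RTrunc G) (hT : TTrunc G) (n₀ : ℤ) :
    ∃ X, ∀ y x n, n₀ ≤ n → X ≤ x → G y x n = 0 := by
  obtain ⟨K, hK⟩ := hT
  obtain ⟨X, hX⟩ := exists_forall_Ico_bound (P := fun n x => ∀ y, G y x n = 0)
    (fun n => (h n).imp fun k hk x hx y => hk y x hx) n₀ K
  refine ⟨X, fun y x n hn hx => ?_⟩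
  by_cases hn' : K ≤ n
  · exact hK _ _ _ hn'
  · exact hX n hn (by omega) x hx y

lemma RTrunc.sub₂₃ {G : ℤ → ℤ → ℤ → W} (h : RTrunc G) (hT : TTrunc G) : RTrunc (sub₂₃ G) := by
  intro n
  obtain ⟨X, hX⟩ := h.exists_bound hT n
  obtain ⟨K, hK⟩ := hT
  obtain ⟨N, hN⟩ : ∃ N : ℕ, K ≤ n + N := ⟨(K - n).toNat, by omega⟩
  refine ⟨X + N, fun y x hx => ?_⟩
  dsimp only
  rw [sub₂₃_eq_sum hK hN]
  refine Finset.sum_eq_zero fun i hi => ?_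
  have := Finset.mem_range.mp hi
  rw [hX _ _ _ (by omega) (by omega), smul_zero]

lemma RTrunc.sub₁₃ {G : ℤ → ℤ → ℤ → W} (h : RTrunc G) (hT : TTrunc G) : RTrunc (sub₁₃ G) := by
  intro n
  obtain ⟨X, hX⟩ := h.exists_bound hT n
  refine ⟨X, fun y x hx => ?_⟩
  exact bin_eq_zero fun p' q' hq => hX _ _ _ hq hx

/-- The substitutions `y ↦ y + z`, `x ↦ x + z` followed by `y ↦ y + x` amount to `y ↦ y + x`
followed by `x ↦ x + z`. -/
theorem sub₂₃_sub₁₂ {G : ℤ → ℤ → ℤ → W} (h : RTrunc G) (hT : TTrunc G) :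
    sub₂₃ (sub₁₂ G) = sub₁₂ (sub₁₃ (sub₂₃ G)) := by
  have hT' := hT
  have hT'' := hT
  obtain ⟨K, hK⟩ := hT
  have hK' := sub₂₃_eq_zero hK
  have hK12 : ∀ l p n, K ≤ n → sub₁₂ G l p n = 0 := fun l p n hn =>
    bin_eq_zero fun p' q' _ => hK _ _ _ hn
  ext y x n
  obtain ⟨N, hN⟩ : ∃ N : ℕ, K ≤ n + N := ⟨(K - n).toNat, by omega⟩
  obtain ⟨X, hX⟩ := h.exists_bound hT' n
  have hX' : ∀ y x n', n ≤ n' → X + N ≤ x → sub₂₃ G y x n' = 0 := fun y x n' hn hx => by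
    rw [sub₂₃_eq_sum hK (N := N) (by omega)]
    refine Finset.sum_eq_zero fun i hi => ?_
    have := Finset.mem_range.mp hi
    rw [hX _ _ _ (by omega) (by omega), smul_zero]
  obtain ⟨I, hI⟩ : ∃ I : ℕ, X + N ≤ x + I := ⟨(X + N - x).toNat, by omega⟩
  -- the right side, sorted by the powers of `y`
  have hR : sub₁₂ (sub₁₃ (sub₂₃ G)) y x n
      = ∑ t ∈ Finset.range (N + I), bc y t • sub₂₃ ((s₂ ^ t) G) (y - t) x n := by
    set f : ℕ → ℕ → W := fun k i =>
      bc y i • bc (y - i) k • sub₂₃ G (y - i - k) (x + i) (n + k) with hf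
    have e1 : sub₁₂ (sub₁₃ (sub₂₃ G)) y x n
        = ∑ i ∈ Finset.range I, ∑ k ∈ Finset.range N, f k i := by
      rw [sub₁₂, bin_eq_sum I fun i hi => ?_]
      · refine Finset.sum_congr rfl fun i _ => ?_
        rw [sub₁₃_eq_sum hK' hN, Finset.smul_sum, zero_add]
      · exact bin_eq_zero fun p' q' hq => hX' _ _ _ hq (by omega)
    have e2 : ∑ i ∈ Finset.range I, ∑ k ∈ Finset.range N, f k i
        = ∑ k ∈ Finset.range (N + I), ∑ i ∈ Finset.range (N + I - k), f k i := by
      rw [Finset.sum_comm, Finset.sum_range_add]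
      rw [Finset.sum_eq_zero (s := Finset.range I) (f := fun k =>
          ∑ i ∈ Finset.range _, f (N + k) i),
        add_zero]
      · refine Finset.sum_congr rfl fun k hk => ?_
        have := Finset.mem_range.mp hk
        refine Finset.sum_subset (Finset.range_subset_range.mpr (by omega)) fun i _ hi => ?_
        have := Finset.mem_range.not.mp hi
        simp only [hf]
        rw [hX' _ _ _ (by omega) (by omega), smul_zero, smul_zero]
      · intro k _
        refine Finset.sum_eq_zero fun i _ => ?_
        simp only [hf]
        rw [hK' _ _ _ (by push_cast; omega), smul_zero, smul_zero]
    rw [e1, e2, ← Finset.sum_range_diag_flip]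
    refine Finset.sum_congr rfl fun t _ => ?_
    have e3 : sub₂₃ ((s₂ ^ t) G) (y - t) x n = (dg ^ t) (sub₂₃ G (y - t)) x n := by
      rw [← slice₂₃]
      suffices h3 : ∀ (t : ℕ) (F : ℤ → ℤ → ℤ → W), TTrunc F →
          sub₂₃ ((s₂ ^ t) F) = (d₂₃ ^ t) (sub₂₃ F) by rw [h3 t G hT'']
      intro t
      induction t with
      | zero => intro F _; rfl
      | succ t ih =>
        intro F hF
        rw [pow_succ, Module.End.mul_apply, ih _ hF.s₂, sub₂₃_s₂ hF, pow_succ,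
          Module.End.mul_apply]
    rw [e3, dg_pow_apply, Finset.smul_sum]
    refine Finset.sum_congr rfl fun k hk => ?_
    have hkt : k ≤ t := Nat.lt_succ_iff.mp (Finset.mem_range.mp hk)
    simp only [hf]
    rw [smul_smul, bc_mul_bc, Nat.sub_add_cancel hkt, ← Nat.cast_smul_eq_nsmul ℂ, smul_smul]
    congr 2
    all_goals push_cast [hkt]
    all_goals omega
  rw [hR, sub₂₃_eq_sum hK12 hN]
  have hL : ∀ j ∈ Finset.range N, bc x j • sub₁₂ G y (x - j) (n + j)
      = ∑ t ∈ Finset.range (N + I), bc x j • bc y t • G (y - t) (x - j + t) (n + j) := by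
    intro j hj
    have := Finset.mem_range.mp hj
    rw [sub₁₂, bin_eq_sum (G := fun y x => G y x (n + j)) (N + I)
      fun i hi => hX _ _ _ (by omega) (by omega),
      Finset.smul_sum]
    simp only [zero_add]
  rw [Finset.sum_congr rfl hL, Finset.sum_comm]
  refine Finset.sum_congr rfl fun t _ => ?_
  have hs : ∀ (t : ℕ) (F : ℤ → ℤ → ℤ → W) a b c, (s₂ ^ t) F a b c = F a (b + t) c := by
    intro t
    induction t with
    | zero => intro F a b c; simp
    | succ t ih =>
      intro F a b c
      rw [pow_succ, Module.End.mul_apply, ih, s₂_apply]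
      push_cast
      rw [add_assoc]
  rw [sub₂₃_eq_sum (K := K) (fun l p n hn => by rw [hs]; exact hK _ _ _ hn) hN, Finset.smul_sum]
  refine Finset.sum_congr rfl fun j _ => ?_
  rw [hs, smul_comm]

/-- The substitution `x ↦ x + z` is injective. -/
lemma eq_zero_of_sub₂₃ {G : ℤ → ℤ → ℤ → W} (hT : TTrunc G) {y : ℤ}
    (h : ∀ x n, sub₂₃ G y x n = 0) : G y = 0 := by
  obtain ⟨K, hK⟩ := hT
  have key : ∀ (j : ℕ) (n : ℤ), K - j ≤ n → ∀ x, G y x n = 0 := by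
    intro j
    induction j with
    | zero => intro n hn x; exact hK _ _ _ (by simpa using hn)
    | succ j ih =>
      intro n hn x
      obtain ⟨N, hN⟩ : ∃ N : ℕ, K ≤ n + (N + 1 : ℕ) := ⟨(K - n).toNat, by push_cast; omega⟩
      have := h x n
      rw [sub₂₃_eq_sum hK hN, Finset.sum_range_succ'] at this
      rw [Finset.sum_eq_zero, zero_add] at this
      · simpa using this
      · intro i _
        rw [ih _ (by push_cast at *; omega), smul_zero]
  ext x n
  exact key (K - n).toNat n (by omega) x

/-- If `y + T` maps a series which is truncated in `y` to one whose coefficients are killed by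
powers of `T`, then the coefficients of the series are killed by powers of `T`. -/
lemma exists_pow_eq_zero {M : Type*} [AddCommGroup M] [Module ℂ M] (T : Module.End ℂ M) (m : ℕ)
    {D : Module.End ℂ (ℤ → M)} (hD : ∀ F y, D F y = F (y + 1) + T (F y)) {F : ℤ → M}
    (hF : FTrunc F) (h : (D ^ m) F = 0) (y : ℤ) : ∃ N, (T ^ N) (F y) = 0 := by
  suffices ∀ F : ℤ → M, FTrunc F → (∀ y, ∃ N, (T ^ N) ((D ^ m) F y) = 0) →
      ∀ y, ∃ N, (T ^ N) (F y) = 0 from this F hF (fun y => ⟨0, by rw [h]; simp⟩) y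
  clear h hF F y
  induction m with
  | zero => intro F _ h; exact h
  | succ m ih =>
    intro F hF h
    obtain ⟨k, hk⟩ := hF
    have hDF : FTrunc (D F) := ⟨k, fun q hq => by
      rw [hD, hk q hq, hk _ (by omega), map_zero, add_zero]⟩
    have h1 := ih (D F) hDF (by simpa only [pow_succ, Module.End.mul_apply] using h)
    have key : ∀ (j : ℕ) y, k - j ≤ y → ∃ N, (T ^ N) (F y) = 0 := by
      intro j
      induction j with
      | zero => intro y hy; exact ⟨0, by rw [hk y (by simpa using hy), map_zero]⟩
      | succ j ihj =>
        intro y hy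
        obtain ⟨N, hN⟩ := h1 y
        obtain ⟨N', hN'⟩ := ihj (y + 1) (by push_cast at hy; omega)
        refine ⟨max N N' + 1, ?_⟩
        have e : T (F y) = D F y - F (y + 1) := by rw [hD]; abel
        have z : ∀ {a b : ℕ} {x : M}, a ≤ b → (T ^ a) x = 0 → (T ^ b) x = 0 := by
          intro a b x hab hx
          obtain ⟨c, rfl⟩ := Nat.exists_eq_add_of_le' hab
          rw [pow_add, Module.End.mul_apply, hx, map_zero]
        rw [pow_succ, Module.End.mul_apply, e, map_sub, z (le_max_left _ _) hN,
          z (le_max_right _ _) hN', sub_zero]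
    exact fun y => key (k - y).toNat y (by omega)

end Substitution

/-! ### Weak associativity -/

section WeakAssoc

variable {H : Type u} [AddCommGroup H] [Module ℂ H]
  {B : LinearMap.BilinForm ℂ H} {S : H ⊗[ℂ] H →ₗ[ℂ] (H ⊗[ℂ] H) ⊗[ℂ] LaurentSeries ℂ}
  {V : Type v} [AddCommGroup V] [Module ℂ V] [Module (ModeAlgebra H) V]
  [IsScalarTower ℂ (ModeAlgebra H) V] {one : V}
  {W : Type w} [AddCommGroup W] [Module ℂ W] {A : H →ₗ[ℂ] ℤ → Module.End ℂ W}

/-- The modes `Y v n` of fields on `W` which are determined by the operators `A a m`: the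
vector `one` acts by the identity, and `Y (a(y) v, z)` is the re-expansion of `a(y + z) Y(v, z)`. -/
structure IsFieldAction (one : V) (A : H →ₗ[ℂ] ℤ → Module.End ℂ W)
    (Y : V →ₗ[ℂ] ℤ → Module.End ℂ W) : Prop where
  fTrunc : ∀ v w, FTrunc fun n => Y v n w
  one_apply : ∀ n w, Y one n w = constSeries w n
  reexp : ∀ a v w, IsReexp (fun q => shiftMode (A a) q fun n => Y v n w)
    fun q n => Y (act a q v) n w

/-- The modes of a family of vertex operators. -/
def modes (YW : V →ₗ[ℂ] VertexOperator ℂ W) : V →ₗ[ℂ] ℤ → Module.End ℂ W :=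
  VertexOperator.ncoeff ∘ₗ YW

lemma vmode_eq_modes (YW : V →ₗ[ℂ] VertexOperator ℂ W) (v : V) (n : ℤ) (w : W) :
    vmode YW v n w = modes YW v n w := rfl

lemma IsUniversalVacuumModule.isFieldAction (hV : IsUniversalVacuumModule B S V one)
    (hA : IsHSModes B S A) : IsFieldAction one A (modes (hV.vertexOp hA)) where
  fTrunc v w := by
    simp only [← vmode_eq_modes, vmode_vertexOp]
    exact (hV.fieldHom hA w v).2.1
  one_apply n w := by
    rw [← vmode_eq_modes, vmode_vertexOp, fieldHom_one]
  reexp a v w := by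
    simp only [← vmode_eq_modes, vmode_vertexOp, fieldHom_act, hA.coe_reexpModes]
    exact isReexp_reexp a _

/-- The field of `a(-1) one` is `a(x)`. -/
lemma IsFieldAction.act_neg_one (hA : IsHSModes B S A) {Y : V →ₗ[ℂ] ℤ → Module.End ℂ W}
    (hY : IsFieldAction one A Y) (a : H) (n : ℤ) (w : W) : Y (act a (-1) one) n w = A a n w := by
  have h := hY.reexp a one w
  simp only [hY.one_apply] at h
  exact h.constSeries_neg_one (hA.fTrunc a w) n

lemma dg_pow_map {M M' : Type*} [AddCommGroup M] [Module ℂ M] [AddCommGroup M'] [Module ℂ M']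
    (φ : M →ₗ[ℂ] M') (m : ℕ) (F : ℤ → ℤ → M) (q n : ℤ) :
    (dg ^ m) (fun q n => φ (F q n)) q n = φ ((dg ^ m) F q n) := by
  rw [dg_pow_apply, dg_pow_apply, map_sum]
  simp only [map_nsmul]

lemma mem_of_dg_pow_mem {M : Type*} [AddCommGroup M] [Module ℂ M] (Q : Submodule ℂ M) {m : ℕ}
    {F : ℤ → ℤ → M} (hF : FTrunc F) (h : ∀ q n, (dg ^ m) F q n ∈ Q) (q n : ℤ) : F q n ∈ Q := by
  rw [← Submodule.Quotient.mk_eq_zero, ← Submodule.mkQ_apply]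
  have hF' : FTrunc fun q n => Q.mkQ (F q n) := by
    obtain ⟨k, hk⟩ := hF
    exact ⟨k, fun q hq => by ext n; dsimp only; rw [hk q hq]; simp⟩
  refine congrFun (eq_zero_of_dg_pow m hF' (k := q) (fun q _ => ?_) q le_rfl) n
  ext n
  rw [dg_pow_map, Submodule.mkQ_apply, (Submodule.Quotient.mk_eq_zero Q).mpr (h q n)]
  rfl

lemma bin_mem {M : Type*} [AddCommGroup M] [Module ℂ M] (Q : Submodule ℂ M) {G : ℤ → ℤ → M}
    (hT : STrunc G) (hG : ∀ p q, G p q ∈ Q) (s p q : ℤ) : bin s G p q ∈ Q := by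
  obtain ⟨N, hN⟩ := hT.exists_nat q
  rw [hN]
  exact Q.sum_mem fun i _ => Q.smul_mem _ (hG _ _)

/-- The vectors `v` for which `(y + z)^m a(y + z) Y(v, z) w` is truncated in `y`. -/
def goodSubmodule {Y : V →ₗ[ℂ] ℤ → Module.End ℂ W} (hY : IsFieldAction one A Y) (a : H) (m : ℕ)
    (w : W) : Submodule ℂ V where
  carrier := {z | Good m fun q => shiftMode (A a) q fun n => Y z n w}
  zero_mem' := by
    refine ⟨0, fun q _ => ?_⟩
    have : (fun q => shiftMode (A a) q fun n => Y 0 n w) = 0 := by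
      ext q n
      simp only [map_zero, Pi.zero_apply, LinearMap.zero_apply]
      exact congrFun (shiftMode_zero _ _) n
    rw [this, map_zero]; rfl
  add_mem' := by
    intro z z' hz hz'
    have := Good.add hz hz'
    have e : (fun q => shiftMode (A a) q fun n => Y (z + z') n w)
        = (fun q => shiftMode (A a) q fun n => Y z n w)
          + fun q => shiftMode (A a) q fun n => Y z' n w := by
      ext1 q
      rw [Pi.add_apply, ← shiftMode_add _ _ (hY.fTrunc _ _) (hY.fTrunc _ _)]
      simp only [map_add]
      rfl
    change Good m _
    rw [e]; exact this
  smul_mem' := by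
    intro c z hz
    have := Good.smul hz c
    have e : (fun q => shiftMode (A a) q fun n => Y (c • z) n w)
        = c • fun q => shiftMode (A a) q fun n => Y z n w := by
      ext1 q
      rw [Pi.smul_apply, ← shiftMode_smul _ _ _ (hY.fTrunc _ _)]
      simp only [map_smul]
      rfl
    change Good m _
    rw [e]; exact this

variable {YV : V →ₗ[ℂ] ℤ → Module.End ℂ V} {Y : V →ₗ[ℂ] ℤ → Module.End ℂ W}

/-- For fixed `u`, `v` and `w`, a single exponent re-expands `a(y + z) Y(u_x v, z) w` for all
modes `u_x`. -/
theorem IsFieldAction.exists_good_family (hV : IsVacuumModule B S V one) (hA : IsHSModes B S A)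
    (hYV : IsFieldAction one (actLin H V) YV) (hY : IsFieldAction one A Y) (u v : V) (w : W) :
    ∀ a, ∃ m, ∀ x, YV u x v ∈ goodSubmodule hY a m w := by
  have mono : ∀ {a m m'} (_ : m ≤ m') {z}, z ∈ goodSubmodule hY a m w →
      z ∈ goodSubmodule hY a m' w := fun h _ hz => Good.mono h hz
  induction u using hV.induction with
  | h0 => exact fun a => ⟨0, fun x => by simp⟩
  | hadd u u' hu hu' =>
    intro a
    obtain ⟨m, hm⟩ := hu a
    obtain ⟨m', hm'⟩ := hu' a
    refine ⟨max m m', fun x => ?_⟩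
    rw [map_add]
    exact Submodule.add_mem _ (mono (le_max_left _ _) (hm x)) (mono (le_max_right _ _) (hm' x))
  | hsmul c u hu =>
    intro a
    obtain ⟨m, hm⟩ := hu a
    refine ⟨m, fun x => ?_⟩
    rw [map_smul]
    exact Submodule.smul_mem _ c (hm x)
  | hone =>
    intro a
    obtain ⟨m, hm⟩ := (hY.reexp a v w).good
    refine ⟨m, fun x => ?_⟩
    rw [hYV.one_apply, constSeries]
    split_ifs
    · exact hm
    · exact Submodule.zero_mem _
  | hact c p u hu =>
    intro a
    obtain ⟨r, c', a', f, hS⟩ := exists_tensor_rep (S (c ⊗ₜ[ℂ] a))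
    choose m hm using fun j => hu (a' j)
    obtain ⟨M, hM⟩ := (Finset.univ.image m).exists_le
    refine ⟨M, fun x => ?_⟩
    have h1 : ∀ q x, act c q (YV u x v) ∈ goodSubmodule hY a M w := fun q x =>
      hA.good_of_isReexp hS (hY.fTrunc _ _) (fun j => mono (hM _ (by simp)) (hm j x))
        (hY.reexp c (YV u x v) w) q
    obtain ⟨⟨y₀, hy₀⟩, m', hm'⟩ := hYV.reexp c u v
    refine mem_of_dg_pow_mem _ (F := fun q n => YV (act c q u) n v) ⟨y₀, hy₀⟩ (m := m')
      (fun q n => ?_) p x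
    have hT := hYV.fTrunc u v
    rw [hm', dg_pow_shiftMode _ hT]
    exact bin_mem _ (hT.sTrunc_mode _) (fun p' q' => h1 _ _) _ _ _

/-- Multiplication by the sum of the first two variables minus the third. -/
def c₁₂₃ : Module.End ℂ (ℤ → ℤ → ℤ → W) := s₁ + s₂ - s₃

lemma commute_d₁₂_c₁₂₃ : Commute (d₁₂ (W := W)) c₁₂₃ := by
  refine LinearMap.ext fun G => ?_
  ext y x n
  simp only [d₁₂, c₁₂₃, Module.End.mul_apply, LinearMap.add_apply, LinearMap.sub_apply,
    Pi.add_apply, Pi.sub_apply, s₁_apply, s₂_apply, s₃_apply]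
  abel

lemma commute_d₁₂_s₂ : Commute (d₁₂ (W := W)) s₂ := rfl

lemma commute_d₂₃_d₁₂₃ : Commute (d₂₃ (W := W)) d₁₂₃ := by
  refine LinearMap.ext fun G => ?_
  ext y x n
  simp only [d₂₃, d₁₂₃, Module.End.mul_apply, LinearMap.add_apply,
    Pi.add_apply, s₁_apply, s₂_apply, s₃_apply]
  abel

lemma commute_d₁₂_d₂₃ : Commute (d₁₂ (W := W)) d₂₃ := by
  refine LinearMap.ext fun G => ?_
  ext y x n
  simp only [d₁₂, d₂₃, Module.End.mul_apply, LinearMap.add_apply,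
    Pi.add_apply, s₁_apply, s₂_apply, s₃_apply]
  abel

lemma commute_d₁₂_d₁₂₃ : Commute (d₁₂ (W := W)) d₁₂₃ := by
  refine LinearMap.ext fun G => ?_
  ext y x n
  simp only [d₁₂, d₁₂₃, Module.End.mul_apply, LinearMap.add_apply,
    Pi.add_apply, s₁_apply, s₂_apply, s₃_apply]
  abel

lemma TTrunc.d₁₂ {G : ℤ → ℤ → ℤ → W} (h : TTrunc G) : TTrunc (d₁₂ G) := h.s₁.add h.s₂
lemma TTrunc.c₁₂₃ {G : ℤ → ℤ → ℤ → W} (h : TTrunc G) : TTrunc (c₁₂₃ G) := (h.s₁.add h.s₂).sub h.s₃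

lemma TTrunc.pow {D : Module.End ℂ (ℤ → ℤ → ℤ → W)} (hD : ∀ G, TTrunc G → TTrunc (D G)) (k : ℕ)
    {G : ℤ → ℤ → ℤ → W} (h : TTrunc G) : TTrunc ((D ^ k) G) := by
  induction k with
  | zero => exact h
  | succ k ih => rw [pow_succ']; exact hD _ ih

lemma sub₂₃_pow {D D' : Module.End ℂ (ℤ → ℤ → ℤ → W)} (hD : ∀ G, TTrunc G → TTrunc (D G))
    (hDD' : ∀ G, TTrunc G → sub₂₃ (D G) = D' (sub₂₃ G)) (k : ℕ) {G : ℤ → ℤ → ℤ → W}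
    (h : TTrunc G) : sub₂₃ ((D ^ k) G) = (D' ^ k) (sub₂₃ G) := by
  induction k generalizing G with
  | zero => rfl
  | succ k ih =>
    rw [pow_succ, Module.End.mul_apply, ih (hD _ h), hDD' _ h, pow_succ, Module.End.mul_apply]

lemma sub₂₃_d₁₂ {G : ℤ → ℤ → ℤ → W} (h : TTrunc G) : sub₂₃ (d₁₂ G) = d₁₂₃ (sub₂₃ G) := by
  rw [d₁₂, LinearMap.add_apply, sub₂₃_add h.s₁ h.s₂, sub₂₃_s₁, sub₂₃_s₂ h, d₁₂₃, d₂₃]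
  simp only [LinearMap.add_apply, add_assoc]

lemma sub₂₃_c₁₂₃ {G : ℤ → ℤ → ℤ → W} (h : TTrunc G) : sub₂₃ (c₁₂₃ G) = d₁₂ (sub₂₃ G) := by
  rw [c₁₂₃, LinearMap.sub_apply, LinearMap.add_apply, sub₂₃_sub (h.s₁.add h.s₂) h.s₃,
    sub₂₃_add h.s₁ h.s₂, sub₂₃_s₁, sub₂₃_s₂ h, sub₂₃_s₃, d₁₂, d₂₃]
  simp only [LinearMap.add_apply]
  abel

lemma fTrunc_pow {D : Module.End ℂ (ℤ → ℤ → ℤ → W)}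
    (hD : ∀ G k, (∀ y, k ≤ y → G y = 0) → ∀ y, k ≤ y → D G y = 0) (j : ℕ)
    {G : ℤ → ℤ → ℤ → W} {k : ℤ} (h : ∀ y, k ≤ y → G y = 0) : ∀ y, k ≤ y → (D ^ j) G y = 0 := by
  induction j with
  | zero => exact h
  | succ j ih => rw [pow_succ']; exact hD _ _ ih

/-- If `Y(Y(u, x) v, z) w` is the re-expansion of `Y(u, x + z) Y(v, z) w`, then the same holds
for `a_p u` in place of `u`.

Both `a(y + x + z) u(x + z) v(z) w` and `Y(Y(Y(a, y) u, x) v, z) w` are equal to the re-expansion of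
`a(y + x + z) Y(Y(u, x) v, z) w`, up to powers of `x + z`, `y + x + z` and `y + x`. On series which
are truncated in `y`, multiplication by `y + x` is injective, and multiplication by `y + x + z` can
be cancelled at the cost of a further power of `x + z`, so that only a power of `x + z` remains. -/
theorem IsFieldAction.weakAssoc_act (hV : IsVacuumModule B S V one) (hA : IsHSModes B S A)
    (hYV : IsFieldAction one (actLin H V) YV) (hY : IsFieldAction one A Y) (a : H) (u v : V) (w : W)
    (ih : IsReexp (fun q => shiftMode (Y u) q fun n => Y v n w) fun q n => Y (YV u q v) n w)
    (p : ℤ) : IsReexp (fun q => shiftMode (Y (act a p u)) q fun n => Y v n w)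
      fun q n => Y (YV (act a p u) q v) n w := by
  set g : ℤ → W := fun n => Y v n w with hg_def
  have hg : FTrunc g := hY.fTrunc v w
  obtain ⟨-, k, hk⟩ := ih
  obtain ⟨m, hm⟩ := hYV.exists_good_family hV hA hY u v w a
  obtain ⟨⟨y₀, hy₀⟩, m', hm'⟩ := hYV.reexp a u v
  -- `a(y) u(x) v(z) w`
  set F : ℤ → ℤ → ℤ → W := fun y x n => A a y (Y u x (g n)) with hF
  have hFT : TTrunc F := tTrunc_modes (A a) (Y u) hg
  have hFR : RTrunc F := fun n => (hY.fTrunc u (g n)).sTrunc_mode (A a)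
  set L' := sub₁₂ F with hL'
  have hL'T : TTrunc L' := by
    obtain ⟨K, hK⟩ := hFT
    exact ⟨K, fun l p n hn => bin_eq_zero fun p' q' _ => hK _ _ _ hn⟩
  set L : ℤ → ℤ → ℤ → W := fun y x n => Y (act a y u) x (g n) with hL
  have hLT : TTrunc L := by
    obtain ⟨K, hK⟩ := hg
    exact ⟨K, fun l p n hn => by simp only [hL, hK n hn, map_zero]⟩
  set ρ : ℤ → ℤ → ℤ → W := fun y x n => Y (YV (act a y u) x v) n w with hρ
  have hact : ∀ y, y₀ ≤ y → ∀ x, YV (act a y u) x v = 0 := fun y hy x => congrFun (hy₀ y hy) x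
  have hρ0 : ∀ y, y₀ ≤ y → ρ y = 0 := fun y hy => by
    ext x n
    simp only [hρ, hact y hy x, map_zero]
    rfl
  set F₁ : ℤ → ℤ → ℤ → W := fun y x n => shiftMode (A a) y (shiftMode (Y u) x g) n with hF₁
  set F₂ : ℤ → ℤ → ℤ → W := fun y x n => shiftMode (A a) y (fun n => Y (YV u x v) n w) n with hF₂
  set F₃ : ℤ → ℤ → ℤ → W := fun y x n => Y (act a y (YV u x v)) n w with hF₃
  have hF₁' : F₁ = sub₁₃ (sub₂₃ F) := shiftMode_shiftMode_eq_dsub (A a) (Y u) hg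
  have hF₁R : RTrunc F₁ := by
    rw [hF₁']; exact (hFR.sub₂₃ hFT).sub₁₃ hFT.sub₂₃
  have hF₃R : RTrunc F₃ := fun n => by
    obtain ⟨K, hK⟩ := hYV.fTrunc u v
    refine ⟨K, fun y x hx => ?_⟩
    have : YV u x v = 0 := hK x hx
    simp only [hF₃, this, act, smul_zero, map_zero]
    rfl
  -- `F₁`, `F₂` and `F₃` stand for `a(y + z) u(x + z) v(z) w`, `a(y + z) Y(u(x) v, z) w` and
  -- `Y(a(y) u(x) v, z) w`; they agree up to powers of `x + z` and `y + z`
  have i1 : (d₂₃ ^ k) F₁ = (d₂₃ ^ k) F₂ := by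
    rw [hF₁, hF₂, d₂₃_pow_shiftMode _ _ fun x => hg.shiftMode _ x,
      d₂₃_pow_shiftMode _ _ fun x => hY.fTrunc _ _, ← hk]
  have i2 : (d₁₃ ^ m) F₃ = (d₁₃ ^ m) F₂ := by
    ext y x n
    rw [slice₁₃, slice₁₃]
    exact congrFun (congrFun ((hY.reexp a (YV u x v) w).dg_pow_eq (hm x)) y) n
  have comm : ∀ X : ℤ → ℤ → ℤ → W, (d₂₃ ^ k) ((d₁₃ ^ m) X) = (d₁₃ ^ m) ((d₂₃ ^ k) X) := fun X =>
    LinearMap.congr_fun (((commute_d₁₃_d₂₃ (W := W)).symm).pow_pow k m) X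
  have i3 : (d₂₃ ^ k) ((d₁₃ ^ m) F₁) = (d₂₃ ^ k) ((d₁₃ ^ m) F₃) := by
    rw [comm F₁, i1, ← comm, ← i2]
  -- after the substitution `y ↦ y + x` the series `F₃` becomes `Y(a(y + x) u(x) v, z) w`, which is
  -- `ρ` up to a power of `y + x`
  set F₄ := sub₁₂ F₃ with hF₄
  have i4 : (d₂₃ ^ k) ((d₁₂₃ ^ m) (sub₂₃ L')) = (d₂₃ ^ k) ((d₁₂₃ ^ m) F₄) := by
    rw [hL', sub₂₃_sub₁₂ hFR hFT, ← hF₁', hF₄, ← sub₁₂_d₁₃_pow hF₁R, ← sub₁₂_d₁₃_pow hF₃R,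
      ← sub₁₂_d₂₃_pow (hF₁R.d₁₃_pow m), ← sub₁₂_d₂₃_pow (hF₃R.d₁₃_pow m), i3]
  have i5 : (d₁₂ ^ m') F₄ = (d₁₂ ^ m') ρ := by
    have e : F₄ = fun y x n => Y (shiftMode (actLin H V a) y (fun n => YV u n v) x) n w := by
      ext y x n
      let φ : V →ₗ[ℂ] W := (LinearMap.applyₗ w).comp ((LinearMap.proj n).comp Y)
      exact (map_bin φ ((hYV.fTrunc u v).sTrunc_mode (actLin H V a)) y 0 x).symm
    ext y x n
    let φ : V →ₗ[ℂ] W := (LinearMap.applyₗ w).comp ((LinearMap.proj n).comp Y)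
    rw [slice₁₂, slice₁₂, e]
    have e1 := dg_pow_map φ m' (fun y x => shiftMode (actLin H V a) y (fun n => YV u n v) x) y x
    have e2 := dg_pow_map φ m' (fun y x => YV (act a y u) x v) y x
    exact e1.trans ((congrArg φ (congrFun (congrFun hm' y) x).symm).trans e2.symm)
  -- the operators commute
  have c1 : ∀ X : ℤ → ℤ → ℤ → W, (d₂₃ ^ k) ((d₁₂₃ ^ m) X) = (d₁₂₃ ^ m) ((d₂₃ ^ k) X) := fun X =>
    LinearMap.congr_fun ((commute_d₂₃_d₁₂₃ (W := W)).pow_pow k m) X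
  have c2 : ∀ X : ℤ → ℤ → ℤ → W, (d₁₂ ^ m') ((d₂₃ ^ k) ((d₁₂₃ ^ m) X))
      = (d₂₃ ^ k) ((d₁₂₃ ^ m) ((d₁₂ ^ m') X)) := fun X => by
    have h1 := LinearMap.congr_fun ((commute_d₁₂_d₂₃ (W := W)).pow_pow m' k) ((d₁₂₃ ^ m) X)
    have h2 := LinearMap.congr_fun ((commute_d₁₂_d₁₂₃ (W := W)).pow_pow m' m) X
    simp only [Module.End.mul_apply] at h1 h2
    rw [h1, h2]
  have i6 : (d₁₂ ^ m') ((d₂₃ ^ k) ((d₁₂₃ ^ m) (sub₂₃ L')))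
      = (d₁₂ ^ m') ((d₂₃ ^ k) ((d₁₂₃ ^ m) ρ)) := by
    rw [i4, c2, i5, ← c2]
  -- the same operators before the substitution `x ↦ x + z`
  have i7 : ∀ X : ℤ → ℤ → ℤ → W, TTrunc X → (d₁₂ ^ m') ((d₂₃ ^ k) ((d₁₂₃ ^ m) (sub₂₃ X)))
      = sub₂₃ ((c₁₂₃ ^ m') ((s₂ ^ k) ((d₁₂ ^ m) X))) ∧
        TTrunc ((c₁₂₃ ^ m') ((s₂ ^ k) ((d₁₂ ^ m) X))) := fun X hX => by
    have t1 : TTrunc ((d₁₂ ^ m) X) := hX.pow (fun _ h => h.d₁₂) m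
    have t2 : TTrunc ((s₂ ^ k) ((d₁₂ ^ m) X)) := t1.pow (fun _ h => h.s₂) k
    rw [sub₂₃_pow (fun _ h => h.c₁₂₃) (fun _ h => sub₂₃_c₁₂₃ h) m' t2,
      sub₂₃_pow (fun _ h => h.s₂) (fun _ h => sub₂₃_s₂ h) k t1,
      sub₂₃_pow (fun _ h => h.d₁₂) (fun _ h => sub₂₃_d₁₂ h) m hX]
    exact ⟨rfl, t2.pow (fun _ h => h.c₁₂₃) m'⟩
  have zc : ∀ (G : ℤ → ℤ → ℤ → W) k, (∀ y, k ≤ y → G y = 0) → ∀ y, k ≤ y → c₁₂₃ G y = 0 :=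
    fun G k h y hy => by
      ext x n
      simp [c₁₂₃, s₁_apply, s₂_apply, s₃_apply, h y hy, h (y + 1) (by omega)]
  have zs : ∀ (G : ℤ → ℤ → ℤ → W) k, (∀ y, k ≤ y → G y = 0) → ∀ y, k ≤ y → s₂ G y = 0 :=
    fun G k h y hy => by
      ext x n
      simp [s₂_apply, h y hy]
  have z12 : ∀ (G : ℤ → ℤ → ℤ → W) k, (∀ y, k ≤ y → G y = 0) → ∀ y, k ≤ y → d₁₂ G y = 0 :=
    fun G k h y hy => by
      ext x n
      simp [d₁₂, s₁_apply, s₂_apply, h y hy, h (y + 1) (by omega)]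
  have z23 : ∀ (G : ℤ → ℤ → ℤ → W) k, (∀ y, k ≤ y → G y = 0) → ∀ y, k ≤ y → d₂₃ G y = 0 :=
    fun G k h y hy => by
      ext x n
      simp [d₂₃, s₂_apply, s₃_apply, h y hy]
  have z123 : ∀ (G : ℤ → ℤ → ℤ → W) k, (∀ y, k ≤ y → G y = 0) → ∀ y, k ≤ y → d₁₂₃ G y = 0 :=
    fun G k h y hy => by
      ext x n
      simp [d₁₂₃, s₁_apply, s₂_apply, s₃_apply, h y hy, h (y + 1) (by omega)]
  -- `a(y + x) u(x) v(z) w` and its re-expansion agree after multiplication by these factors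
  obtain ⟨y₁, hy₁⟩ := hV.isHSModule.truncation a u
  have hL0 : ∀ y, y₁ ≤ y → L y = 0 := fun y hy => by
    ext x n
    simp only [hL, hy₁ y hy, map_zero]
    rfl
  set Θ := (c₁₂₃ ^ m') ((s₂ ^ k) ((d₁₂ ^ m) (L' - L))) with hΘ
  have hΘ1 : ∀ y, max y₀ y₁ ≤ y → Θ y = 0 := by
    intro y hy
    have h1 : (c₁₂₃ ^ m') ((s₂ ^ k) ((d₁₂ ^ m) L')) y = 0 := by
      refine eq_zero_of_sub₂₃ (i7 L' hL'T).2 fun x n => ?_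
      rw [← (i7 L' hL'T).1, i6]
      have := fTrunc_pow z12 m' (fTrunc_pow z23 k (fTrunc_pow z123 m hρ0)) y (by omega)
      rw [this]; rfl
    have h2 := fTrunc_pow zc m' (fTrunc_pow zs k (fTrunc_pow z12 m hL0)) y (by omega)
    simp only [hΘ, map_sub, Pi.sub_apply, h1, h2, sub_zero]
  -- for each power of `z`, some power of `y + x` kills `L' - L`; as `Θ` is truncated in `y`, it
  -- vanishes
  have hΘ0 : Θ = 0 := by
    have hex : ∀ n, ∃ M : ℕ, ∀ y x, (d₁₂ ^ M) (L' - L) y x n = 0 := by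
      intro n
      obtain ⟨-, M, hM⟩ := hY.reexp a u (g n)
      refine ⟨M, fun y x => ?_⟩
      rw [map_sub]
      simp only [Pi.sub_apply]
      rw [slice₁₂, slice₁₂]
      exact sub_eq_zero.mpr (congrFun (congrFun hM.symm y) x)
    have hLL : TTrunc (L' - L) := hL'T.sub hLT
    ext y x n
    obtain ⟨M, hM⟩ : ∃ M : ℕ, ∀ n', n ≤ n' → ∀ y x, (d₁₂ ^ M) (L' - L) y x n' = 0 := by
      choose f hf using hex
      obtain ⟨K, hK⟩ := hLL
      obtain ⟨M, hM⟩ := ((Finset.Ico n K).image f).exists_le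
      refine ⟨M, fun n' hn' => ?_⟩
      by_cases h : K ≤ n'
      · intro y x
        have : (fun y x => (L' - L) y x n') = 0 := by ext y x; exact hK _ _ _ h
        rw [slice₁₂, this, map_zero]; rfl
      · have hfM : f n' ≤ M := hM _ (Finset.mem_image_of_mem f (by simp; omega))
        obtain ⟨j, rfl⟩ := Nat.exists_eq_add_of_le' hfM
        intro y x
        have : (fun y x => (d₁₂ ^ f n') (L' - L) y x n') = 0 := by ext y x; exact hf _ _ _
        rw [pow_add, Module.End.mul_apply, slice₁₂, this, map_zero]; rfl
    have zn : ∀ (D : Module.End ℂ (ℤ → ℤ → ℤ → W)),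
        (∀ G : ℤ → ℤ → ℤ → W, (∀ n', n ≤ n' → ∀ y x, G y x n' = 0) →
          ∀ n', n ≤ n' → ∀ y x, D G y x n' = 0) → ∀ (j : ℕ) (G : ℤ → ℤ → ℤ → W),
        (∀ n', n ≤ n' → ∀ y x, G y x n' = 0) → ∀ n', n ≤ n' → ∀ y x, (D ^ j) G y x n' = 0 := by
      intro D hD j
      induction j with
      | zero => exact fun G h => h
      | succ j ih => intro G h; rw [pow_succ']; exact hD _ (ih G h)
    have hcomm : (d₁₂ ^ M) Θ = (c₁₂₃ ^ m') ((s₂ ^ k) ((d₁₂ ^ m) ((d₁₂ ^ M) (L' - L)))) := by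
      have h1 := LinearMap.congr_fun ((commute_d₁₂_c₁₂₃ (W := W)).pow_pow M m')
        ((s₂ ^ k) ((d₁₂ ^ m) (L' - L)))
      have h2 := LinearMap.congr_fun ((commute_d₁₂_s₂ (W := W)).pow_pow M k)
        ((d₁₂ ^ m) (L' - L))
      have h3 := LinearMap.congr_fun ((Commute.refl (d₁₂ (W := W))).pow_pow M m) (L' - L)
      simp only [Module.End.mul_apply] at h1 h2 h3
      rw [hΘ, h1, h2, h3]
    have hk0 : ∀ y x, (d₁₂ ^ M) Θ y x n = 0 := by
      rw [hcomm]
      refine zn c₁₂₃ (fun G h n' hn' y x => ?_) m' _ (zn s₂ (fun G h n' hn' y x => ?_) k _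
        (zn d₁₂ (fun G h n' hn' y x => ?_) m _ hM)) n le_rfl
      · simp [c₁₂₃, s₁_apply, s₂_apply, s₃_apply, h n' hn', h (n' + 1) (by omega)]
      · simp [s₂_apply, h n' hn']
      · simp [d₁₂, s₁_apply, s₂_apply, h n' hn']
    have hT : FTrunc fun y x => Θ y x n := ⟨max y₀ y₁, fun y hy => by
      ext x; dsimp only; rw [hΘ1 y hy]; rfl⟩
    refine congrFun (eq_zero_of_dg_pow M hT (k := y) (fun y' _ => ?_) y le_rfl) x
    ext x
    rw [← slice₁₂, hk0]; rfl
  have hEL : sub₂₃ L = fun y x n => shiftMode (Y (act a y u)) x g n := rfl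
  set E := sub₂₃ L - ρ with hE
  have hE1 : (d₁₂ ^ m') ((d₂₃ ^ k) ((d₁₂₃ ^ m) E)) = 0 := by
    have h1 := (i7 (L' - L) (hL'T.sub hLT)).1
    rw [← hΘ, hΘ0, sub₂₃_sub hL'T hLT, map_sub, map_sub, map_sub, i6] at h1
    have h0 : sub₂₃ (0 : ℤ → ℤ → ℤ → W) = 0 := by
      ext y x n; exact bin_eq_zero fun _ _ _ => rfl
    rw [h0] at h1
    rw [hE, map_sub, map_sub, map_sub, ← neg_sub, h1, neg_zero]
  have hE0 : ∀ y, max y₀ y₁ ≤ y → E y = 0 := by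
    intro y hy
    ext x n
    simp only [hE, Pi.sub_apply, hρ0 y (by omega)]
    rw [show sub₂₃ L y x n = 0 from bin_eq_zero fun p' q' _ => by
      simp only [hL0 y (by omega)]; rfl]
    simp
  have hE2 : (d₂₃ ^ k) ((d₁₂₃ ^ m) E) = 0 := by
    have hT := fTrunc_pow z23 k (fTrunc_pow z123 m hE0)
    ext y x n
    have hT' : FTrunc fun y x => (d₂₃ ^ k) ((d₁₂₃ ^ m) E) y x n := ⟨max y₀ y₁, fun y hy => by
      ext x; dsimp only; rw [hT y hy]; rfl⟩
    refine congrFun (eq_zero_of_dg_pow m' hT' (k := y) (fun y' _ => ?_) y le_rfl) x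
    ext x
    rw [← slice₁₂, hE1]; rfl
  rw [c1] at hE2
  -- the factor `(y + x + z)^m` is traded for a power of `x + z`, one power of `y` at a time
  have hloc := exists_pow_eq_zero (dg (W := W)) m (D := d₁₂₃) (fun G y => by
    ext x n
    simp [d₁₂₃, s₁_apply, s₂_apply, s₃_apply, dg_apply, add_assoc])
    (F := (d₂₃ ^ k) E) ⟨_, fTrunc_pow z23 k hE0⟩ hE2 p
  obtain ⟨N, hN⟩ := hloc
  refine ⟨?_, N + k, ?_⟩
  · obtain ⟨K, hK⟩ := hYV.fTrunc (act a p u) v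
    refine ⟨K, fun q hq => ?_⟩
    have : YV (act a p u) q v = 0 := hK q hq
    ext n
    simp only [this, map_zero]
    rfl
  · have e : (d₂₃ ^ k) E p = (dg ^ k) (E p) := by
      ext x n; exact slice₂₃ k E p x n
    rw [e, ← Module.End.mul_apply, ← pow_add] at hN
    have e2 : E p = (fun q => shiftMode (Y (act a p u)) q g)
        - fun q n => Y (YV (act a p u) q v) n w := rfl
    rw [e2, map_sub, sub_eq_zero] at hN
    exact hN.symm

/-- Weak associativity: `Y(Y(u, x) v, z) w` is the re-expansion of `Y(u, x + z) Y(v, z) w`. -/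
theorem IsFieldAction.weakAssoc (hV : IsVacuumModule B S V one) (hA : IsHSModes B S A)
    (hYV : IsFieldAction one (actLin H V) YV) (hY : IsFieldAction one A Y) (u v : V) (w : W) :
    IsReexp (fun q => shiftMode (Y u) q fun n => Y v n w) fun q n => Y (YV u q v) n w := by
  have hg := hY.fTrunc v w
  induction u using hV.induction with
  | h0 =>
    convert isReexp_zero (W := W) using 1
    · ext q n
      rw [map_zero]
      exact bin_eq_zero fun _ _ _ => rfl
    · ext q n
      simp
  | hadd u u' hu hu' =>
    convert hu.add hu' using 1
    · ext1 q
      rw [map_add, shiftMode_add_left _ _ _ hg]; rfl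
    · ext q n
      simp
  | hsmul c u hu =>
    convert hu.smul c using 1
    · ext1 q
      rw [map_smul, shiftMode_smul_left _ _ _ hg]; rfl
    · ext q n
      simp
  | hone =>
    have e : (fun q => shiftMode (Y one) q fun n => Y v n w)
        = fun q n => Y (YV one q v) n w := by
      ext q n
      simp only [shiftMode, hY.one_apply, hYV.one_apply, constSeries]
      by_cases hq : q = -1
      · rw [bin, finsum_eq_single _ 0]
        · simp [hq]
        · intro i hi
          rw [if_neg (by omega), smul_zero]
      · rw [if_neg hq, map_zero]
        refine finsum_eq_zero_of_forall_eq_zero fun i => ?_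
        dsimp only
        split_ifs with hi
        · rw [bc_eq_zero_of_lt (by omega) (by omega), zero_smul]
        · rw [smul_zero]
    refine ⟨?_, 0, by rw [e]⟩
    obtain ⟨K, hK⟩ := hYV.fTrunc one v
    refine ⟨K, fun q hq => ?_⟩
    have : YV one q v = 0 := hK q hq
    ext n
    simp only [this, map_zero]
    rfl
  | hact a p u hu => exact hYV.weakAssoc_act hV hA hY a u v w hu p

end WeakAssoc

/-! ### Creation, modules and uniqueness -/

section Creation

variable {H : Type u} [AddCommGroup H] [Module ℂ H]
  {B : LinearMap.BilinForm ℂ H} {S : H ⊗[ℂ] H →ₗ[ℂ] (H ⊗[ℂ] H) ⊗[ℂ] LaurentSeries ℂ}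
  {V : Type v} [AddCommGroup V] [Module ℂ V] [Module (ModeAlgebra H) V]
  [IsScalarTower ℂ (ModeAlgebra H) V] {one : V}
  {W : Type w} [AddCommGroup W] [Module ℂ W] {A : H →ₗ[ℂ] ℤ → Module.End ℂ W}
  {YV : V →ₗ[ℂ] ℤ → Module.End ℂ V}

/-- On the vacuum, no factor `(y + z)^m` is needed in the re-expansions. -/
lemma IsFieldAction.good_one (hV : IsVacuumModule B S V one)
    (hY : IsFieldAction one (actLin H V) YV) (v : V) :
    ∀ a, v ∈ goodSubmodule hY a 0 one := by
  induction v using hV.induction with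
  | h0 => exact fun a => Submodule.zero_mem _
  | hadd x y hx hy => exact fun a => Submodule.add_mem _ (hx a) (hy a)
  | hsmul c x hx => exact fun a => Submodule.smul_mem _ c (hx a)
  | hone =>
    intro a
    have e : (fun n => YV one n one) = constSeries one := funext fun n => hY.one_apply n one
    refine ⟨0, fun q hq => ?_⟩
    rw [e]
    exact dg_pow_constSeries _ (fun n hn => hV.vacuumLike a n (by simpa using hn)) hq
  | hact c p x hx =>
    intro a
    obtain ⟨r, c', a', f, hS⟩ := exists_tensor_rep (S (c ⊗ₜ[ℂ] a))
    exact hV.isHSModule.isHSModes.good_of_isReexp hS (hY.fTrunc _ _) (fun j => hx (a' j))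
      (hY.reexp c x one) p

lemma IsFieldAction.act_one (hV : IsVacuumModule B S V one)
    (hY : IsFieldAction one (actLin H V) YV) (a : H) (q : ℤ) (v : V) (n : ℤ) :
    YV (act a q v) n one = shiftMode (actLin H V a) q (fun n => YV v n one) n :=
  congrFun (congrFun ((hY.reexp a v one).dg_pow_eq (hY.good_one hV v a)) q) n

/-- The creation property. -/
theorem IsFieldAction.creation (hV : IsVacuumModule B S V one)
    (hY : IsFieldAction one (actLin H V) YV) (v : V) :
    (∀ n, 0 ≤ n → YV v n one = 0) ∧ YV v (-1) one = v := by
  induction v using hV.induction with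
  | h0 => exact ⟨fun n _ => by simp, by simp⟩
  | hadd x y hx hy =>
    refine ⟨fun n hn => ?_, ?_⟩
    · rw [map_add, Pi.add_apply, LinearMap.add_apply, hx.1 n hn, hy.1 n hn, add_zero]
    · rw [map_add, Pi.add_apply, LinearMap.add_apply, hx.2, hy.2]
  | hsmul c x hx =>
    refine ⟨fun n hn => ?_, ?_⟩
    · rw [map_smul, Pi.smul_apply, LinearMap.smul_apply, hx.1 n hn, smul_zero]
    · rw [map_smul, Pi.smul_apply, LinearMap.smul_apply, hx.2]
  | hone =>
    simp only [hY.one_apply, constSeries]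
    exact ⟨fun n hn => if_neg (by omega), by simp⟩
  | hact a p x hx =>
    simp only [hY.act_one hV]
    refine ⟨fun n hn => bin_eq_zero fun p' q' hq => by
      dsimp only; rw [hx.1 q' (by omega), map_zero], ?_⟩
    rw [shiftMode, bin_eq_sum (N := 1)]
    · simp [hx.2]
    · intro i hi
      rw [hx.1 _ (by omega), map_zero]

lemma bc_eq_choose (m : ℤ) (i : ℕ) : bc m i = (Ring.choose (i - m - 1) i : ℤ) := by
  rw [bc, show m = -(-m) by ring, Ring.choose_neg, neg_neg,
    show -m + i - 1 = (i : ℤ) - m - 1 by ring]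
  simp only [Units.smul_def, Int.negOnePow_def, zpow_natCast, Units.val_pow_eq_pow_val, smul_eq_mul]
  push_cast
  rw [← mul_assoc, ← mul_pow]
  simp

lemma fTrunc_modes (YW : V →ₗ[ℂ] VertexOperator ℂ W) (v : V) (w : W) :
    FTrunc fun n => modes YW v n w := by
  refine ⟨-HahnSeries.order ((HahnModule.of ℂ).symm (YW v w)), fun n hn => ?_⟩
  exact VertexOperator.ncoeff_eq_zero_of_lt_order (YW v) n w (by omega)

/-- The equation in weak associativity, in terms of `dg`. -/
lemma weak_assoc_iff (Y : V →ₗ[ℂ] VertexOperator ℂ V) (YW : V →ₗ[ℂ] VertexOperator ℂ W) (u v : V)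
    (w : W) (l : ℕ) :
    (∀ m n : ℤ,
      ∑ᶠ i : ℕ, (Ring.choose (i - m - 1) i : ℤ) • vmode YW u (m + l - i) (vmode YW v (n + i) w)
      = ∑ i ∈ Finset.range (l + 1),
          (l.choose i) • vmode YW (vmode Y u (m + l - i) v) (n + i) w) ↔
    (dg ^ l) (fun q n => modes YW (modes Y u q v) n w)
      = (dg ^ l) (fun q => shiftMode (modes YW u) q fun n => modes YW v n w) := by
  have h1 : ∀ m n : ℤ, ∑ᶠ i : ℕ, (Ring.choose (i - m - 1) i : ℤ) •
        vmode YW u (m + l - i) (vmode YW v (n + i) w)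
      = (dg ^ l) (fun q => shiftMode (modes YW u) q fun n => modes YW v n w) m n := fun m n => by
    rw [dg_pow_shiftMode _ (fTrunc_modes YW v w), bin]
    refine finsum_congr fun i => ?_
    rw [bc_eq_choose, Int.cast_smul_eq_zsmul, add_comm (l : ℤ) m]
    rfl
  have h2 : ∀ m n : ℤ, ∑ i ∈ Finset.range (l + 1),
        (l.choose i) • vmode YW (vmode Y u (m + l - i) v) (n + i) w
      = (dg ^ l) (fun q n => modes YW (modes Y u q v) n w) m n := fun m n => by
    rw [dg_pow_apply]; rfl
  simp only [h1, h2]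
  exact ⟨fun h => funext fun m => funext fun n => (h m n).symm, fun h m n => by rw [h]⟩

/-- The fields which are determined by the operators `A a m` are unique. -/
theorem IsFieldAction.ext (hV : IsVacuumModule B S V one) {Y Y' : V →ₗ[ℂ] ℤ → Module.End ℂ W}
    (hY : IsFieldAction one A Y) (hY' : IsFieldAction one A Y') : Y = Y' := by
  suffices ∀ v w, (fun n => Y v n w) = fun n => Y' v n w from
    LinearMap.ext fun v => funext fun n => LinearMap.ext fun w => congrFun (this v w) n
  intro v w
  induction v using hV.induction with
  | h0 => simp
  | hadd x y hx hy =>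
    ext n
    have h1 := congrFun hx n
    have h2 := congrFun hy n
    simp [h1, h2]
  | hsmul c x hx =>
    ext n
    have h1 := congrFun hx n
    simp [h1]
  | hone => ext n; rw [hY.one_apply, hY'.one_apply]
  | hact a m x hx =>
    have h1 := hY.reexp a x w
    have h2 := hY'.reexp a x w
    rw [hx] at h1
    exact congrFun (h1.unique h2) m

lemma modes_injective : Function.Injective (modes : (V →ₗ[ℂ] VertexOperator ℂ W) → _) := by
  intro Y Y' h
  ext v w n
  have := congrFun (congrArg (fun Z => (Z v : ℤ → Module.End ℂ W)) h) (-n - 1)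
  have h2 := LinearMap.congr_fun this w
  simp only [modes, LinearMap.comp_apply, VertexOperator.ncoeff_apply] at h2
  rw [show -(-n - 1) - 1 = n by ring] at h2
  exact h2

variable {Y : V →ₗ[ℂ] VertexOperator ℂ V} {YW : V →ₗ[ℂ] VertexOperator ℂ W}

lemma isVAModule_of_isFieldAction (hV : IsVacuumModule B S V one) (hA : IsHSModes B S A)
    (hY : IsFieldAction one (actLin H V) (modes Y)) (hYW : IsFieldAction one A (modes YW)) :
    IsVAModule one Y YW where
  vacuum n w := hYW.one_apply n w
  weak_assoc u v w := by
    obtain ⟨l, hl⟩ := (hY.weakAssoc hV hA hYW u v w).2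
    exact ⟨l, (weak_assoc_iff Y YW u v w l).mpr hl⟩

/-- In a module, weak associativity for `a(-1) one` says that the field of `a_q v` is obtained by
re-expansion. -/
lemma isFieldAction_of_isVAModule (hV : IsVacuumModule B S V one)
    (hact : ∀ a n, vmode Y (act (H := H) a (-1) one) n = act a n)
    (h : IsVAModule one Y YW) (hact' : ∀ a n w, vmode YW (act (H := H) a (-1) one) n w = A a n w) :
    IsFieldAction one A (modes YW) where
  fTrunc := fTrunc_modes YW
  one_apply n w := h.vacuum n w
  reexp a v w := by
    obtain ⟨l, hl⟩ := h.weak_assoc (act a (-1) one) v w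
    rw [weak_assoc_iff] at hl
    have e1 : ∀ q, modes Y (act a (-1) one) q v = act a q v := fun q => congrFun (hact a q) v
    have e2 : modes YW (act a (-1) one) = A a :=
      funext fun q => LinearMap.ext fun w => hact' a q w
    simp only [e1, e2] at hl
    refine ⟨?_, l, hl⟩
    obtain ⟨k, hk⟩ := hV.isHSModule.truncation a v
    exact ⟨k, fun q hq => by ext n; dsimp only; rw [hk q hq]; simp⟩

/-- The Jacobi identity implies weak associativity: its second term vanishes for large `m`. -/
lemma IsWeakQVA.isVAModule (h : IsWeakQVA one Y) : IsVAModule one Y Y where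
  vacuum := h.vacuum
  weak_assoc u v w := by
    obtain ⟨r, v', u', f, hJ⟩ := h.jacobi u v
    choose k hk using fun j => fTrunc_modes Y (u' j) w
    obtain ⟨K, hK⟩ := (Finset.univ.image k).exists_le
    refine ⟨K.toNat, (weak_assoc_iff Y Y u v w K.toNat).mpr ?_⟩
    ext l n
    have h1 := hJ l K.toNat n w
    rw [Finset.sum_eq_zero, smul_zero, sub_zero, prodCoeff_eq_bin] at h1
    · rw [dg_pow_shiftMode _ (fTrunc_modes Y v w), dg_pow_apply]
      refine Eq.trans ?_ h1.symm
      rw [finsum_nat_eq_range (K.toNat + 1), ← Finset.sum_range_reflect]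
      · refine Finset.sum_congr rfl fun i hi => ?_
        have hi' : i ≤ K.toNat := Nat.lt_succ_iff.mp (Finset.mem_range.mp hi)
        rw [show K.toNat + 1 - 1 - i = K.toNat - i by omega, Nat.choose_symm hi',
          Ring.choose_natCast, natCast_zsmul, vmode_eq_modes, vmode_eq_modes]
        have e1 : l + (K.toNat : ℤ) - (K.toNat - i : ℕ) = l + i := by push_cast [hi']; ring
        have e2 : n + ((K.toNat - i : ℕ) : ℤ) = K.toNat + n - i := by push_cast [hi']; ring
        rw [e1, e2]
      · intro i hi
        rw [Ring.choose_natCast, Nat.choose_eq_zero_of_lt (by omega)]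
        simp
    · intro j _
      have hkj : k j ≤ K := hK _ (by simp)
      unfold swapCoeff
      refine finsum_eq_zero_of_forall_eq_zero fun i => finsum_eq_zero_of_forall_eq_zero fun s => ?_
      have h0 : modes Y (u' j) (K.toNat + i) w = 0 := hk j _ (by omega)
      rw [vmode_eq_modes Y (u' j), h0]
      simp [vmode]

end Creation

/-! ### Functions satisfying the Borcherds recursion -/

section Borcherds

variable {W : Type*} [AddCommGroup W] [Module ℂ W]

/-- The recursion which is satisfied by the coefficients of each term of the Jacobi identity:
`x₀` acts in the same way as `x₁ - x₂`. -/
def Borcherds (E : ℤ → ℤ → ℤ → W) : Prop :=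
  ∀ l m n, E (l + 1) m n = E l (m + 1) n - E l m (n + 1)

lemma Borcherds.sub {E E' : ℤ → ℤ → ℤ → W} (h : Borcherds E) (h' : Borcherds E') :
    Borcherds (E - E') := fun l m n => by
  simp only [Pi.sub_apply, h l m n, h' l m n]; abel

lemma Borcherds.add {E E' : ℤ → ℤ → ℤ → W} (h : Borcherds E) (h' : Borcherds E') :
    Borcherds (E + E') := fun l m n => by
  simp only [Pi.add_apply, h l m n, h' l m n]; abel

/-- A solution of the recursion which vanishes for large `m` and for large `n` vanishes. -/
lemma Borcherds.eq_zero {E : ℤ → ℤ → ℤ → W} (h : Borcherds E) {m₀ n₀ : ℤ}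
    (hm : ∀ l m n, m₀ ≤ m → E l m n = 0) (hn : ∀ l m n, n₀ ≤ n → E l m n = 0) : E = 0 := by
  have key : ∀ (j : ℕ) (m : ℤ), m₀ - j ≤ m → ∀ l n, E l m n = 0 := by
    intro j
    induction j with
    | zero => intro m hj l n; exact hm _ _ _ (by simpa using hj)
    | succ j ih =>
      intro m hj l n
      have step : ∀ l n, E (l + 1) m n = - E l m (n + 1) := fun l n => by
        rw [h, ih (m + 1) (by push_cast at hj; omega), zero_sub]
      have : ∀ (i : ℕ) (l n : ℤ), n₀ - i ≤ n → E l m n = 0 := by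
        intro i
        induction i with
        | zero => intro l n hi; exact hn _ _ _ (by simpa using hi)
        | succ i ihi =>
          intro l n hi
          have := step (l - 1) n
          rw [sub_add_cancel, ihi _ (n + 1) (by push_cast at hi; omega), neg_zero] at this
          exact this
      exact this (n₀ - n).toNat l n (by omega)
  ext l m n
  exact key (m₀ - m).toNat m (by omega) l n

lemma zpow_neg_one_succ (l : ℤ) : (-1 : ℂ) ^ (l + 1) = - (-1) ^ l := by
  rw [zpow_add₀ (by norm_num)]; simp

lemma zpow_neg_one_mul_self (l : ℤ) : (-1 : ℂ) ^ l * (-1) ^ l = 1 := by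
  rw [← mul_zpow]; simp

lemma zpow_neg_one_add_natCast (l : ℤ) (i : ℕ) : (-1 : ℂ) ^ (l + i) = (-1) ^ l * (-1) ^ i := by
  rw [zpow_add₀ (by norm_num), zpow_natCast]

/-- A solution which vanishes for large `l` and for large `n` vanishes, because the recursion is
symmetric, up to signs, in its three variables. -/
lemma Borcherds.eq_zero' {E : ℤ → ℤ → ℤ → W} (h : Borcherds E) {l₀ n₀ : ℤ}
    (hl : ∀ l m n, l₀ ≤ l → E l m n = 0) (hn : ∀ l m n, n₀ ≤ n → E l m n = 0) : E = 0 := by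
  have h' : Borcherds fun a b c => (-1 : ℂ) ^ c • E b a c := fun a b c => by
    have := h b a c
    simp only [zpow_neg_one_succ, this]
    module
  have h0 := h'.eq_zero (m₀ := l₀) (n₀ := n₀) (fun _ _ _ hb => by rw [hl _ _ _ hb, smul_zero])
    (fun _ _ _ hc => by rw [hn _ _ _ hc, smul_zero])
  ext l m n
  have := congrFun (congrFun (congrFun h0 m) l) n
  have hz : (-1 : ℂ) ^ n ≠ 0 := zpow_ne_zero _ (by norm_num)
  exact (smul_eq_zero.mp this).resolve_left hz

lemma borcherds_bin {G : ℤ → ℤ → W} (hG : STrunc G) : Borcherds fun l m n => bin l G m n :=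
  fun l m n => bin_succ hG l m n

/-- The coefficients `∑ᵢ C(m, i) ρ (l + i) (m + n - i)` of the iterate term of the Jacobi
identity. -/
def iter (ρ : ℤ → ℤ → W) (l m n : ℤ) : W :=
  (-1 : ℂ) ^ l • bin m (fun p q => (-1 : ℂ) ^ q • ρ q p) n l

lemma sTrunc_iter {ρ : ℤ → ℤ → W} (hρ : FTrunc ρ) :
    STrunc fun p q => (-1 : ℂ) ^ q • ρ q p := by
  obtain ⟨k, hk⟩ := hρ
  exact ⟨k, fun p q hq => by simp [hk q hq]⟩

lemma iter_eq_finsum (ρ : ℤ → ℤ → W) (l m n : ℤ) :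
    iter ρ l m n = ∑ᶠ i : ℕ, (Ring.choose m i : ℤ) • ρ (l + i) (m + n - i) := by
  rw [iter, bin, smul_finsum]
  refine finsum_congr fun i => ?_
  rw [← Int.cast_smul_eq_zsmul ℂ, bc, zpow_neg_one_add_natCast, smul_smul, smul_smul,
    show n + m - (i : ℤ) = m + n - i by ring]
  congr 1
  have h1 := zpow_neg_one_mul_self l
  have h2 : (-1 : ℂ) ^ i * (-1) ^ i = 1 := by rw [← mul_pow]; simp
  linear_combination ((Ring.choose m i : ℤ) : ℂ) * (-1) ^ i * (-1) ^ i * h1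
    + ((Ring.choose m i : ℤ) : ℂ) * h2

lemma borcherds_iter {ρ : ℤ → ℤ → W} (hρ : FTrunc ρ) : Borcherds (iter ρ) := fun l m n => by
  have := bin_succ (sTrunc_iter hρ) m n l
  simp only [iter, zpow_neg_one_succ, this]
  module

lemma iter_zero (ρ : ℤ → ℤ → W) (l n : ℤ) : iter ρ l 0 n = ρ l n := by
  rw [iter, bin_zero, smul_smul, zpow_neg_one_mul_self, one_smul]

lemma iter_natCast {ρ : ℤ → ℤ → W} (hρ : FTrunc ρ) (m : ℕ) (l n : ℤ) :
    iter ρ l m n = (dg ^ m) ρ l n := by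
  induction m generalizing l n with
  | zero => simp [iter_zero]
  | succ m ih =>
    have := borcherds_iter hρ l m n
    rw [eq_sub_iff_add_eq] at this
    rw [Nat.cast_succ, ← this, ih, ih, pow_succ', Module.End.mul_apply, dg_apply]

lemma iter_eq_zero {ρ : ℤ → ℤ → W} {k : ℤ} (hk : ∀ q, k ≤ q → ρ q = 0) {l : ℤ} (hl : k ≤ l)
    (m n : ℤ) : iter ρ l m n = 0 := by
  rw [iter, bin_eq_zero fun p q hq => by rw [hk q (by omega)]; simp, smul_zero]

/-- Weak associativity identifies the product term and the iterate term of the Jacobi identity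
in a range. -/
lemma IsReexp.exists_bin_eq_iter {a : ℤ → Module.End ℂ W} {g : ℤ → W} (hg : FTrunc g)
    {ρ : ℤ → ℤ → W} (h : IsReexp (fun q => shiftMode a q g) ρ) :
    ∃ m₀ : ℤ, ∀ l m n, m₀ ≤ m → bin l (fun p q => a p (g q)) m n = iter ρ l m n := by
  obtain ⟨hρ, k, hk⟩ := h
  refine ⟨k, fun l m n hm => ?_⟩
  obtain ⟨m, rfl⟩ := Int.eq_ofNat_of_zero_le (by omega : 0 ≤ m)
  rw [iter_natCast hρ, ← dg_pow_shiftMode a hg,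
    dg_pow_eq_of_le (by omega : k ≤ m) hk]

end Borcherds

/-! ### Products with the vacuum -/

section Vacuum

variable {W : Type*} [AddCommGroup W] [Module ℂ W]

/-- The coefficients of the expansion of `h(y + z)` in nonnegative powers of `y`. -/
def taylor (h : ℤ → W) (q n : ℤ) : W := if q ≤ -1 then bc n (-1 - q).toNat • h (q + n + 1) else 0

lemma dg_taylor (h : ℤ → W) : dg (taylor h) = taylor fun n => h (n + 1) := by
  ext q n
  simp only [dg_apply, taylor]
  rcases lt_trichotomy q (-1) with hq | hq | hq
  · obtain ⟨i, hi⟩ : ∃ i : ℕ, q + 1 + 1 + i = 0 := ⟨(-2 - q).toNat, by omega⟩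
    rw [if_pos (by omega), if_pos (by omega), if_pos (by omega),
      show (-1 - (q + 1)).toNat = i by omega, show (-1 - q).toNat = i + 1 by omega,
      bc_succ_succ, show q + 1 + n + 1 = q + n + 1 + 1 by ring,
      show q + (n + 1) + 1 = q + n + 1 + 1 by ring]
    module
  · subst hq
    simp [add_comm]
  · rw [if_neg (by omega), if_neg (by omega), if_neg (by omega), add_zero]

lemma dg_pow_taylor (h : ℤ → W) (m : ℕ) : (dg ^ m) (taylor h) = taylor fun n => h (n + m) := by
  induction m generalizing h with
  | zero => simp
  | succ m ih =>
    rw [pow_succ, Module.End.mul_apply, dg_taylor, ih]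
    congr 1
    ext n
    push_cast
    rw [add_assoc]

lemma dg_swap (F : ℤ → ℤ → W) (m : ℕ) (q n : ℤ) :
    (dg ^ m) (fun q n => F n q) q n = (dg ^ m) F n q := by
  induction m generalizing F with
  | zero => rfl
  | succ m ih =>
    have e : dg (fun q n => F n q) = fun q n => dg F n q := by
      funext q n
      simp only [dg_apply, add_comm]
    rw [pow_succ, Module.End.mul_apply, Module.End.mul_apply, e, ih]

lemma bc_symm (a b : ℕ) : bc (-1 - b) a = bc (-1 - a) b := by
  rw [bc_eq_choose, bc_eq_choose, show (a : ℤ) - (-1 - b) - 1 = (a + b : ℕ) by push_cast; ring,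
    show (b : ℤ) - (-1 - a) - 1 = (a + b : ℕ) by push_cast; ring, Ring.choose_natCast,
    Ring.choose_natCast, Nat.choose_symm_add]

lemma taylor_swap {h : ℤ → W} (hh : ∀ n, 0 ≤ n → h n = 0) (q n : ℤ) :
    taylor h q n = taylor h n q := by
  simp only [taylor]
  have aux : ∀ q n : ℤ, q ≤ -1 → ¬ n ≤ -1 → bc n (-1 - q).toNat • h (q + n + 1) = 0 := by
    intro q n hq hn
    by_cases hqn : n < ((-1 - q).toNat : ℤ)
    · rw [bc_eq_zero_of_lt (by omega) hqn, zero_smul]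
    · rw [hh _ (by omega), smul_zero]
  split_ifs with h1 h2 h2
  · obtain ⟨a, ha⟩ : ∃ a : ℕ, q = -1 - a := ⟨(-1 - q).toNat, by omega⟩
    obtain ⟨b, hb⟩ : ∃ b : ℕ, n = -1 - b := ⟨(-1 - n).toNat, by omega⟩
    subst ha hb
    rw [show (-1 - (-1 - (a : ℤ))).toNat = a by omega,
      show (-1 - (-1 - (b : ℤ))).toNat = b by omega, bc_symm, add_comm (-1 - (a : ℤ))]
  · exact aux q n h1 h2
  · exact (aux n q h2 h1).symm
  · rfl

lemma IsReexp.eq_taylor {a : ℤ → Module.End ℂ W} {w : W} (hw : FTrunc fun n => a n w)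
    {ρ : ℤ → ℤ → W} (h : IsReexp (fun q => shiftMode a q (constSeries w)) ρ) :
    ρ = taylor fun n => a n w := by
  refine h.unique ⟨⟨0, fun q hq => by ext n; rw [taylor, if_neg (by omega)]; rfl⟩, ?_⟩
  obtain ⟨k, hk⟩ := hw
  have e : (fun q => shiftMode a q (constSeries w)) = fun q n => taylor (fun n => a n w) n q := by
    ext q n
    rw [shiftMode_constSeries, taylor, add_comm q n]
  refine ⟨k.toNat, ?_⟩
  rw [e]
  ext q n
  rw [dg_swap (taylor fun n => a n w), dg_pow_taylor]
  exact taylor_swap (fun n hn => hk _ (by omega)) q n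

variable {H : Type u} [AddCommGroup H] [Module ℂ H]
  {B : LinearMap.BilinForm ℂ H} {S : H ⊗[ℂ] H →ₗ[ℂ] (H ⊗[ℂ] H) ⊗[ℂ] LaurentSeries ℂ}
  {V : Type v} [AddCommGroup V] [Module ℂ V] [Module (ModeAlgebra H) V]
  [IsScalarTower ℂ (ModeAlgebra H) V] {one : V}
  {YV : V →ₗ[ℂ] ℤ → Module.End ℂ V}

/-- `Y(Y(v, x) one, z) = Y(v, x + z)`, expanded in nonnegative powers of `x`. -/
lemma IsFieldAction.mode_one (hV : IsVacuumModule B S V one)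
    (hY : IsFieldAction one (actLin H V) YV) (v : V) (i : ℕ) (m : ℤ) (w : V) :
    YV (YV v (-1 - i) one) m w = bc m i • YV v (m - i) w := by
  have h := hY.weakAssoc hV hV.isHSModule.isHSModes hY v one w
  simp only [hY.one_apply] at h
  have := congrFun (congrFun (h.eq_taylor (hY.fTrunc v w)) (-1 - i)) m
  rw [this, taylor, if_pos (by omega), show (-1 - (-1 - (i : ℤ))).toNat = i by omega,
    show -1 - (i : ℤ) + m + 1 = m - i by ring]

end Vacuum

/-! ### Multiplication by Laurent series -/

section Conv

variable {W : Type*} [AddCommGroup W] [Module ℂ W]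

/-- The modes of `f(x) c(x)`, where `c(x) = ∑ c_q x^{-q-1}`. -/
def conv (f : LaurentSeries ℂ) (c : ℤ → W) (q : ℤ) : W := ∑ᶠ s : ℤ, f.coeff s • c (q + s)

lemma conv_eq_sum {f : LaurentSeries ℂ} {c : ℤ → W} {s₀ K q S : ℤ}
    (h₀ : ∀ s, s < s₀ → f.coeff s = 0) (hK : ∀ q, K ≤ q → c q = 0) (hS : K ≤ q + S) :
    conv f c q = ∑ s ∈ Finset.Ico s₀ S, f.coeff s • c (q + s) :=
  finsum_int_eq_Ico _ _ (fun s hs => by rw [h₀ s hs, zero_smul])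
    fun s hs => by rw [hK _ (by omega), smul_zero]

lemma conv_add {c c' : ℤ → W} (hc : FTrunc c) (hc' : FTrunc c') (f : LaurentSeries ℂ) (q : ℤ) :
    conv f (fun q => c q + c' q) q = conv f c q + conv f c' q := by
  obtain ⟨K, hK⟩ := hc
  obtain ⟨K', hK'⟩ := hc'
  obtain ⟨s₀, h₀⟩ := exists_coeff_bound f
  rw [conv_eq_sum h₀ hK (S := max K K' - q) (by omega),
    conv_eq_sum h₀ hK' (S := max K K' - q) (by omega),
    conv_eq_sum h₀ (K := max K K') (fun q hq => by rw [hK q (by omega), hK' q (by omega), add_zero])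
      (S := max K K' - q) (by omega), ← Finset.sum_add_distrib]
  simp only [smul_add]

lemma map_conv {W' : Type*} [AddCommGroup W'] [Module ℂ W'] (φ : W →ₗ[ℂ] W') {c : ℤ → W}
    (hc : FTrunc c) (f : LaurentSeries ℂ) (q : ℤ) :
    φ (conv f c q) = conv f (fun q => φ (c q)) q := by
  obtain ⟨K, hK⟩ := hc
  obtain ⟨s₀, h₀⟩ := exists_coeff_bound f
  rw [conv_eq_sum h₀ hK (S := K - q) (by omega), conv_eq_sum h₀ (K := K)
    (fun q hq => by rw [hK q hq, map_zero]) (S := K - q) (by omega), map_sum]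
  simp only [map_smul]

lemma conv_smul {c : ℤ → W} (hc : FTrunc c) (f : LaurentSeries ℂ) (x : ℂ) (q : ℤ) :
    conv f (fun q => x • c q) q = x • conv f c q :=
  (map_conv (x • LinearMap.id) hc f q).symm

lemma conv_sub {c c' : ℤ → W} (hc : FTrunc c) (hc' : FTrunc c') (f : LaurentSeries ℂ) (q : ℤ) :
    conv f (fun q => c q - c' q) q = conv f c q - conv f c' q := by
  have := conv_add hc (hc'.smul (-1)) f q
  rw [show ((-1 : ℂ) • c') = fun q => (-1 : ℂ) • c' q from rfl, conv_smul hc'] at this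
  simpa [sub_eq_add_neg] using this

lemma conv_shift (f : LaurentSeries ℂ) (c : ℤ → W) (k q : ℤ) :
    conv f (fun q => c (q + k)) q = conv f c (q + k) := by
  unfold conv
  refine finsum_congr fun s => ?_
  rw [add_right_comm]

lemma FTrunc.conv {c : ℤ → W} (hc : FTrunc c) (f : LaurentSeries ℂ) : FTrunc (conv f c) := by
  obtain ⟨K, hK⟩ := hc
  obtain ⟨s₀, h₀⟩ := exists_coeff_bound f
  refine ⟨K - s₀, fun q hq => ?_⟩
  rw [conv_eq_sum h₀ hK (S := s₀) (by omega), Finset.Ico_self, Finset.sum_empty]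

lemma FTrunc.sum {ι : Type*} (T : Finset ι) {c : ι → ℤ → W} (h : ∀ i ∈ T, FTrunc (c i)) :
    FTrunc fun q => ∑ i ∈ T, c i q := by
  classical
  induction T using Finset.induction_on with
  | empty => exact ⟨0, fun q _ => by simp⟩
  | insert i T hi ih =>
    simp only [Finset.sum_insert hi]
    exact (h i (by simp)).add (ih fun j hj => h j (by simp [hj]))

lemma conv_single (k : ℤ) (x : ℂ) (c : ℤ → W) (q : ℤ) :
    conv (HahnSeries.single k x) c q = x • c (q + k) := by
  rw [conv, finsum_eq_single _ k]
  · simp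
  · intro s hs
    rw [HahnSeries.coeff_single_of_ne hs, zero_smul]

lemma coeff_smul_eq_conv (f : LaurentSeries ℂ) (z : HahnModule ℤ ℂ W) (q : ℤ) :
    ((HahnModule.of ℂ).symm (f • z)).coeff (-q - 1)
      = conv f (fun q => ((HahnModule.of ℂ).symm z).coeff (-q - 1)) q := by
  classical
  rw [HahnModule.coeff_smul, conv]
  have hmem : ∀ ij ∈ Finset.VAddAntidiagonal (-q - 1) (Set.VAddAntidiagonal.finite_of_isPWO
      f.isPWO_support ((HahnModule.of ℂ).symm z).isPWO_support (-q - 1)),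
      ij.2 = -(q + ij.1) - 1 := fun ij hij => by
    have h : ij.1 + ij.2 = -q - 1 := ((Finset.mem_vaddAntidiagonal _ _).mp hij).2.2
    omega
  symm
  rw [finsum_eq_sum_of_support_subset (s := Finset.image Prod.fst (Finset.VAddAntidiagonal (-q - 1)
    (Set.VAddAntidiagonal.finite_of_isPWO f.isPWO_support
      ((HahnModule.of ℂ).symm z).isPWO_support (-q - 1)))), Finset.sum_image]
  · refine Finset.sum_congr rfl fun ij hij => ?_
    rw [hmem ij hij]
  · intro ij hij ij' hij' h
    refine Prod.ext h ?_
    rw [hmem ij hij, hmem ij' hij', h]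
  · intro s hs
    have h1 : f.coeff s ≠ 0 := fun h => hs (by simp only [h, zero_smul])
    have h2 : ((HahnModule.of ℂ).symm z).coeff (-(q + s) - 1) ≠ 0 :=
      fun h => hs (by simp only [h, smul_zero])
    rw [Finset.mem_coe, Finset.mem_image]
    exact ⟨(s, -(q + s) - 1), (Finset.mem_vaddAntidiagonal _ _).mpr
      ⟨h1, h2, show s + (-(q + s) - 1) = -q - 1 by ring⟩, rfl⟩

variable {V : Type*} [AddCommGroup V] [Module ℂ V]

/-- The `ℂ((x))`-submodule of `V((x))` generated by the series `Y(v, x) u`. -/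
def fieldSpan (Y : V →ₗ[ℂ] VertexOperator ℂ V) :
    Submodule (LaurentSeries ℂ) (HahnModule ℤ ℂ V) :=
  Submodule.span (LaurentSeries ℂ) (Set.range fun p : V × V => Y p.1 p.2)

/-- The sequence `c` consists of the modes of a series in the `ℂ((x))`-span of the `Y(v, x) u`. -/
def InSpan (Y : V →ₗ[ℂ] VertexOperator ℂ V) (c : ℤ → V) : Prop :=
  ∃ z ∈ fieldSpan Y, ∀ q, c q = ((HahnModule.of ℂ).symm z).coeff (-q - 1)

variable {Y : V →ₗ[ℂ] VertexOperator ℂ V}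

lemma inSpan_modes (v u : V) : InSpan Y fun q => modes Y v q u :=
  ⟨Y v u, Submodule.subset_span ⟨(v, u), rfl⟩, fun _ => rfl⟩

lemma InSpan.add {c c' : ℤ → V} (h : InSpan Y c) (h' : InSpan Y c') :
    InSpan Y (fun q => c q + c' q) := by
  obtain ⟨z, hz, e⟩ := h
  obtain ⟨z', hz', e'⟩ := h'
  exact ⟨z + z', Submodule.add_mem _ hz hz', fun q => by dsimp only; rw [e, e']; simp⟩

lemma InSpan.zero : InSpan Y fun _ => 0 := ⟨0, Submodule.zero_mem _, fun q => by simp⟩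

lemma InSpan.conv {c : ℤ → V} (h : InSpan Y c) (f : LaurentSeries ℂ) : InSpan Y (conv f c) := by
  obtain ⟨z, hz, e⟩ := h
  refine ⟨f • z, Submodule.smul_mem _ f hz, fun q => ?_⟩
  rw [coeff_smul_eq_conv]
  simp only [← e]

lemma InSpan.smul {c : ℤ → V} (h : InSpan Y c) (x : ℂ) : InSpan Y (fun q => x • c q) := by
  have := h.conv (HahnSeries.single 0 x)
  convert this using 1
  ext q
  rw [conv_single, add_zero]

lemma InSpan.shift {c : ℤ → V} (h : InSpan Y c) (k : ℤ) : InSpan Y (fun q => c (q + k)) := by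
  have := h.conv (HahnSeries.single k 1)
  convert this using 1
  ext q
  rw [conv_single, one_smul]

lemma InSpan.sum {ι : Type*} (T : Finset ι) {c : ι → ℤ → V} (h : ∀ i ∈ T, InSpan Y (c i)) :
    InSpan Y fun q => ∑ i ∈ T, c i q := by
  classical
  induction T using Finset.induction_on with
  | empty => simpa using InSpan.zero
  | insert i T hi ih =>
    simp only [Finset.sum_insert hi]
    exact (h i (by simp)).add (ih fun j hj => h j (by simp [hj]))

lemma InSpan.exists_rep {c : ℤ → V} (h : InSpan Y c) : ∃ (r : ℕ) (v u : Fin r → V)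
    (f : Fin r → LaurentSeries ℂ), ∀ q,
      c q = ∑ j, QVA.conv (f j) (fun q => modes Y (v j) q (u j)) q := by
  obtain ⟨z, hz, e⟩ := h
  rw [fieldSpan, Submodule.mem_span_set'] at hz
  obtain ⟨r, f, g, rfl⟩ := hz
  choose p hp using fun i => (g i).2
  refine ⟨r, fun i => (p i).1, fun i => (p i).2, f, fun q => ?_⟩
  have : ∀ T : Finset (Fin r),
      ((HahnModule.of ℂ).symm (∑ i ∈ T, f i • (g i : HahnModule ℤ ℂ V))).coeff (-q - 1)
        = ∑ i ∈ T, ((HahnModule.of ℂ).symm (f i • (g i : HahnModule ℤ ℂ V))).coeff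
          (-q - 1) := by
    intro T
    classical
    induction T using Finset.induction_on with
    | empty => simp
    | insert i T hi ih => rw [Finset.sum_insert hi, Finset.sum_insert hi, ← ih]; simp
  rw [e, this]
  refine Finset.sum_congr rfl fun i _ => ?_
  rw [coeff_smul_eq_conv, ← hp i]
  rfl

end Conv

/-! ### Exponentials of the translation operator -/

section Theta

variable {V : Type v} [AddCommGroup V] [Module ℂ V]

/-- The modes of `∑ᵢ x^i c(x)_{-1-i} one`, which is `e^{xD} c(x)` for the translation operator `D`
of the vertex algebra. -/
def theta (Y : V →ₗ[ℂ] ℤ → Module.End ℂ V) (one : V) (c : ℤ → V) (l : ℤ) : V :=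
  ∑ᶠ i : ℕ, Y (c (l + i)) (-1 - i) one

variable {Y : V →ₗ[ℂ] ℤ → Module.End ℂ V} {one : V}

lemma theta_eq_sum {c : ℤ → V} {K l : ℤ} (hK : ∀ q, K ≤ q → c q = 0) {N : ℕ} (hN : K ≤ l + N) :
    theta Y one c l = ∑ i ∈ Finset.range N, Y (c (l + i)) (-1 - i) one :=
  finsum_nat_eq_range N fun i hi => by rw [hK _ (by omega)]; simp

lemma theta_add {c c' : ℤ → V} (hc : FTrunc c) (hc' : FTrunc c') (l : ℤ) :
    theta Y one (fun q => c q + c' q) l = theta Y one c l + theta Y one c' l := by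
  obtain ⟨K, hK⟩ := hc
  obtain ⟨K', hK'⟩ := hc'
  obtain ⟨N, hN⟩ : ∃ N : ℕ, max K K' ≤ l + N := ⟨(max K K' - l).toNat, by omega⟩
  rw [theta_eq_sum hK (N := N) (by omega), theta_eq_sum hK' (N := N) (by omega),
    theta_eq_sum (K := max K K') (fun q hq => by rw [hK q (by omega), hK' q (by omega), add_zero])
        hN,
    ← Finset.sum_add_distrib]
  simp

lemma theta_smul (c : ℤ → V) (x : ℂ) (l : ℤ) :
    theta Y one (fun q => x • c q) l = x • theta Y one c l := by
  simp only [theta, map_smul, Pi.smul_apply, LinearMap.smul_apply, smul_finsum]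

lemma theta_sum {ι : Type*} (T : Finset ι) {c : ι → ℤ → V} (h : ∀ i ∈ T, FTrunc (c i)) (l : ℤ) :
    theta Y one (fun q => ∑ i ∈ T, c i q) l = ∑ i ∈ T, theta Y one (c i) l := by
  classical
  induction T using Finset.induction_on with
  | empty => simp [theta]
  | insert i T hi ih =>
    simp only [Finset.sum_insert hi]
    rw [theta_add (h i (by simp)) (FTrunc.sum T fun j hj => h j (by simp [hj])),
      ih fun j hj => h j (by simp [hj])]

lemma theta_shift (c : ℤ → V) (k l : ℤ) :
    theta Y one (fun q => c (q + k)) l = theta Y one c (l + k) := by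
  unfold theta
  refine finsum_congr fun i => ?_
  rw [add_right_comm]

lemma theta_congr {c c' : ℤ → V} {l : ℤ} (h : ∀ q, l ≤ q → c q = c' q) :
    theta Y one c l = theta Y one c' l :=
  finsum_congr fun i => by rw [h _ (by omega)]

lemma FTrunc.theta {c : ℤ → V} (hc : FTrunc c) : FTrunc (theta Y one c) := by
  obtain ⟨K, hK⟩ := hc
  refine ⟨K, fun q hq => ?_⟩
  rw [theta_eq_sum hK (N := 0) (by simpa using hq)]
  simp

variable {H : Type u} [AddCommGroup H] [Module ℂ H]
  {B : LinearMap.BilinForm ℂ H} {S : H ⊗[ℂ] H →ₗ[ℂ] (H ⊗[ℂ] H) ⊗[ℂ] LaurentSeries ℂ}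
  [Module (ModeAlgebra H) V] [IsScalarTower ℂ (ModeAlgebra H) V]

/-- The field of `e^{xD} c(x)`. -/
lemma IsFieldAction.theta_apply (hV : IsVacuumModule B S V one)
    (hY : IsFieldAction one (actLin H V) Y) {c : ℤ → V} (hc : FTrunc c) (l m : ℤ) (w : V) :
    Y (theta Y one c l) m w = bin m (fun p q => Y (c q) p w) 0 l := by
  obtain ⟨K, hK⟩ := hc
  obtain ⟨N, hN⟩ : ∃ N : ℕ, K ≤ l + N := ⟨(K - l).toNat, by omega⟩
  rw [theta_eq_sum hK hN, bin_eq_sum_of_le (K := K) (fun p q hq => by rw [hK q hq]; simp) hN]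
  simp only [map_sum, Finset.sum_apply, LinearMap.sum_apply]
  refine Finset.sum_congr rfl fun i _ => ?_
  rw [hY.mode_one hV, zero_add]

/-- Moving `a_p` out of `e^{xD}`. -/
lemma IsFieldAction.theta_act (hV : IsVacuumModule B S V one)
    (hY : IsFieldAction one (actLin H V) Y) {c : ℤ → V} (hc : FTrunc c) (a : H) (p l : ℤ) :
    theta Y one (fun q => act a p (c q)) l
      = shiftMode (actLin H V a) p (theta Y one c) l := by
  have hθ : FTrunc (theta Y one c) := hc.theta
  obtain ⟨K, hK⟩ := hc
  obtain ⟨N, hN⟩ : ∃ N : ℕ, K ≤ l + N := ⟨(K - l).toNat, by omega⟩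
  have h1 : theta Y one (fun q => act a p (c q)) l
      = ∑ i ∈ Finset.range N, ∑ k ∈ Finset.range (i + 1),
          bc p k • act a (p - k) (Y (c (l + i)) (-1 - ((i - k : ℕ) : ℤ)) one) := by
    rw [theta_eq_sum (K := K) (fun q hq => by rw [hK q hq]; exact smul_zero _) hN]
    refine Finset.sum_congr rfl fun i _ => ?_
    rw [hY.act_one hV, shiftMode, bin_eq_sum (N := i + 1)]
    · refine Finset.sum_congr rfl fun k hk => ?_
      have : k < i + 1 := Finset.mem_range.mp hk
      rw [zero_add, actLin_apply, show -1 - (i : ℤ) + k = -1 - ((i - k : ℕ) : ℤ) by omega]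
    · intro k hk
      rw [(hY.creation hV _).1 _ (by omega), map_zero]
  have h2 : shiftMode (actLin H V a) p (theta Y one c) l
      = ∑ k ∈ Finset.range N, ∑ i ∈ Finset.range (N - k),
          bc p k • act a (p - k) (Y (c (l + ((k + i : ℕ) : ℤ))) (-1 - (i : ℤ)) one) := by
    rw [shiftMode, bin_eq_sum (N := N)]
    · refine Finset.sum_congr rfl fun k hk => ?_
      have : k < N := Finset.mem_range.mp hk
      rw [theta_eq_sum hK (N := N - k) (by push_cast [this.le]; omega), map_sum, Finset.smul_sum]
      refine Finset.sum_congr rfl fun i _ => ?_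
      rw [zero_add, actLin_apply]
      push_cast
      rw [add_assoc]
    · intro k hk
      rw [theta_eq_sum hK (N := 0) (by simp; omega), Finset.sum_range_zero, map_zero]
  rw [h1, h2, ← Finset.sum_range_diag_flip N fun k i =>
    bc p k • act a (p - k) (Y (c (l + ((k + i : ℕ) : ℤ))) (-1 - (i : ℤ)) one)]
  refine Finset.sum_congr rfl fun i _ => Finset.sum_congr rfl fun k hk => ?_
  have : k < i + 1 := Finset.mem_range.mp hk
  rw [show k + (i - k) = i by omega]

end Theta

/-! ### Skew symmetry implies the Jacobi identity -/

section Skew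

variable {H : Type u} [AddCommGroup H] [Module ℂ H]
  {B : LinearMap.BilinForm ℂ H} {S : H ⊗[ℂ] H →ₗ[ℂ] (H ⊗[ℂ] H) ⊗[ℂ] LaurentSeries ℂ}
  {V : Type v} [AddCommGroup V] [Module ℂ V] [Module (ModeAlgebra H) V]
  [IsScalarTower ℂ (ModeAlgebra H) V] {one : V}

/-- The modes of `-e^{xD} c(-x)`, where `c(x) = ∑ c_q x^{-q-1}`. -/
def signedTheta (Y : V →ₗ[ℂ] ℤ → Module.End ℂ V) (one : V) (c : ℤ → V) : ℤ → V :=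
  theta Y one fun q => (-1 : ℂ) ^ q • c q

/-- The modes of `-e^{xD} Y(u, -x) v`. -/
def skew (Y : V →ₗ[ℂ] ℤ → Module.End ℂ V) (one u v : V) : ℤ → V :=
  signedTheta Y one fun q => Y u q v

lemma tw_neg {W : Type*} [AddCommGroup W] [Module ℂ W] (l : ℤ) (f : LaurentSeries ℂ)
    (G : ℤ → ℤ → W) (p q : ℤ) : tw l (-f) G p q = - tw l f G p q := by
  simp only [tw, HahnSeries.coeff_neg', Pi.neg_apply, neg_smul, finsum_neg_distrib]

lemma fTrunc_sign {W : Type*} [AddCommGroup W] [Module ℂ W] {c : ℤ → W} (hc : FTrunc c) :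
    FTrunc fun q => (-1 : ℂ) ^ q • c q := by
  obtain ⟨K, hK⟩ := hc
  exact ⟨K, fun q hq => by dsimp only; rw [hK q hq, smul_zero]⟩

variable {Y : V →ₗ[ℂ] VertexOperator ℂ V}

/-- The iterate term of the Jacobi identity is determined, at `n = 0`, by `skew`. -/
lemma IsFieldAction.iter_zero_right (hV : IsVacuumModule B S V one)
    (hY : IsFieldAction one (actLin H V) (modes Y)) (u v w : V) (l m : ℤ) :
    iter (fun q n => modes Y (modes Y u q v) n w) l m 0
      = (-1 : ℂ) ^ l • modes Y (skew (modes Y) one u v l) m w := by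
  rw [skew, signedTheta, hY.theta_apply hV (fTrunc_sign (hY.fTrunc u v))]
  simp only [map_smul, Pi.smul_apply, LinearMap.smul_apply]
  rfl

/-- The iterate terms for `u`, `v` and for `v'`, `u'` are related as soon as `skew` expresses
`e^{xD} Y(u, -x) v` in terms of the `Y(v', x) u'`. -/
theorem IsFieldAction.iter_eq (hV : IsVacuumModule B S V one)
    (hY : IsFieldAction one (actLin H V) (modes Y)) {u v : V} {r : ℕ} {v' u' : Fin r → V}
    {f : Fin r → LaurentSeries ℂ}
    (h : ∀ q, skew (modes Y) one u v q = ∑ j, conv (f j) (fun q => modes Y (v' j) q (u' j)) q)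
    (w : V) (l m n : ℤ) :
    iter (fun q n => modes Y (modes Y u q v) n w) l m n
      = (-1 : ℂ) ^ l • ∑ j, conv (f j)
          (fun l => iter (fun q n => modes Y (modes Y (v' j) q (u' j)) n w) l n m) l := by
  have hρ : ∀ u v, FTrunc fun q n => modes Y (modes Y u q v) n w := fun u v => by
    obtain ⟨k, hk⟩ := hY.fTrunc u v
    refine ⟨k, fun q hq => ?_⟩
    have : modes Y u q v = 0 := hk q hq
    ext n
    simp only [this, map_zero]
    rfl
  have hi : ∀ j m n, FTrunc fun l =>
      iter (fun q n => modes Y (modes Y (v' j) q (u' j)) n w) l m n := fun j m n => by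
    obtain ⟨k, hk⟩ := hρ (v' j) (u' j)
    exact ⟨k, fun l hl => iter_eq_zero hk hl m n⟩
  set N : ℤ → ℤ → ℤ → V := fun l m n => (-1 : ℂ) ^ l • ∑ j, conv (f j)
    (fun l => iter (fun q n => modes Y (modes Y (v' j) q (u' j)) n w) l n m) l with hN
  have hNB : Borcherds N := fun l m n => by
    have key : ∀ j, conv (f j)
          (fun l => iter (fun q n => modes Y (modes Y (v' j) q (u' j)) n w) l n m) (l + 1)
        = conv (f j)
            (fun l => iter (fun q n => modes Y (modes Y (v' j) q (u' j)) n w) l (n + 1) m) l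
        - conv (f j)
          (fun l => iter (fun q n => modes Y (modes Y (v' j) q (u' j)) n w) l n (m + 1)) l :=
      fun j => by
      rw [← conv_sub (hi j _ _) (hi j _ _), ← conv_shift]
      congr 1
      ext l
      exact borcherds_iter (hρ _ _) l n m
    simp only [hN]
    rw [Finset.sum_congr rfl fun j _ => key j, Finset.sum_sub_distrib, zpow_neg_one_succ]
    module
  set E := iter (fun q n => modes Y (modes Y u q v) n w) - N with hE
  have hEB : Borcherds E := (borcherds_iter (hρ u v)).sub hNB
  have hE0 : ∀ l m, E l m 0 = 0 := fun l m => by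
    have : modes Y (skew (modes Y) one u v l) m w
        = ∑ j, conv (f j) (fun q => modes Y (modes Y (v' j) q (u' j)) m w) l := by
      rw [h]
      simp only [map_sum, Finset.sum_apply, LinearMap.sum_apply]
      refine Finset.sum_congr rfl fun j _ => ?_
      let φ : V →ₗ[ℂ] V := (LinearMap.applyₗ w).comp ((LinearMap.proj m).comp (modes Y))
      exact map_conv φ (hY.fTrunc (v' j) (u' j)) (f j) l
    simp only [hE, hN, Pi.sub_apply]
    rw [hY.iter_zero_right hV, this]
    simp only [iter_zero, sub_self]
  have hEn : ∀ (k : ℕ) l m, E l m k = 0 := by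
    intro k
    induction k with
    | zero => exact_mod_cast hE0
    | succ k ih =>
      intro l m
      have := hEB l m k
      rw [ih, ih, zero_sub] at this
      push_cast
      exact neg_eq_zero.mp this.symm
  obtain ⟨L, hL⟩ : ∃ L : ℤ, ∀ l m n, L ≤ l → E l m n = 0 := by
    obtain ⟨k, hk⟩ := hρ u v
    choose k' hk' using fun j => hρ (v' j) (u' j)
    choose s hs using fun j => exists_coeff_bound (f j)
    obtain ⟨K, hK⟩ := (insert k (Finset.univ.image fun j => k' j - s j)).exists_le
    refine ⟨K, fun l m n hl => ?_⟩
    simp only [hE, hN, Pi.sub_apply]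
    have h1 : k ≤ K := hK _ (by simp)
    rw [iter_eq_zero hk (by omega), Finset.sum_eq_zero, smul_zero, sub_zero]
    intro j _
    have h2 : k' j - s j ≤ K := hK _ (by simp)
    rw [conv_eq_sum (hs j) (K := k' j) (S := s j)
      (fun q hq => iter_eq_zero (hk' j) hq _ _) (by omega), Finset.Ico_self, Finset.sum_empty]
  have hE' := hEB.eq_zero' (l₀ := L) (n₀ := 0) hL fun l m n hn => by
    obtain ⟨n, rfl⟩ := Int.eq_ofNat_of_zero_le hn
    exact hEn n l m
  exact sub_eq_zero.mp (congrFun (congrFun (congrFun hE' l) m) n)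

/-- The `S`-Jacobi identity, for an expression of `e^{xD} Y(u, -x) v` in terms of
the `Y(v', x) u'`. The defect satisfies the Borcherds recursion. It vanishes for large `m` by weak
associativity for `u`, `v`, and for large `n` by weak associativity for `v'`, `u'`. -/
theorem IsFieldAction.sJacobi (hV : IsVacuumModule B S V one)
    (hY : IsFieldAction one (actLin H V) (modes Y)) {u v : V} {r : ℕ} {v' u' : Fin r → V}
    {f : Fin r → LaurentSeries ℂ}
    (h : ∀ q, skew (modes Y) one u v q = ∑ j, conv (f j) (fun q => modes Y (v' j) q (u' j)) q) :
    SJacobi Y u v v' u' fun j => -f j := by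
  intro l m n w
  have hA := hV.isHSModule.isHSModes
  have hL : ∀ j, Lau fun p q => modes Y (v' j) p (modes Y (u' j) q w) := fun j => by
    refine lau_of_fTrunc ?_ fun q => hY.fTrunc _ _
    obtain ⟨K, hK⟩ := hY.fTrunc (u' j) w
    refine ⟨K, fun q hq p => ?_⟩
    have : modes Y (u' j) q w = 0 := hK q hq
    rw [this, map_zero]
  have hsw : ∀ j, swapCoeff l (-f j) (vmode Y (v' j)) (vmode Y (u' j)) m n w
      = - tw l (f j) (fun p q => modes Y (v' j) p (modes Y (u' j) q w)) n m := fun j => by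
    exact (swapCoeff_eq_tw l (-f j) (vmode Y (v' j)) (vmode Y (u' j)) m n w (hL j)).trans
      (tw_neg l (f j) (fun p q => modes Y (v' j) p (modes Y (u' j) q w)) n m)
  have hP : STrunc fun p q => modes Y u p (modes Y v q w) :=
    (hY.fTrunc v w).sTrunc_mode (modes Y u)
  have hρ : FTrunc fun q n => modes Y (modes Y u q v) n w := by
    obtain ⟨k, hk⟩ := hY.fTrunc u v
    refine ⟨k, fun q hq => ?_⟩
    have : modes Y u q v = 0 := hk q hq
    ext n
    simp only [this, map_zero]
    rfl
  have hR : ∀ T : Finset (Fin r), Borcherds fun l m n => (-1 : ℂ) ^ l •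
      ∑ j ∈ T, tw l (f j) (fun p q => modes Y (v' j) p (modes Y (u' j) q w)) n m := by
    intro T l m n
    simp only [tw_succ (hL _), zpow_neg_one_succ, Finset.sum_sub_distrib]
    module
  set J : ℤ → ℤ → ℤ → V := (fun l m n => bin l (fun p q => modes Y u p (modes Y v q w)) m n)
    + (fun l m n => (-1 : ℂ) ^ l • ∑ j, tw l (f j)
      (fun p q => modes Y (v' j) p (modes Y (u' j) q w)) n m)
    - iter (fun q n => modes Y (modes Y u q v) n w) with hJ
  have hJB : Borcherds J := ((borcherds_bin hP).add (hR _)).sub (borcherds_iter hρ)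
  obtain ⟨m₀, hm₀⟩ : ∃ m₀ : ℤ, ∀ l m n, m₀ ≤ m → J l m n = 0 := by
    obtain ⟨k, hk⟩ := (hY.weakAssoc hV hA hY u v w).exists_bin_eq_iter (hY.fTrunc v w)
    choose k' hk' using fun j => hY.fTrunc (u' j) w
    obtain ⟨K, hK⟩ := (insert k (Finset.univ.image k')).exists_le
    refine ⟨K, fun l m n hm => ?_⟩
    have h1 : k ≤ K := hK _ (by simp)
    simp only [hJ, Pi.add_apply, Pi.sub_apply]
    rw [hk l m n (by omega), Finset.sum_eq_zero, smul_zero, add_zero, sub_self]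
    intro j _
    have h2 : k' j ≤ K := hK _ (by simp)
    refine tw_eq_zero fun p q hq => ?_
    have : modes Y (u' j) q w = 0 := hk' j q (by omega)
    rw [this, map_zero]
  obtain ⟨n₀, hn₀⟩ : ∃ n₀ : ℤ, ∀ l m n, n₀ ≤ n → J l m n = 0 := by
    obtain ⟨k, hk⟩ := hY.fTrunc v w
    choose k' hk' using fun j =>
      (hY.weakAssoc hV hA hY (v' j) (u' j) w).exists_bin_eq_iter (hY.fTrunc (u' j) w)
    obtain ⟨K, hK⟩ := (insert k (Finset.univ.image k')).exists_le
    refine ⟨K, fun l m n hn => ?_⟩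
    have h1 : k ≤ K := hK _ (by simp)
    simp only [hJ, Pi.add_apply, Pi.sub_apply]
    rw [hY.iter_eq hV h, bin_eq_zero, zero_add, sub_eq_zero]
    · congr 1
      refine Finset.sum_congr rfl fun j _ => ?_
      have h2 : k' j ≤ K := hK _ (by simp)
      exact finsum_congr fun s => by rw [hk' j _ _ _ (by omega)]
    · intro p q hq
      have : modes Y v q w = 0 := hk q (by omega)
      rw [this, map_zero]
  have hJ0 := congrFun (congrFun (congrFun (hJB.eq_zero hm₀ hn₀) l) m) n
  simp only [hJ, Pi.add_apply, Pi.sub_apply, Pi.zero_apply] at hJ0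
  rw [Finset.sum_congr rfl fun j _ => hsw j, Finset.sum_neg_distrib, smul_neg, sub_neg_eq_add,
    prodCoeff_eq_bin]
  rw [sub_eq_zero, iter_eq_finsum] at hJ0
  exact hJ0

end Skew

/-! ### Multiplication by `y + c z` -/

section Binomial

variable {W : Type*} [AddCommGroup W] [Module ℂ W] {W' : Type*} [AddCommGroup W'] [Module ℂ W']

/-- Multiplication by `y + c z` on series `F(y, z) = ∑ F q n y^{-q-1} z^{-n-1}`. -/
def mulLin (c : ℂ) : Module.End ℂ (ℤ → ℤ → W) where
  toFun F q n := F (q + 1) n + c • F q (n + 1)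
  map_add' F G := by ext; simp only [Pi.add_apply, smul_add]; abel
  map_smul' x F := by
    ext; simp only [Pi.smul_apply, smul_add, RingHom.id_apply, smul_comm c x]

lemma mulLin_apply (c : ℂ) (F : ℤ → ℤ → W) (q n : ℤ) :
    mulLin c F q n = F (q + 1) n + c • F q (n + 1) := rfl

lemma mulLin_one : mulLin (W := W) 1 = dg := by
  ext F q n
  rw [mulLin_apply, dg_apply, one_smul]

/-- An operator on truncated series in `z` which takes multiplication by `z` to multiplication
by `ε z` takes multiplication by `y + c z` to multiplication by `y + ε c z`. -/
lemma mulLin_pow_comp {Φ : (ℤ → W) → ℤ → W'} {ε : ℂ}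
    (hadd : ∀ c c', FTrunc c → FTrunc c' → Φ (c + c') = Φ c + Φ c')
    (hsmul : ∀ (x : ℂ) c, FTrunc c → Φ (x • c) = x • Φ c)
    (hshift : ∀ c l, Φ (fun q => c (q + 1)) l = ε • Φ c (l + 1)) (c : ℂ) (n : ℕ)
    {F : ℤ → ℤ → W} (hF : ∀ p, FTrunc (F p)) :
    (mulLin (c * ε) ^ n) (fun p => Φ (F p)) = fun p => Φ ((mulLin c ^ n) F p) := by
  induction n generalizing F with
  | zero => rfl
  | succ n ih =>
    have hs : ∀ p, FTrunc (c • fun q => F p (q + 1)) := fun p => ((hF p).shift 1).smul c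
    have h1 : ∀ p, mulLin c F p = F (p + 1) + c • fun q => F p (q + 1) := fun p => rfl
    have h2 : mulLin (c * ε) (fun p => Φ (F p)) = fun p => Φ (mulLin c F p) := by
      ext p l
      rw [mulLin_apply, h1, hadd _ _ (hF _) (hs p), hsmul c _ ((hF p).shift 1)]
      simp only [Pi.add_apply, Pi.smul_apply, hshift, smul_smul]
    rw [pow_succ, pow_succ, Module.End.mul_apply, Module.End.mul_apply, h2]
    exact ih fun p => by rw [h1]; exact (hF _).add (hs p)

lemma mulLin_pow_eq_of_le (c : ℂ) {m m' : ℕ} (h : m ≤ m') {F G : ℤ → ℤ → W}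
    (e : (mulLin c ^ m) F = (mulLin c ^ m) G) : (mulLin c ^ m') F = (mulLin c ^ m') G := by
  obtain ⟨j, rfl⟩ := Nat.exists_eq_add_of_le' h
  rw [pow_add, Module.End.mul_apply, e, Module.End.mul_apply]

lemma mulLin_pow_conv (f : LaurentSeries ℂ) (c : ℂ) (n : ℕ) {F : ℤ → ℤ → W}
    (hF : ∀ p, FTrunc (F p)) :
    (mulLin c ^ n) (fun p => conv f (F p)) = fun p => conv f ((mulLin c ^ n) F p) := by
  have := mulLin_pow_comp (Φ := conv (W := W) f) (ε := 1)
    (fun c c' hc hc' => funext fun q => conv_add hc hc' f q)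
    (fun x c hc => funext fun q => conv_smul hc f x q)
    (fun c l => by rw [one_smul]; exact conv_shift f c 1 l) c n hF
  rwa [mul_one] at this

/-- Multiplication by `y - z` is injective on series which are truncated in `y`. -/
lemma eq_of_mulLin_pow_eq {n : ℕ} {F G : ℤ → ℤ → W} (hF : FTrunc F) (hG : FTrunc G)
    (hF' : ∀ p, FTrunc (F p)) (hG' : ∀ p, FTrunc (G p))
    (h : (mulLin (-1) ^ n) F = (mulLin (-1) ^ n) G) : F = G := by
  let Φ : (ℤ → W) → ℤ → W := fun c q => (-1 : ℂ) ^ q • c q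
  have key : ∀ {F : ℤ → ℤ → W}, (∀ p, FTrunc (F p)) →
      (dg ^ n) (fun p => Φ (F p)) = fun p => Φ ((mulLin (-1) ^ n) F p) := fun {F} hF => by
    have := mulLin_pow_comp (Φ := Φ) (ε := -1)
      (fun c c' _ _ => funext fun q => smul_add ((-1 : ℂ) ^ q) (c q) (c' q))
      (fun x c _ => funext fun q => smul_comm ((-1 : ℂ) ^ q) x (c q))
      (fun c l => by simp only [Φ, zpow_neg_one_succ, smul_smul]; ring_nf) (-1) n hF
    rwa [show (-1 : ℂ) * -1 = 1 by norm_num, mulLin_one] at this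
  have hΦ : ∀ {F : ℤ → ℤ → W}, FTrunc F → FTrunc fun p => Φ (F p) := fun {F} ⟨k, hk⟩ =>
    ⟨k, fun p hp => by ext q; simp [Φ, hk p hp]⟩
  have := eq_of_dg_pow_eq (hΦ hF) (hΦ hG) (by rw [key hF', key hG', h])
  ext p q
  have h1 : (-1 : ℂ) ^ q • F p q = (-1 : ℂ) ^ q • G p q := congrFun (congrFun this p) q
  exact smul_right_injective W (zpow_ne_zero q (by norm_num : (-1 : ℂ) ≠ 0)) h1

lemma mulLin_neg_one_bin {G : ℤ → ℤ → W} (hG : STrunc G) (s : ℤ) (n : ℕ) :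
    (mulLin (-1) ^ n) (bin s G) = bin (s + n) G := by
  induction n with
  | zero => simp
  | succ n ih =>
    rw [pow_succ', Module.End.mul_apply, ih]
    ext p q
    rw [mulLin_apply, Nat.cast_succ, ← add_assoc, bin_succ hG, neg_one_smul, sub_eq_add_neg]

lemma mulLin_neg_one_tw {G : ℤ → ℤ → W} (hG : Lau G) (f : LaurentSeries ℂ) (l : ℤ) (n : ℕ) :
    (mulLin (-1) ^ n) (tw l f G) = tw (l + n) f G := by
  induction n with
  | zero => simp
  | succ n ih =>
    rw [pow_succ', Module.End.mul_apply, ih]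
    ext p q
    rw [mulLin_apply, Nat.cast_succ, ← add_assoc, tw_succ hG, neg_one_smul, sub_eq_add_neg]

/-- Multiplication by `y - z`, for a series which is expanded in nonnegative powers of the
first variable. -/
lemma mulLin_neg_one_tw_swap {G : ℤ → ℤ → W} (hG : Lau G) (f : LaurentSeries ℂ) (l : ℤ) (n : ℕ)
    (p q : ℤ) :
    (mulLin (-1) ^ n) (fun p q => tw l f G q p) p q = (-1 : ℂ) ^ n • tw (l + n) f G q p := by
  induction n generalizing p q with
  | zero => simp
  | succ n ih =>
    rw [pow_succ', Module.End.mul_apply, mulLin_apply, ih, ih, Nat.cast_succ, ← add_assoc,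
      tw_succ hG]
    module

end Binomial

section InSpan

variable {V : Type*} [AddCommGroup V] [Module ℂ V] {Y : V →ₗ[ℂ] VertexOperator ℂ V}

lemma InSpan.fTrunc {c : ℤ → V} (h : InSpan Y c) : FTrunc c := by
  obtain ⟨r, v, u, f, e⟩ := h.exists_rep
  rw [show c = fun q => ∑ j, QVA.conv (f j) (fun q => modes Y (v j) q (u j)) q from funext e]
  exact FTrunc.sum _ fun j _ => (fTrunc_modes Y (v j) (u j)).conv (f j)

/-- Division by a power of `y + z`. -/
lemma InSpan.of_dg_pow (m : ℕ) {F : ℤ → ℤ → V} (hF : FTrunc F)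
    (h : ∀ q, InSpan Y ((dg ^ m) F q)) : ∀ q, InSpan Y (F q) := by
  induction m generalizing F with
  | zero => simpa using h
  | succ m ih =>
    have h1 : ∀ q, InSpan Y (dg F q) := by
      refine ih ?_ fun q => ?_
      · exact hF.dg_pow 1
      · rw [← Module.End.mul_apply, ← pow_succ]; exact h q
    obtain ⟨K, hK⟩ := hF
    have h2 : ∀ j : ℕ, ∀ q, K - j ≤ q → InSpan Y (F q) := by
      intro j
      induction j with
      | zero => intro q hq; rw [hK q (by simpa using hq)]; exact InSpan.zero
      | succ j ihj =>
        intro q hj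
        have := ((h1 q).add ((ihj (q + 1) (by push_cast at hj; omega)).smul (-1))).shift (-1)
        convert this using 2 with n
        simp [dg_apply]
    intro q
    exact h2 (K - q).toNat q (by omega)

/-- Multiplication by `f(x - y)`, one coefficient in `y` at a time. -/
lemma InSpan.tw {G : ℤ → ℤ → V} (hG : Lau G) (h : ∀ q, InSpan Y fun p => G p q) (l : ℤ)
    (f : LaurentSeries ℂ) (q : ℤ) : InSpan Y fun p => tw l f G p q := by
  obtain ⟨K, hK⟩ := hG.1
  obtain ⟨N, hN⟩ : ∃ N : ℕ, K ≤ q + N := ⟨(K - q).toNat, by omega⟩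
  simp only [tw_eq_sum_sum hG (fun p q' (hq' : q + N ≤ q') => hK p q' (by omega))]
  refine InSpan.sum _ fun i _ => ?_
  obtain ⟨s₀, h₀⟩ := exists_coeff_bound f
  let φ : ℤ → ℂ := fun t => bc (t + i) i * f.coeff (t + i - l)
  let g : LaurentSeries ℂ := HahnSeries.ofSuppBddBelow φ ⟨s₀ + l - i, fun t ht => by
    by_contra hc
    exact ht (by simp only [φ]; rw [h₀ _ (by omega), mul_zero])⟩
  have hg : ∀ t, g.coeff t = φ t := fun _ => rfl
  convert (h (q + i)).conv g using 1
  ext p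
  rw [QVA.conv, ← finsum_comp_equiv (Equiv.addRight ((i : ℤ) - l))]
  refine finsum_congr fun s => ?_
  simp only [Equiv.coe_addRight, hg, φ]
  rw [show l + (s + ((i : ℤ) - l)) = s + i by ring, show s + ((i : ℤ) - l) = s + i - l by ring,
    show p + l + (s + i - l) - (i : ℤ) = p + s by ring]

end InSpan

/-! ### Skew symmetry -/

section SkewSpan

variable {H : Type u} [AddCommGroup H] [Module ℂ H]
  {B : LinearMap.BilinForm ℂ H} {S : H ⊗[ℂ] H →ₗ[ℂ] (H ⊗[ℂ] H) ⊗[ℂ] LaurentSeries ℂ}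
  {V : Type v} [AddCommGroup V] [Module ℂ V] [Module (ModeAlgebra H) V]
  [IsScalarTower ℂ (ModeAlgebra H) V] {one : V} {Y : V →ₗ[ℂ] VertexOperator ℂ V}

lemma signedTheta_add {Y : V →ₗ[ℂ] ℤ → Module.End ℂ V} {c c' : ℤ → V} (hc : FTrunc c)
    (hc' : FTrunc c') :
    signedTheta Y one (c + c') = signedTheta Y one c + signedTheta Y one c' := by
  ext l
  simp only [signedTheta, Pi.add_apply, smul_add]
  exact theta_add (fTrunc_sign hc) (fTrunc_sign hc') l

lemma signedTheta_smul {Y : V →ₗ[ℂ] ℤ → Module.End ℂ V} (x : ℂ) (c : ℤ → V) :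
    signedTheta Y one (x • c) = x • signedTheta Y one c := by
  ext l
  simp only [signedTheta, Pi.smul_apply, smul_comm _ x]
  exact theta_smul _ x l

lemma signedTheta_shift {Y : V →ₗ[ℂ] ℤ → Module.End ℂ V} (c : ℤ → V) (l : ℤ) :
    signedTheta Y one (fun q => c (q + 1)) l = (-1 : ℂ) • signedTheta Y one c (l + 1) := by
  rw [signedTheta, signedTheta, ← theta_shift, ← theta_smul]
  congr 1
  ext q
  rw [zpow_neg_one_succ, smul_smul]
  congr 1
  ring

lemma mulLin_pow_signedTheta {Y : V →ₗ[ℂ] ℤ → Module.End ℂ V} (c : ℂ) (n : ℕ) {F : ℤ → ℤ → V}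
    (hF : ∀ p, FTrunc (F p)) : (mulLin (-c) ^ n) (fun p => signedTheta Y one (F p))
      = fun p => signedTheta Y one ((mulLin c ^ n) F p) := by
  have := mulLin_pow_comp (Φ := signedTheta Y one) (ε := -1) (fun c c' => signedTheta_add)
    (fun x c _ => signedTheta_smul x c) signedTheta_shift c n hF
  rwa [mul_neg_one] at this

lemma signedTheta_sum {Y : V →ₗ[ℂ] ℤ → Module.End ℂ V} {ι : Type*} (T : Finset ι) {c : ι → ℤ → V}
    (h : ∀ i ∈ T, FTrunc (c i)) (l : ℤ) :
    signedTheta Y one (fun q => ∑ i ∈ T, c i q) l = ∑ i ∈ T, signedTheta Y one (c i) l := by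
  simp only [signedTheta, Finset.smul_sum]
  exact theta_sum T (fun i hi => fTrunc_sign (h i hi)) l

lemma signedTheta_congr {Y : V →ₗ[ℂ] ℤ → Module.End ℂ V} {c c' : ℤ → V} {l : ℤ}
    (h : ∀ q, l ≤ q → c q = c' q) : signedTheta Y one c l = signedTheta Y one c' l :=
  theta_congr fun q hq => by rw [h q hq]

lemma FTrunc.signedTheta {Y : V →ₗ[ℂ] ℤ → Module.End ℂ V} {F : ℤ → ℤ → V} (hF : FTrunc F) :
    FTrunc fun p => QVA.signedTheta Y one (F p) := by
  obtain ⟨k, hk⟩ := hF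
  refine ⟨k, fun p hp => ?_⟩
  ext l
  simp [hk p hp, QVA.signedTheta, QVA.theta]

lemma signedTheta_act (hV : IsVacuumModule B S V one)
    (hY : IsFieldAction one (actLin H V) (modes Y)) {c : ℤ → V} (hc : FTrunc c) (a : H) (p l : ℤ) :
    signedTheta (modes Y) one (fun q => act a p (c q)) l
      = shiftMode (actLin H V a) p (signedTheta (modes Y) one c) l := by
  rw [signedTheta, signedTheta, ← hY.theta_act hV (fTrunc_sign hc)]
  congr 1
  ext q
  exact ((actLin H V a p).map_smul _ _).symm

/-- `e^{xD} a(y - x) c(-x) = a(y) e^{xD} c(-x)`. -/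
lemma signedTheta_shiftMode (hV : IsVacuumModule B S V one)
    (hY : IsFieldAction one (actLin H V) (modes Y)) {c : ℤ → V} (hc : FTrunc c) (a : H) (p l : ℤ) :
    signedTheta (modes Y) one (shiftMode (actLin H V a) p c) l
      = act a p (signedTheta (modes Y) one c l) := by
  set G : ℤ → ℤ → V := fun p q => actLin H V a p (c q) with hG
  set K : ℤ → ℤ → V := fun p q => actLin H V a p (signedTheta (modes Y) one c q) with hK
  have hθ : FTrunc (signedTheta (modes Y) one c) := (fTrunc_sign hc).theta
  have hGt : STrunc G := hc.sTrunc_mode _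
  have hKt : STrunc K := hθ.sTrunc_mode _
  have hGf : ∀ s p, FTrunc (bin s G p) := fun s p => by
    obtain ⟨k, hk⟩ := hGt.bin s
    exact ⟨k, fun q hq => hk p q hq⟩
  set E : ℤ → ℤ → ℤ → V := fun m p l => signedTheta (modes Y) one (bin p G m) l with hE
  have h1 : Borcherds E := fun m p l => by
    have e : bin (p + 1) G m = bin p G (m + 1) + (-1 : ℂ) • fun q => bin p G m (q + 1) := by
      ext q
      simp only [bin_succ hGt, Pi.add_apply, Pi.smul_apply]
      module
    simp only [hE]
    rw [e, signedTheta_add (hGf _ _) (((hGf _ _).shift 1).smul _), signedTheta_smul]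
    simp only [Pi.add_apply, Pi.smul_apply, signedTheta_shift]
    module
  have h2 := h1.sub (borcherds_bin hKt)
  obtain ⟨k, hk⟩ := hc
  have h3 := h2.eq_zero (m₀ := 0) (n₀ := k) ?_ ?_
  · have := congrFun (congrFun (congrFun h3 0) p) l
    simp only [Pi.sub_apply, bin_zero, Pi.zero_apply, sub_eq_zero] at this
    exact this
  · intro m p l hp
    obtain ⟨p, rfl⟩ := Int.eq_ofNat_of_zero_le hp
    induction p generalizing m l with
    | zero =>
      simp only [Pi.sub_apply, hE, sub_eq_zero]
      have : bin (0 : ℕ) G m = G m := by ext q; simp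
      rw [this]
      exact signedTheta_act hV hY ⟨k, hk⟩ a m l
    | succ p ih =>
      have := h2 m p l
      rw [ih _ _ (by omega), ih _ _ (by omega), sub_zero] at this
      exact_mod_cast this.symm
  · intro m p l hl
    have hθk : ∀ q, k ≤ q → signedTheta (modes Y) one c q = 0 := fun q hq => by
      rw [signedTheta, theta_eq_sum (K := k) (N := 0) (fun q hq => by rw [hk q hq, smul_zero])
        (by simpa using hq), Finset.sum_range_zero]
    simp only [Pi.sub_apply, hE, sub_eq_zero]
    rw [signedTheta_congr (c' := fun _ => 0) fun q hq => bin_eq_zero fun p' q' hq' => by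
      simp only [hG]; rw [hk q' (by omega), map_zero]]
    rw [bin_eq_zero fun p' q' hq' => by simp only [hK]; rw [hθk q' (by omega), map_zero]]
    simp [signedTheta, theta]

lemma bc_choose (M i : ℕ) (h : i ≤ M) : bc (-1 - i) (M - i) = (M.choose i : ℂ) := by
  rw [bc_eq_choose, show ((M - i : ℕ) : ℤ) - (-1 - i) - 1 = M by omega, Ring.choose_natCast,
    Nat.choose_symm h]
  simp

/-- `e^{xD} Y(u, -x) one = u`, in terms of `Y(one, x) u = u`. -/
lemma skew_one_right (hV : IsVacuumModule B S V one)
    (hY : IsFieldAction one (actLin H V) (modes Y)) (u : V) (l : ℤ) :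
    skew (modes Y) one u one l = (-1 : ℂ) • modes Y one l u := by
  have h0 := (hY.creation hV u).1
  have hz : ∀ q : ℤ, 0 ≤ q → (-1 : ℂ) ^ q • modes Y u q one = 0 := fun q hq => by
    rw [h0 q hq, smul_zero]
  rw [hY.one_apply, skew, signedTheta, constSeries]
  by_cases hl : 0 ≤ l
  · rw [theta_eq_sum hz (N := 0) (by simpa using hl), if_neg (by omega)]
    simp
  · obtain ⟨M, rfl⟩ : ∃ M : ℕ, l = -1 - M := ⟨(-1 - l).toNat, by omega⟩
    rw [theta_eq_sum hz (N := M + 1) (by push_cast; omega)]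
    have : ∀ i ∈ Finset.range (M + 1),
        modes Y ((-1 : ℂ) ^ (-1 - (M : ℤ) + i) • modes Y u (-1 - (M : ℤ) + i) one) (-1 - i) one
        = (((-1 : ℤ) ^ i * (M.choose i : ℤ) : ℤ) : ℂ) •
          ((-1 : ℂ) ^ (-1 - (M : ℤ)) • modes Y u (-1 - (M : ℤ)) one) := fun i hi => by
      have hi' : i ≤ M := Nat.lt_succ_iff.mp (Finset.mem_range.mp hi)
      rw [map_smul, Pi.smul_apply, LinearMap.smul_apply,
        show -1 - (M : ℤ) + i = -1 - ((M - i : ℕ) : ℤ) by omega, hY.mode_one hV,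
        bc_choose M i hi', show -1 - ((M - i : ℕ) : ℤ) = -1 - (M : ℤ) + i by omega,
        zpow_neg_one_add_natCast, smul_smul, smul_smul,
        show -1 - (i : ℤ) - ((M - i : ℕ) : ℤ) = -1 - (M : ℤ) by omega]
      push_cast
      congr 1
      ring
    rw [Finset.sum_congr rfl this, ← Finset.sum_smul, ← Int.cast_sum,
      Int.alternating_sum_range_choose]
    by_cases hM : M = 0
    · subst hM
      simp [(hY.creation hV u).2]
    · rw [if_neg hM, if_neg (by omega)]
      simp

/-- `e^{xD} Y(one, -x) v = Y(v, x) one`. -/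
lemma skew_one_left (hV : IsVacuumModule B S V one)
    (hY : IsFieldAction one (actLin H V) (modes Y)) (v : V) (l : ℤ) :
    skew (modes Y) one one v l = (-1 : ℂ) • modes Y v l one := by
  have e : ∀ q : ℤ, (-1 : ℂ) ^ q • modes Y one q v = if q = -1 then (-1 : ℂ) • v else 0 := by
    intro q
    rw [hY.one_apply, constSeries]
    split_ifs with h
    · simp [h]
    · rw [smul_zero]
  simp only [skew, signedTheta, e]
  by_cases hl : 0 ≤ l
  · rw [(hY.creation hV v).1 l hl, theta_eq_sum (K := 0) (N := 0) (fun q hq => if_neg (by omega))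
      (by simpa using hl)]
    simp
  · rw [theta, finsum_eq_single _ (-1 - l).toNat fun i hi => by rw [if_neg (by omega)]; simp,
      if_pos (by omega), show -1 - ((-1 - l).toNat : ℤ) = l by omega]
    simp

lemma skew_add_left (hY : IsFieldAction one (actLin H V) (modes Y)) (u u' v : V) (l : ℤ) :
    skew (modes Y) one (u + u') v l = skew (modes Y) one u v l + skew (modes Y) one u' v l := by
  rw [skew, map_add]
  exact congrFun (signedTheta_add (hY.fTrunc u v) (hY.fTrunc u' v)) l

lemma skew_add_right (hY : IsFieldAction one (actLin H V) (modes Y)) (u v v' : V) (l : ℤ) :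
    skew (modes Y) one u (v + v') l = skew (modes Y) one u v l + skew (modes Y) one u v' l := by
  simp only [skew, map_add]
  exact congrFun (signedTheta_add (hY.fTrunc u v) (hY.fTrunc u v')) l

lemma skew_smul_left (u v : V) (x : ℂ) (l : ℤ) :
    skew (modes Y) one (x • u) v l = x • skew (modes Y) one u v l := by
  rw [skew, map_smul]
  exact congrFun (signedTheta_smul x _) l

lemma skew_smul_right (u v : V) (x : ℂ) (l : ℤ) :
    skew (modes Y) one u (x • v) l = x • skew (modes Y) one u v l := by
  simp only [skew, map_smul]
  exact congrFun (signedTheta_smul x _) l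

/-- Each series in the span is a sum of series `f(x) Y(v, x) u`. -/
lemma InSpan.induction {P : (ℤ → V) → Prop}
    (hadd : ∀ c c', FTrunc c → FTrunc c' → P c → P c' → P (c + c'))
    (hconv : ∀ f v u, P (QVA.conv f fun q => modes Y v q u)) {c : ℤ → V} (h : InSpan Y c) :
    P c := by
  obtain ⟨r, v, u, f, e⟩ := h.exists_rep
  have ht : ∀ j, FTrunc (QVA.conv (f j) fun q => modes Y (v j) q (u j)) := fun j =>
    (fTrunc_modes Y (v j) (u j)).conv (f j)
  have : ∀ T : Finset (Fin r),
      P fun q => ∑ j ∈ T, QVA.conv (f j) (fun q => modes Y (v j) q (u j)) q := by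
    intro T
    induction T using Finset.induction_on with
    | empty =>
      convert hconv 0 0 0 using 1
      ext q
      simp [QVA.conv]
    | insert i T hi ih =>
      simp only [Finset.sum_insert hi]
      exact hadd _ _ (ht i) (FTrunc.sum T fun j _ => ht j) (hconv _ _ _) ih
  convert this Finset.univ using 1
  exact funext e

lemma shiftMode_conv (a : ℤ → Module.End ℂ V) {c : ℤ → V} (hc : FTrunc c) (f : LaurentSeries ℂ)
    (p : ℤ) : shiftMode a p (conv f c) = conv f (shiftMode a p c) := by
  have hf : FTrunc (conv f c) := hc.conv f
  obtain ⟨K, hK⟩ := hc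
  obtain ⟨K', hK'⟩ := hf
  obtain ⟨s₀, h₀⟩ := exists_coeff_bound f
  ext n
  obtain ⟨N, hN, hN'⟩ : ∃ N : ℕ, K ≤ n + s₀ + N ∧ K' ≤ n + N :=
    ⟨(max (K - n - s₀) (K' - n)).toNat, by omega, by omega⟩
  have hb : ∀ q, K ≤ q → shiftMode a p c q = 0 := fun q hq =>
    bin_eq_zero fun p' q' h => by rw [hK q' (by omega), map_zero]
  rw [conv_eq_sum h₀ hb (S := K - n) (by omega), shiftMode,
    bin_eq_sum_of_le (K := K') (N := N) (fun p q hq => by rw [hK' q hq, map_zero]) hN']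
  have h1 : ∀ i ∈ Finset.range N, bc p i • a (0 + p - i) (conv f c (n + i))
      = ∑ s ∈ Finset.Ico s₀ (K - n), f.coeff s • bc p i • a (0 + p - i) (c (n + s + i)) := by
    intro i _
    rw [conv_eq_sum h₀ hK (S := K - n) (by omega), map_sum, Finset.smul_sum]
    refine Finset.sum_congr rfl fun s _ => ?_
    rw [map_smul, smul_comm, add_right_comm]
  rw [Finset.sum_congr rfl h1, Finset.sum_comm]
  refine Finset.sum_congr rfl fun s hs => ?_
  rw [shiftMode, bin_eq_sum_of_le (K := K) (N := N) (fun p q hq => by rw [hK q hq, map_zero])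
    (by have := (Finset.mem_Ico.mp hs).1; omega), Finset.smul_sum]

/-- The span of the `Y(v, x) u` is stable under `a(y + x)`, after re-expansion. -/
lemma InSpan.exists_isReexp (hY : IsFieldAction one (actLin H V) (modes Y)) (a : H) {c : ℤ → V}
    (h : InSpan Y c) : ∃ T : ℤ → ℤ → V,
      IsReexp (fun p => shiftMode (actLin H V a) p c) T ∧ ∀ p, InSpan Y (T p) := by
  refine InSpan.induction (P := fun c => ∃ T : ℤ → ℤ → V,
    IsReexp (fun p => shiftMode (actLin H V a) p c) T ∧ ∀ p, InSpan Y (T p)) ?_ ?_ h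
  · intro c c' hc hc' h h'
    obtain ⟨T, hT, hI⟩ := h
    obtain ⟨T', hT', hI'⟩ := h'
    refine ⟨T + T', ?_, fun p => (hI p).add (hI' p)⟩
    have := hT.add hT'
    convert this using 2 with p
    exact shiftMode_add _ p hc hc'
  · intro f v u
    obtain ⟨hT, m, hm⟩ := hY.reexp a v u
    have hr := (hY.reexp a v u).fTrunc_apply (hY.fTrunc v u)
    refine ⟨fun p => QVA.conv f fun q => modes Y (act a p v) q u, ⟨?_, m, ?_⟩, fun p =>
      (inSpan_modes _ _).conv f⟩
    · obtain ⟨k, hk⟩ := hT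
      refine ⟨k, fun p hp => funext fun q => finsum_eq_zero_of_forall_eq_zero fun s => ?_⟩
      have : modes Y (act a p v) (q + s) u = 0 := congrFun (hk p hp) (q + s)
      dsimp only
      rw [this, smul_zero]
    · simp only [shiftMode_conv _ (hY.fTrunc v u)]
      rw [← mulLin_one] at hm ⊢
      rw [mulLin_pow_conv f 1 m hr, mulLin_pow_conv f 1 m fun p => (hY.fTrunc v u).shiftMode _ p,
          hm]

lemma lau_modes (v u w : V) : Lau fun p q => modes Y v p (modes Y u q w) := by
  refine lau_of_fTrunc ?_ fun q => fTrunc_modes Y _ _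
  obtain ⟨K, hK⟩ := fTrunc_modes Y u w
  refine ⟨K, fun q hq p => ?_⟩
  have : modes Y u q w = 0 := hK q hq
  rw [this, map_zero]

/-- The span of the `Y(v, x) u` is stable under `a(y)`, up to a power of `y - x` and
after re-expansion, if skew symmetry holds for `a(x)` and every `Y(v, x)`. -/
lemma InSpan.exists_mulLin_pow_eq (hV : IsVacuumModule B S V one)
    (hY : IsFieldAction one (actLin H V) (modes Y)) (a : H)
    (ha : ∀ v, InSpan Y (skew (modes Y) one (act a (-1) one) v)) {c : ℤ → V}
    (h : InSpan Y c) : ∃ T : ℤ → ℤ → V, FTrunc T ∧ (∀ p, InSpan Y (T p)) ∧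
      ∃ k : ℕ, (mulLin (-1) ^ k) (fun p q => act a p (c q)) = (mulLin (-1) ^ k) T := by
  have hA := hV.isHSModule.isHSModes
  refine InSpan.induction (P := fun c => ∃ T : ℤ → ℤ → V, FTrunc T ∧ (∀ p, InSpan Y (T p)) ∧
    ∃ k : ℕ, (mulLin (-1) ^ k) (fun p q => act a p (c q)) = (mulLin (-1) ^ k) T) ?_ ?_ h
  · intro c c' hc hc' h h'
    obtain ⟨T, hT, hI, k, hk⟩ := h
    obtain ⟨T', hT', hI', k', hk'⟩ := h'
    refine ⟨T + T', hT.add hT', fun p => (hI p).add (hI' p), max k k', ?_⟩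
    have e : (fun p q => act a p ((c + c') q))
        = (fun p q => act a p (c q)) + fun p q => act a p (c' q) := by
      ext p q
      exact (actLin H V a p).map_add _ _
    rw [e, map_add, map_add, mulLin_pow_eq_of_le _ (le_max_left k k') hk,
      mulLin_pow_eq_of_le _ (le_max_right k k') hk']
  · intro f v w
    obtain ⟨r, v', u', g, hg⟩ := (ha v).exists_rep
    have hJ := hY.sJacobi hV hg
    set G : Fin r → ℤ → ℤ → V := fun j p q => modes Y (v' j) p (modes Y (u' j) q w) with hG
    have hL : ∀ j, Lau (G j) := fun j => lau_modes _ _ _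
    let T : ℤ → ℤ → V := fun p q => ∑ j, QVA.tw 0 (-g j) (G j) q p
    have hTI : ∀ p, InSpan Y (T p) := fun p =>
      InSpan.sum _ fun j _ => InSpan.tw (hL j) (fun q => inSpan_modes _ _) 0 (-g j) p
    have hTt : ∃ K, ∀ p, K ≤ p → T p = 0 := by
      choose k hk using fun j => fTrunc_modes Y (u' j) w
      obtain ⟨K, hK⟩ := (Finset.univ.image k).exists_le
      refine ⟨K, fun p hp => funext fun q => Finset.sum_eq_zero fun j _ => ?_⟩
      refine tw_eq_zero fun p' q' hq' => ?_
      have h1 : k j ≤ K := hK _ (by simp)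
      have h2 : modes Y (u' j) q' w = 0 := hk j q' (by omega)
      simp only [hG, h2, map_zero]
    have hs : STrunc fun p q => act a p (modes Y v q w) :=
      (fTrunc_modes Y v w).sTrunc_mode (actLin H V a)
    obtain ⟨k, hk⟩ : ∃ k : ℕ, (mulLin (-1) ^ k) (fun p q => act a p (modes Y v q w))
        = (mulLin (-1) ^ k) T := by
      obtain ⟨k, hk⟩ := fTrunc_modes Y (act a (-1) one) v
      refine ⟨k.toNat, ?_⟩
      have e0 : (fun p q => act a p (modes Y v q w))
          = bin 0 fun p q => act a p (modes Y v q w) := by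
        ext p q
        rw [bin_zero]
      have eT : T = ∑ j, fun p q => QVA.tw 0 (-g j) (G j) q p := by
        ext p q
        simp only [T, Finset.sum_apply]
      rw [e0, mulLin_neg_one_bin hs, eT, map_sum]
      ext m n
      have h1 := hJ k.toNat m n w
      rw [finsum_eq_zero_of_forall_eq_zero, sub_eq_zero, prodCoeff_eq_bin] at h1
      · simp only [Finset.sum_apply, mulLin_neg_one_tw_swap (hL _), zero_add, ← Finset.smul_sum]
        simp only [vmode_eq_modes, hY.act_neg_one hA] at h1
        refine h1.trans ?_
        rw [zpow_natCast]
        congr 1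
        exact Finset.sum_congr rfl fun j _ => swapCoeff_eq_tw _ _ _ _ _ _ _ (hL j)
      · intro i
        have : modes Y (act a (-1) one) (k.toNat + i) v = 0 := hk _ (by omega)
        rw [vmode_eq_modes, vmode_eq_modes, this]
        simp
    refine ⟨fun p => QVA.conv f (T p), ?_, fun p => (hTI p).conv f, k, ?_⟩
    · obtain ⟨K, hK⟩ := hTt
      exact ⟨K, fun p hp => by ext q; simp [hK p hp, QVA.conv]⟩
    · have e : (fun p q => act a p (QVA.conv f (fun q => modes Y v q w) q))
          = fun p => QVA.conv f fun q => act a p (modes Y v q w) := by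
        ext p q
        exact map_conv (actLin H V a p) (fTrunc_modes Y v w) f q
      rw [e, mulLin_pow_conv f _ _ fun p => (hTI p).fTrunc, ← hk, mulLin_pow_conv f]
      intro p
      obtain ⟨K, hK⟩ := hs
      exact ⟨K, fun q hq => hK p q hq⟩

lemma FTrunc.signedTheta_apply {Y : V →ₗ[ℂ] ℤ → Module.End ℂ V} {c : ℤ → V} (hc : FTrunc c) :
    FTrunc (QVA.signedTheta Y one c) := (fTrunc_sign hc).theta

/-- If `e^{xD} Y(u, -x) v` lies in the span of the `Y(v', x) u'`, then so does
`e^{xD} Y(a_p u, -x) v`. -/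
lemma inSpan_skew_act (hV : IsVacuumModule B S V one)
    (hY : IsFieldAction one (actLin H V) (modes Y)) {a : H}
    (ha : ∀ v, InSpan Y (skew (modes Y) one (act a (-1) one) v)) {u v : V}
    (hu : InSpan Y (skew (modes Y) one u v)) (p : ℤ) :
    InSpan Y (skew (modes Y) one (act a p u) v) := by
  obtain ⟨T, hT, hTI, k, hk⟩ := hu.exists_mulLin_pow_eq hV hY a ha
  have hre := hY.reexp a u v
  have hF := hre.fTrunc_apply (hY.fTrunc u v)
  obtain ⟨hF', m, hm⟩ := hre
  have h1 : (mulLin (-1) ^ m) (fun p => signedTheta (modes Y) one fun q => modes Y (act a p u) q v)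
      = (mulLin (-1) ^ m) fun p q => act a p (skew (modes Y) one u v q) := by
    rw [← mulLin_one] at hm
    rw [mulLin_pow_signedTheta 1 m hF, hm, ← mulLin_pow_signedTheta 1 m fun p =>
      (hY.fTrunc u v).shiftMode _ p]
    congr 1
    ext p l
    exact signedTheta_shiftMode hV hY (hY.fTrunc u v) a p l
  have h2 := eq_of_mulLin_pow_eq (n := max m k) (FTrunc.signedTheta (Y := modes Y) (one := one)
      hF') hT
    (fun p => (hF p).signedTheta_apply) (fun p => (hTI p).fTrunc)
    ((mulLin_pow_eq_of_le _ (le_max_left m k) h1).trans (mulLin_pow_eq_of_le _ (le_max_right m k)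
        hk))
  have := hTI p
  rw [← h2] at this
  exact this

/-- Pulling `f(y - x)` out of `e^{xD}` after the substitution `x ↦ -x`, up to a power
of `y + x`. -/
lemma signedTheta_tw {Y : V →ₗ[ℂ] ℤ → Module.End ℂ V} {G T : ℤ → ℤ → V} (hG : Lau G)
    (hT : FTrunc T) (hT' : ∀ p, FTrunc (T p)) {m : ℕ}
    (hm : (dg ^ m) T = (dg ^ m) fun p => signedTheta Y one (G p)) {f : LaurentSeries ℂ} {s₀ : ℤ}
    (h₀ : ∀ s, s < s₀ → f.coeff s = 0) {M : ℕ} (hM : m ≤ M + s₀) (p l : ℤ) :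
    signedTheta Y one (tw M f G p) l
      = (-1 : ℂ) ^ p • tw M f (fun l p => (-1 : ℂ) ^ p • T p l) l p := by
  have hG' : ∀ s p, FTrunc (bin s G p) := fun s p => by
    obtain ⟨k, hk⟩ := hG.1.bin s
    exact ⟨k, fun q hq => hk p q hq⟩
  have hL : Lau fun l p => (-1 : ℂ) ^ p • T p l := by
    obtain ⟨k, hk⟩ := hT
    exact lau_of_fTrunc ⟨k, fun q hq l => by rw [hk q hq]; exact smul_zero _⟩
      fun q => (hT' q).smul _
  obtain ⟨P, hP⟩ := hG.tw_eq_sum l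
  obtain ⟨P', hP'⟩ := hL.tw_eq_sum p
  obtain ⟨S, hS, hS'⟩ : ∃ S, P ≤ p + M + S ∧ P' ≤ l + M + S :=
    ⟨max (P - p - M) (P' - l - M), by omega, by omega⟩
  rw [hP' f s₀ M l p S h₀ le_rfl hS', Finset.smul_sum, signedTheta_congr fun q hq =>
    hP f s₀ M p q S h₀ hq hS, signedTheta_sum (c := fun s q => f.coeff s • bin (M + s) G p q) _
      fun s _ => (hG' _ p).smul (f.coeff s)]
  refine Finset.sum_congr rfl fun s hs => ?_
  obtain ⟨N, hN⟩ : ∃ N : ℕ, (M : ℤ) + s = N :=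
    ⟨(M + s).toNat, by have := (Finset.mem_Ico.mp hs).1; omega⟩
  have hmN : m ≤ N := by have := (Finset.mem_Ico.mp hs).1; omega
  have e0 : bin 0 G = G := by ext p q; simp
  have e1 : signedTheta Y one (bin N G p) l = (dg ^ N) T p l := by
    have := mulLin_neg_one_bin hG.1 0 N
    rw [e0, zero_add] at this
    rw [dg_pow_eq_of_le hmN hm, ← this, ← mulLin_one, ← neg_neg (1 : ℂ),
      mulLin_pow_signedTheta (-1) N fun p => by rw [← e0]; exact hG' 0 p, neg_neg]
  have e2 := iter_natCast hT N p l
  rw [iter] at e2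
  change signedTheta Y one (f.coeff s • bin (M + s) G p) l = _
  rw [signedTheta_smul, hN, Pi.smul_apply, e1, smul_comm, e2]

/-- Skew symmetry for `a(x)` and `Y(v, x)`, by induction on `v`. The `S`-relation moves `a` past
the leftmost factor of `v = c_p x`, and the factors `f(y - x)` in it pass through `e^{xD}`. -/
lemma inSpan_skew_act_neg_one (hV : IsVacuumModule B S V one)
    (hY : IsFieldAction one (actLin H V) (modes Y)) (v : V) :
    ∀ a : H, InSpan Y (skew (modes Y) one (act a (-1) one) v) := by
  have hA := hV.isHSModule.isHSModes
  induction v using hV.induction with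
  | h0 =>
    intro a
    have := (inSpan_modes (Y := Y) 0 0).smul 0
    convert this using 1
    ext l
    rw [← zero_smul ℂ (0 : V), skew_smul_right]
    simp
  | hadd x y hx hy =>
    intro a
    convert (hx a).add (hy a) using 1
    exact funext fun l => skew_add_right hY _ _ _ l
  | hsmul c x hx =>
    intro a
    convert (hx a).smul c using 1
    exact funext fun l => skew_smul_right _ _ _ l
  | hone =>
    intro a
    convert (inSpan_modes (Y := Y) one (act a (-1) one)).smul (-1) using 1
    exact funext fun l => skew_one_right hV hY _ l
  | hact c p x ih =>
    intro a
    have hact : ∀ (a : H) (x : V), skew (modes Y) one (act a (-1) one) x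
        = signedTheta (modes Y) one fun q => act a q x := fun a x => by
      ext l
      simp only [skew, hY.act_neg_one hA]
      rfl
    rw [hact]
    let F : ℤ → ℤ → V := fun p q => act a q (act c p x)
    suffices ∀ p, InSpan Y (signedTheta (modes Y) one (F p)) from this p
    obtain ⟨r, c', a', f, hS⟩ := exists_tensor_rep (S (c ⊗ₜ[ℂ] a))
    have hFt : ∀ p, FTrunc (F p) := fun p => hV.isHSModule.truncation a _
    let G : Fin r → ℤ → ℤ → V := fun j p q => act (c' j) p (act (a' j) q x)
    have hL : ∀ j, Lau (G j) := fun j => by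
      refine lau_of_fTrunc ?_ fun q => hV.isHSModule.truncation _ _
      obtain ⟨K, hK⟩ := hV.isHSModule.truncation (a' j) x
      exact ⟨K, fun q hq p => by simp only [G]; rw [hK q hq]; exact smul_zero _⟩
    choose T hT hTI using fun j => (ih (a' j)).exists_isReexp hY (c' j)
    choose m hm using fun j => (hT j).2
    choose s₀ h₀ using fun j => exists_coeff_bound (f j)
    obtain ⟨M, hM⟩ : ∃ M : ℕ, ∀ j, (m j : ℤ) ≤ (M + 1 : ℕ) + s₀ j := by
      obtain ⟨K, hK⟩ := (Finset.univ.image fun j => m j - s₀ j).exists_le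
      refine ⟨K.toNat, fun j => ?_⟩
      have : m j - s₀ j ≤ K := hK _ (by simp)
      omega
    have hm' : ∀ j, (dg ^ m j) (T j)
        = (dg ^ m j) fun p => signedTheta (modes Y) one (G j p) := fun j => by
      rw [hm j]
      congr 1
      ext p l
      rw [hact, signedTheta_act hV hY (hV.isHSModule.truncation _ _)]
    -- the delta function is killed by `y - x`
    have h1 : mulLin (-1) F = ∑ j, tw 1 (f j) (G j) := by
      ext p q
      have e := fun p q => sub_eq_iff_eq_add.mp (hA.relation a c r c' a' f hS q p x)
      have e1 : F (p + 1) q = _ := e (p + 1) q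
      have e2 : F p (q + 1) = _ := e p (q + 1)
      rw [mulLin_apply, e1, e2]
      simp only [Finset.sum_apply]
      have : ∀ j, tw 1 (f j) (G j) p q = tw 0 (f j) (G j) (p + 1) q - tw 0 (f j) (G j) p (q + 1) :=
        fun j => tw_succ (hL j) (f j) 0 p q
      simp only [this, Finset.sum_sub_distrib, G]
      rw [show q + 1 + p + 1 = q + (p + 1) + 1 by ring]
      simp only [actLin_apply]
      module
    have h2 : (mulLin (-1) ^ (M + 1)) F = ∑ j, tw (M + 1 : ℕ) (f j) (G j) := by
      rw [pow_succ, Module.End.mul_apply, h1, map_sum]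
      refine Finset.sum_congr rfl fun j _ => ?_
      rw [mulLin_neg_one_tw (hL j), Nat.cast_succ, add_comm]
    have hp : FTrunc F := by
      obtain ⟨K, hK⟩ := hV.isHSModule.truncation c x
      exact ⟨K, fun p hp => by ext q; simp only [F]; rw [hK p hp]; exact smul_zero _⟩
    refine InSpan.of_dg_pow (M + 1) hp.signedTheta fun p => ?_
    have h3 : (dg ^ (M + 1)) (fun p => signedTheta (modes Y) one (F p)) p
        = fun l => ∑ j, (-1 : ℂ) ^ p •
            tw (M + 1 : ℕ) (f j) (fun l p => (-1 : ℂ) ^ p • T j p l) l p := by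
      ext l
      rw [← mulLin_one, ← neg_neg (1 : ℂ), mulLin_pow_signedTheta (-1) (M + 1) hFt, neg_neg, h2]
      have e : (∑ j, tw (M + 1 : ℕ) (f j) (G j)) p
          = fun q => ∑ j, tw (M + 1 : ℕ) (f j) (G j) p q := by
        ext q
        simp only [Finset.sum_apply]
      dsimp only
      rw [e, signedTheta_sum]
      · exact Finset.sum_congr rfl fun j _ => signedTheta_tw (hL j) (hT j).1
          (fun p => (hTI j p).fTrunc) (hm' j) (h₀ j) (hM j) p l
      · intro j _
        obtain ⟨K, hK⟩ := (hL j).1.tw (M + 1 : ℕ) (f j)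
        exact ⟨K, fun q hq => hK p q hq⟩
    rw [h3]
    refine InSpan.sum _ fun j _ => InSpan.smul (InSpan.tw ?_ ?_ _ _ _) _
    · obtain ⟨K, hK⟩ := (hT j).1
      exact lau_of_fTrunc ⟨K, fun q hq l => by rw [hK q hq]; exact smul_zero _⟩
        fun q => (hTI j q).fTrunc.smul _
    · exact fun q => (hTI j q).smul _

/-- Skew symmetry: `e^{xD} Y(u, -x) v` lies in the span of the `Y(v', x) u'`. -/
theorem inSpan_skew (hV : IsVacuumModule B S V one)
    (hY : IsFieldAction one (actLin H V) (modes Y)) (u v : V) :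
    InSpan Y (skew (modes Y) one u v) := by
  induction u using hV.induction with
  | h0 =>
    have := (inSpan_modes (Y := Y) 0 0).smul 0
    convert this using 1
    ext l
    rw [← zero_smul ℂ (0 : V), skew_smul_left]
    simp
  | hadd x y hx hy =>
    convert hx.add hy using 1
    exact funext fun l => skew_add_left hY _ _ _ l
  | hsmul c x hx =>
    convert hx.smul c using 1
    exact funext fun l => skew_smul_left _ _ _ l
  | hone =>
    convert (inSpan_modes (Y := Y) v one).smul (-1) using 1
    exact funext fun l => skew_one_left hV hY _ l
  | hact a p x ih =>
    exact inSpan_skew_act hV hY (fun v => inSpan_skew_act_neg_one hV hY v a) ih p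

/-- The fields which are determined by the operators `a(m)` on a vacuum module form a weak quantum
vertex algebra. -/
theorem isWeakQVA_of_isFieldAction (hV : IsVacuumModule B S V one)
    (hY : IsFieldAction one (actLin H V) (modes Y)) : IsWeakQVA one Y where
  vacuum n v := hY.one_apply n v
  creation_regular v n hn := (hY.creation hV v).1 n hn
  creation v := (hY.creation hV v).2
  jacobi u v := by
    obtain ⟨r, v', u', f, h⟩ := (inSpan_skew hV hY u v).exists_rep
    exact ⟨r, v', u', fun j => -f j, hY.sJacobi hV h⟩

end SkewSpan

end

end QVA

theorem proposition2p14
    {H : Type u} [AddCommGroup H] [Module ℂ H]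
    (B : LinearMap.BilinForm ℂ H)
    (S : H ⊗[ℂ] H →ₗ[ℂ] (H ⊗[ℂ] H) ⊗[ℂ] LaurentSeries ℂ)
    {V : Type v} [AddCommGroup V] [Module ℂ V] [Module (QVA.ModeAlgebra H) V]
    [IsScalarTower ℂ (QVA.ModeAlgebra H) V] (one : V)
    (hV : QVA.IsUniversalVacuumModule B S V one)
    (hinj : Function.Injective (fun a : H => (QVA.act a (-1) one : V))) :
    ∃ Y : V →ₗ[ℂ] VertexOperator ℂ V,
      (QVA.IsWeakQVA one Y ∧
        ∀ (a : H) (n : ℤ), QVA.vmode Y (QVA.act a (-1) one) n = QVA.act a n) ∧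
      (∀ Y' : V →ₗ[ℂ] VertexOperator ℂ V,
        (QVA.IsWeakQVA one Y' ∧
          ∀ (a : H) (n : ℤ), QVA.vmode Y' (QVA.act a (-1) one) n = QVA.act a n) → Y' = Y) ∧
      (∀ (W : Type w) [AddCommGroup W] [Module ℂ W] [Module (QVA.ModeAlgebra H) W]
        [IsScalarTower ℂ (QVA.ModeAlgebra H) W], QVA.IsHSModule B S W →
        ∃! YW : V →ₗ[ℂ] VertexOperator ℂ W,
          QVA.IsVAModule one Y YW ∧
            ∀ (a : H) (n : ℤ), QVA.vmode YW (QVA.act a (-1) one) n = QVA.act a n) := by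
  have hA := hV.isVacuumModule.isHSModule.isHSModes
  have hY := hV.isFieldAction hA
  refine ⟨hV.vertexOp hA, ⟨QVA.isWeakQVA_of_isFieldAction hV.isVacuumModule hY, fun a n =>
    funext fun w => hY.act_neg_one hA a n w⟩, fun Y' ⟨hY', hact⟩ => ?_, fun W _ _ _ _ hW => ?_⟩
  · refine QVA.modes_injective (QVA.IsFieldAction.ext hV.isVacuumModule ?_ hY)
    exact QVA.isFieldAction_of_isVAModule hV.isVacuumModule hact hY'.isVAModule fun a n w =>
      congrFun (hact a n) w
  · have hB := hW.isHSModes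
    have hYW := hV.isFieldAction hB
    refine ⟨hV.vertexOp hB, ⟨QVA.isVAModule_of_isFieldAction hV.isVacuumModule hB hY hYW,
      fun a n => funext fun w => hYW.act_neg_one hB a n w⟩, fun YW ⟨hM, hact⟩ => ?_⟩
    refine QVA.modes_injective (QVA.IsFieldAction.ext hV.isVacuumModule ?_ hYW)
    exact QVA.isFieldAction_of_isVAModule hV.isVacuumModule
      (fun a n => funext fun w => hY.act_neg_one hA a n w) hM fun a n w => congrFun (hact a n) w
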